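/- Let $C=(c_{ij})$ be a symmetrizable generalized Cartan matrix of size $n$ with symmetrizer $D=\mathrm{diag}(c_1,\dots,c_n)$, let $K$ be a field, and let $\Pi=\Pi(C,D)$ be the generalized preprojective algebra of Geiss–Leclerc–Schröer over $K$, with $H_i=K[\varepsilon_i]/(\varepsilon_i^{c_i})$. A $\Pi$-module $M$ is locally free if every $e_iM$ is free over $H_i$; if these ranks are finite they form its rank vector. The generalized simple module $E_i$ is the locally free module whose rank vector is the $i$-th unit vector; a module is $\mathbb E$-filtered if it has a finite filtration with all factors among the $E_j$; $\mathrm{sub}_iM$ is the largest submodule of $M$ all of whose composition factors are isomorphic to the simple module $S_i$ at the vertex $i$, and $\mathrm{sub}\,M=\bigoplus_i\mathrm{sub}_iM$. Rank vectors of $\Pi$-modules are viewed as elements of the root lattice $R=\bigoplus_i\mathbb Z\alpha_i$ (with $\alpha_1,\dots,\alpha_n$ linearly independent), and integral weights are $\gamma=\sum_i\gamma_i\varpi_i$, $\gamma_i\in\mathbb Z$. The Weyl group $W$ is generated by the simple reflections $s_i$; for $w\in W$ the difference $w\gamma-\gamma$ is regarded as an element of $R$ (determined by $s_i\varpi_j=\varpi_j-\delta_{ij}\alpha_i$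 and $s_i\alpha_j=\alpha_j-c_{ij}\alpha_i$). Let $\widetilde\Pi=\Pi(\widetilde C,\widetilde D)$ with $\widetilde C=\begin{pmatrix}C&-I_n\\-I_n&2I_n\end{pmatrix}$ and $\widetilde D=\begin{pmatrix}D&0\\0&D\end{pmatrix}$ be the framed preprojective algebra, with vertices $i$ and $i'$ for $1\le i\le n$. An $\mathbb E$-filtered $\widetilde\Pi$-module $T$ is stable if $\mathrm{sub}_iT=0$ for all unprimed $i$. A rank vector of a $\widetilde\Pi$-module is written $(\nu,\lambda)$, where $\nu\in R$ records the ranks at the vertices $i$, and $\lambda=-\sum_i\lambda_{i'}\varpi_i$ records the ranks $\lambda_{i'}$ at the vertices $i'$. Then for every weight $\gamma=w\lambda$ with $w\in W$ and $\lambda$ an anti-dominant integral weight there is, up to isomorphism, exactly one stable $\widetilde\Pi$-module $\widetilde N(\gamma)$ with rank vector $(w\lambda-\lambda,\lambda)$. There is an injective homomorphism $\widetilde N(\lambda)\to\widetilde N(w\lambda)$, and the cokernel of any such homomorphism is, up to isomorphism, one and the same $\Pi$-module $N(\gamma)$ (regarded as a $\widetilde\Pi$-module through the canonical surjection $\widetilde\Pi\to\Pi$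 that kills the idempotents $e_{i'}$). These finite-dimensional $\Pi$-modules depend only on $\gamma$ and satisfy: (1) If $\gamma$ is anti-dominant, then $N(\gamma)=0$. (2) Let $w\in W$ and let $i$ be a vertex with $\varpi_i-w\varpi_i\ne0$. Then $N(-w\varpi_i)$ is $\mathbb E$-filtered with rank vector $\varpi_i-w\varpi_i$ and $\mathrm{sub}\,N(-w\varpi_i)\cong E_i$. Conversely, every finite-dimensional locally free $\Pi$-module $M$ with rank vector $\varpi_i-w\varpi_i$ and $\mathrm{sub}\,M\cong E_i$ is isomorphic to $N(-w\varpi_i)$. (3) If $\gamma$ and $\delta$ lie in the same closed Weyl chamber, that is, $\gamma=w\lambda$ and $\delta=w\mu$ for one $w\in W$ and anti-dominant integral weights $\lambda,\mu$, then $N(\gamma+\delta)\cong N(\gamma)\oplus N(\delta)$. -/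

import Mathlib

universe u v w

/-- A symmetrizable generalized Cartan matrix `C` with rows and columns indexed by `ι`, a
symmetrizer `D = diag(c_i)` of `C`, and an orientation `Ω` of `C`. -/
structure CartanDatum (ι : Type w) where
  /-- the generalized Cartan matrix -/
  C : Matrix ι ι ℤ
  /-- the diagonal entries `c_i` of the symmetrizer -/
  c : ι → ℕ
  /-- the orientation -/
  Ω : ι → ι → Prop
  diag : ∀ i, C i i = 2
  nonpos : ∀ i j, i ≠ j → C i j ≤ 0
  zero_iff : ∀ i j, C i j = 0 ↔ C j i = 0
  c_pos : ∀ i, 1 ≤ c i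
  symm : ∀ i j, (c i : ℤ) * C i j = (c j : ℤ) * C j i
  orient : ∀ i j, (Ω i j ∨ Ω j i) ↔ C i j < 0
  acyclic : ∀ i, ¬ Relation.TransGen Ω i i

namespace CartanDatum

section Algebra

variable {ι : Type w} (S : CartanDatum ι)

/-- `g_{ij} = gcd(c_{ij}, c_{ji})`, used for `c_{ij} < 0`. -/
def g (i j : ι) : ℕ := Int.gcd (S.C i j) (S.C j i)

/-- `f_{ij} = |c_{ij}| / g_{ij}`, used for `c_{ij} < 0`. -/
def f (i j : ι) : ℕ := (S.C i j).natAbs / S.g i j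

open Classical in
/-- The sign `sgn(i, j)`: `1` for `(i, j) ∈ Ω` and `-1` for `(i, j)` in the opposite orientation. -/
noncomputable def sgn (K : Type u) [Field K] (i j : ι) : K := if S.Ω i j then 1 else -1

/-- Generators: the vertex idempotents `e_i`, the loops `ε_i : i → i` and the arrows
`α_{ij}^{(k)} : j → i`. In the double quiver only the arrows with `c_{ij} < 0` and `k < g_{ij}`
occur; the other symbols are set to zero in `Rel.arr_zero`. -/
inductive Gen (ι : Type w) : Type w
  | e (i : ι)
  | eps (i : ι)
  | arr (i j : ι) (k : ℕ)

section Rel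

variable (K : Type u) [Field K]

/-- The vertex idempotent as an element of the free algebra. -/
def fe (i : ι) : FreeAlgebra K (Gen ι) := FreeAlgebra.ι K (Gen.e i)
/-- The loop `ε_i` as an element of the free algebra. -/
def feps (i : ι) : FreeAlgebra K (Gen ι) := FreeAlgebra.ι K (Gen.eps i)
/-- The arrow `α_{ij}^{(k)}` as an element of the free algebra. -/
def farr (i j : ι) (k : ℕ) : FreeAlgebra K (Gen ι) := FreeAlgebra.ι K (Gen.arr i j k)

variable [Fintype ι]

/-- The relations of the path algebra of the double quiver (the first six) together with the
defining relations of the generalized preprojective algebra (the last three). -/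
inductive Rel : FreeAlgebra K (Gen ι) → FreeAlgebra K (Gen ι) → Prop
  | idem (i : ι) : Rel (fe K i * fe K i) (fe K i)
  | orth (i j : ι) (h : i ≠ j) : Rel (fe K i * fe K j) 0
  | one : Rel (∑ i, fe K i) 1
  | eps_vertex (i : ι) : Rel (fe K i * feps K i * fe K i) (feps K i)
  | arr_vertex (i j : ι) (k : ℕ) : Rel (fe K i * farr K i j k * fe K j) (farr K i j k)
  | arr_zero (i j : ι) (k : ℕ) (h : ¬ (S.C i j < 0 ∧ k < S.g i j)) : Rel (farr K i j k) 0
  | nilp (i : ι) : Rel (feps K i ^ S.c i) 0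
  | comm (i j : ι) (k : ℕ) (h : S.C i j < 0) (hk : k < S.g i j) :
      Rel (feps K i ^ S.f j i * farr K i j k) (farr K i j k * feps K j ^ S.f i j)
  | mesh (i : ι) :
      Rel (∑ j with S.C j i < 0, ∑ k ∈ Finset.range (S.g i j), ∑ l ∈ Finset.range (S.f j i),
        S.sgn K i j • (feps K i ^ l * farr K i j k * farr K j i k * feps K i ^ (S.f j i - 1 - l))) 0

/-- The generalized preprojective algebra `Π(C, D)` over the field `K`. -/
def Preproj : Type (max u w) := RingQuot (S.Rel K)

noncomputable instance : Ring (S.Preproj K) := inferInstanceAs (Ring (RingQuot (S.Rel K)))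
noncomputable instance : Algebra K (S.Preproj K) :=
  inferInstanceAs (Algebra K (RingQuot (S.Rel K)))

/-- The canonical projection from the free algebra. -/
noncomputable def quot : FreeAlgebra K (Gen ι) →ₐ[K] S.Preproj K := RingQuot.mkAlgHom K (S.Rel K)

/-- The idempotent `e_i` of `Π`. -/
noncomputable def e (i : ι) : S.Preproj K := S.quot K (fe K i)
/-- The element `ε_i` of `Π`. -/
noncomputable def eps (i : ι) : S.Preproj K := S.quot K (feps K i)
/-- The element `α_{ij}^{(k)}` of `Π`. -/
noncomputable def arr (i j : ι) (k : ℕ) : S.Preproj K := S.quot K (farr K i j k)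

variable {S K} in
theorem quot_rel {x y : FreeAlgebra K (Gen ι)} (h : S.Rel K x y) : S.quot K x = S.quot K y :=
  RingQuot.mkAlgHom_rel K h

theorem e_mul_eps (i : ι) : S.e K i * S.eps K i = S.eps K i := by
  have h1 := quot_rel (Rel.eps_vertex (S := S) (K := K) i)
  have h2 := quot_rel (Rel.idem (S := S) (K := K) i)
  simp only [map_mul] at h1 h2
  change S.e K i * S.eps K i * S.e K i = S.eps K i at h1
  change S.e K i * S.e K i = S.e K i at h2
  rw [← h1, ← mul_assoc, ← mul_assoc, h2]

theorem eps_pow (i : ι) : S.eps K i ^ S.c i = 0 := by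
  have h1 := quot_rel (Rel.nilp (S := S) (K := K) i)
  rw [map_pow, map_zero] at h1
  exact h1

end Rel

end Algebra

section Modules

variable {ι : Type w} [Fintype ι] (S : CartanDatum ι) (K : Type u) [Field K]

/-- `H_i = K[ε_i] / (ε_i ^ c_i)`. -/
abbrev H (i : ι) : Type u :=
  Polynomial K ⧸ Ideal.span {(Polynomial.X ^ S.c i : Polynomial K)}

variable (M : Type v) [AddCommGroup M] [Module K M] [Module (S.Preproj K) M]
  [IsScalarTower K (S.Preproj K) M]

/-- The subspace `e_i M` of a `Π`-module `M`. -/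
noncomputable def vertexSpace (i : ι) : Submodule K M :=
  LinearMap.range (Algebra.lsmul K K M (S.e K i))

theorem eps_mem (i : ι) (x : M) : S.eps K i • x ∈ S.vertexSpace K M i :=
  ⟨S.eps K i • x, by
    change S.e K i • S.eps K i • x = _
    rw [← mul_smul, e_mul_eps]⟩

/-- The action of `ε_i` on `e_i M`. -/
noncomputable def epsEnd (i : ι) : Module.End K (S.vertexSpace K M i) :=
  (Algebra.lsmul K K M (S.eps K i)).restrict fun x _ => S.eps_mem K M i x

theorem epsEnd_pow_apply (i : ι) (n : ℕ) (x : S.vertexSpace K M i) :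
    (((S.epsEnd K M i) ^ n) x : M) = S.eps K i ^ n • (x : M) := by
  induction n with
  | zero => simp
  | succ n ih =>
    rw [pow_succ', pow_succ', mul_smul, ← ih]
    rfl

/-- The `K`-algebra homomorphism from `H_i` to the endomorphisms of `e_i M`. -/
noncomputable def HAction (i : ι) : S.H K i →ₐ[K] Module.End K (S.vertexSpace K M i) :=
  Ideal.Quotient.liftₐ _ (Polynomial.aeval (S.epsEnd K M i)) (by
    intro a ha
    obtain ⟨b, rfl⟩ := Ideal.mem_span_singleton'.mp ha
    have h : S.epsEnd K M i ^ S.c i = 0 := by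
      ext x
      rw [epsEnd_pow_apply, eps_pow]
      simp
    rw [map_mul, map_pow, Polynomial.aeval_X, h, mul_zero])

/-- The `H_i`-module structure of `e_i M`. -/
noncomputable instance vertexModule (i : ι) : Module (S.H K i) (S.vertexSpace K M i) :=
  Module.compHom _ (S.HAction K M i).toRingHom

/-- `M` is locally free of finite rank, with rank vector `r`. -/
def HasRankVec (r : ι → ℤ) : Prop :=
  ∀ i, Module.Free (S.H K i) (S.vertexSpace K M i) ∧ Module.Finite (S.H K i) (S.vertexSpace K M i) ∧
    (Module.finrank (S.H K i) (S.vertexSpace K M i) : ℤ) = r i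

/-- `M` is (isomorphic to) the generalized simple module `E_i`: the space `e_i M` is isomorphic to
`H_i`, and `e_j M = 0` for `j ≠ i`. -/
def IsGenSimple [DecidableEq ι] (i : ι) : Prop := S.HasRankVec K M (Pi.single i 1)

/-- `M` is (isomorphic to) the simple module `S_i`: it is one-dimensional, located at the vertex
`i`, and all loops and arrows act by zero. -/
def IsVertexSimple (i : ι) : Prop :=
  Module.finrank K M = 1 ∧ (∀ x : M, S.e K i • x = x) ∧ (∀ j, ∀ x : M, S.eps K j • x = 0) ∧
    ∀ j l k, ∀ x : M, S.arr K j l k • x = 0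

/-- `M` is `𝔼`-filtered: it has a finite filtration all of whose factors are generalized simple
modules. -/
def IsEFiltered [DecidableEq ι] : Prop :=
  ∃ (n : ℕ) (F : ℕ → Submodule (S.Preproj K) M), F 0 = ⊥ ∧ F n = ⊤ ∧
    ∀ k < n, F k ≤ F (k + 1) ∧ ∃ j, S.IsGenSimple K (F (k + 1) ⧸ (F k).submoduleOf (F (k + 1))) j

/-- `sub_i M`: the largest submodule of `M` all of whose composition factors are isomorphic to
`S_i`. -/
noncomputable def subAt (i : ι) : Submodule (S.Preproj K) M :=
  sSup {N | ∀ A B : Submodule (S.Preproj K) M, A ⋖ B → B ≤ N →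
    S.IsVertexSimple K (B ⧸ A.submoduleOf B) i}

/-- `sub M`, the (automatically direct) sum of all the `sub_i M`. -/
noncomputable def sub : Submodule (S.Preproj K) M := ⨆ i, S.subAt K M i

end Modules

/-- A finite-dimensional module over a `K`-algebra `A`, bundled. -/
structure FinDimMod (K : Type u) (A : Type v) [Field K] [Ring A] [Algebra K A] where
  /-- the underlying space -/
  carrier : Type u
  [addCommGroup : AddCommGroup carrier]
  [moduleK : Module K carrier]
  [moduleA : Module A carrier]
  [isScalarTower : IsScalarTower K A carrier]
  [finite : Module.Finite K carrier]

attribute [instance] FinDimMod.addCommGroup FinDimMod.moduleK FinDimMod.moduleA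
  FinDimMod.isScalarTower FinDimMod.finite

instance (K : Type u) (A : Type v) [Field K] [Ring A] [Algebra K A] :
    CoeSort (FinDimMod K A) (Type u) := ⟨FinDimMod.carrier⟩

section Weyl

variable {ι : Type w} [Fintype ι] [DecidableEq ι] (S : CartanDatum ι)

/-- The formal sums `∑ ν_i α_i + ∑ γ_i ϖ_i` of simple roots and fundamental weights, as pairs
`(ν, γ)`. The root lattice consists of the pairs `(ν, 0)`. Here the simple roots stay linearly
independent even if `C` is singular. -/
abbrev ExtLattice (ι : Type w) : Type w := (ι → ℤ) × (ι → ℤ)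

/-- The pairing with the simple coroot `α_i^∨`: it takes `α_j` to `c_{ij}` and `ϖ_j` to
`δ_{ij}`. -/
def coroot (i : ι) : ExtLattice ι →ₗ[ℤ] ℤ :=
  LinearMap.proj i ∘ₗ S.C.mulVecLin ∘ₗ LinearMap.fst ℤ (ι → ℤ) (ι → ℤ) +
    LinearMap.proj i ∘ₗ LinearMap.snd ℤ (ι → ℤ) (ι → ℤ)

theorem coroot_simple (i : ι) : S.coroot i ((Pi.single i 1, 0) : ExtLattice ι) = 2 := by
  simp [coroot, S.diag]

/-- The simple reflection `s_i`, with `s_i x = x - ⟨x, α_i^∨⟩ α_i`. -/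
def s (i : ι) : ExtLattice ι ≃ₗ[ℤ] ExtLattice ι := Module.reflection (S.coroot_simple i)

/-- The Weyl group, generated by the simple reflections. -/
def W : Subgroup (ExtLattice ι ≃ₗ[ℤ] ExtLattice ι) := Subgroup.closure (Set.range S.s)

/-- The weight of a formal sum of simple roots and fundamental weights, in the basis of the
fundamental weights: `α_i = ∑ c_{ji} ϖ_j`. -/
def toWeight (x : ExtLattice ι) : ι → ℤ := S.C.mulVec x.1 + x.2

/-- The weight `w γ`, for an integral weight `γ = ∑ γ_i ϖ_i`. -/
def act (w : ExtLattice ι ≃ₗ[ℤ] ExtLattice ι) (γ : ι → ℤ) : ι → ℤ := S.toWeight (w (0, γ))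

/-- The element `w γ - γ` of the root lattice, in the basis of the simple roots, for an element `w`
of the Weyl group and an integral weight `γ`. -/
def disp (w : ExtLattice ι ≃ₗ[ℤ] ExtLattice ι) (γ : ι → ℤ) : ι → ℤ := (w (0, γ) - (0, γ)).1

/-- Anti-dominant integral weights. -/
def AntiDominant (γ : ι → ℤ) : Prop := ∀ i, γ i ≤ 0

/-- The two weights lie in a common closed Weyl chamber `w (-C_0)`, `w ∈ W`. -/
def SameChamber (γ δ : ι → ℤ) : Prop :=
  ∃ w ∈ S.W, ∃ l m : ι → ℤ, AntiDominant l ∧ AntiDominant m ∧ γ = S.act w l ∧ δ = S.act w m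

end Weyl

section Framed

variable {ι : Type w} (S : CartanDatum ι)

/-- The orientation of the framed datum: all of `Ω`, and `(i', i)` for every vertex `i`. -/
def framedΩ : ι ⊕ ι → ι ⊕ ι → Prop
  | .inl i, .inl j => S.Ω i j
  | .inr i, .inl j => i = j
  | _, .inr _ => False

theorem framedΩ_acyclic (x : ι ⊕ ι) : ¬ Relation.TransGen S.framedΩ x x := by
  have h1 : ∀ a b, Relation.TransGen S.framedΩ a b → ∃ j, b = Sum.inl j := by
    intro a b h
    cases h with
    | single h => rcases a with a | a <;> rcases b with b | b <;> simp_all [framedΩ]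
    | @tail c _ _ h => rcases c with a | a <;> rcases b with b | b <;> simp_all [framedΩ]
  have h2 : ∀ i b, Relation.TransGen S.framedΩ (Sum.inl i) b →
      ∃ j, b = Sum.inl j ∧ Relation.TransGen S.Ω i j := by
    intro i b h
    induction h with
    | @single b h =>
      rcases b with b | b
      · exact ⟨b, rfl, .single h⟩
      · exact h.elim
    | @tail b c _ h ih =>
      obtain ⟨j, rfl, hj⟩ := ih
      rcases c with c | c
      · exact ⟨c, rfl, hj.tail h⟩
      · exact h.elim
  intro h
  obtain ⟨j, rfl⟩ := h1 _ _ h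
  obtain ⟨k, hk, h⟩ := h2 _ _ h
  cases hk
  exact S.acyclic j h

variable [DecidableEq ι]

/-- The framed datum, on the vertices `i` (as `Sum.inl i`) and `i'` (as `Sum.inr i`), with Cartan
matrix `(C, -1; -1, 2)` and symmetrizer `(D, 0; 0, D)`. -/
def framed : CartanDatum (ι ⊕ ι) where
  C := Matrix.fromBlocks S.C (-1) (-1) (Matrix.diagonal fun _ => 2)
  c := Sum.elim S.c S.c
  Ω := S.framedΩ
  diag := by rintro (i | i) <;> simp [S.diag]
  nonpos := by
    rintro (i | i) (j | j) h
    · exact S.nonpos i j (by simpa using h)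
    · by_cases hij : i = j <;> simp [hij]
    · by_cases hij : i = j <;> simp [hij]
    · have hij : i ≠ j := by simpa using h
      simp [hij]
  zero_iff := by
    rintro (i | i) (j | j)
    · exact S.zero_iff i j
    · simp [Matrix.one_apply, eq_comm]
    · simp [Matrix.one_apply, eq_comm]
    · simp [Matrix.diagonal_apply, eq_comm]
  c_pos := by rintro (i | i) <;> exact S.c_pos i
  symm := by
    rintro (i | i) (j | j)
    · exact S.symm i j
    · by_cases hij : i = j
      · simp [hij]
      · simp [hij, Ne.symm hij]
    · by_cases hij : i = j
      · simp [hij]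
      · simp [hij, Ne.symm hij]
    · by_cases hij : i = j
      · simp [hij]
      · simp [hij, Ne.symm hij]
  orient := by
    rintro (i | i) (j | j)
    · exact S.orient i j
    · by_cases hij : i = j
      · simp [hij, framedΩ]
      · simp [hij, framedΩ, Ne.symm hij]
    · by_cases hij : i = j
      · simp [hij, framedΩ]
      · simp [hij, framedΩ]
    · by_cases hij : i = j
      · simp [hij, framedΩ]
      · simp [hij, framedΩ]
  acyclic := S.framedΩ_acyclic

variable [Fintype ι] (K : Type u) [Field K]

/-- The framed preprojective algebra. -/
abbrev FPreproj : Type (max u w) := S.framed.Preproj K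

/-- The images in `Π` of the generators of the framed algebra: generators at the original vertices
are kept, all those which involve a framing vertex go to zero. -/
noncomputable def unframeGen : Gen (ι ⊕ ι) → S.Preproj K
  | .e (.inl i) => S.e K i
  | .eps (.inl i) => S.eps K i
  | .arr (.inl i) (.inl j) k => S.arr K i j k
  | _ => 0

theorem unframe_rel (x y : FreeAlgebra K (Gen (ι ⊕ ι))) (h : S.framed.Rel K x y) :
    FreeAlgebra.lift K (S.unframeGen K) x = FreeAlgebra.lift K (S.unframeGen K) y := by
  have he : ∀ i, FreeAlgebra.lift K (S.unframeGen K) (fe K i) = S.unframeGen K (.e i) :=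
    fun i => FreeAlgebra.lift_ι_apply _ _
  have heps : ∀ i, FreeAlgebra.lift K (S.unframeGen K) (feps K i) = S.unframeGen K (.eps i) :=
    fun i => FreeAlgebra.lift_ι_apply _ _
  have harr : ∀ i j k, FreeAlgebra.lift K (S.unframeGen K) (farr K i j k) =
      S.unframeGen K (.arr i j k) := fun i j k => FreeAlgebra.lift_ι_apply _ _
  cases h with
  | idem i =>
    rcases i with i | i
    · simpa [he, unframeGen, e] using quot_rel (Rel.idem (S := S) (K := K) i)
    · simp [he, unframeGen]
  | orth i j h =>
    rcases i with i | i <;> rcases j with j | j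
    · simpa [he, unframeGen, e] using
        quot_rel (Rel.orth (S := S) (K := K) i j (by simpa using h))
    all_goals simp [he, unframeGen]
  | one =>
    simpa [he, unframeGen, e] using quot_rel (Rel.one (S := S) (K := K))
  | eps_vertex i =>
    rcases i with i | i
    · simpa [he, heps, unframeGen, e, eps] using quot_rel (Rel.eps_vertex (S := S) (K := K) i)
    · simp [he, heps, unframeGen]
  | arr_vertex i j k =>
    rcases i with i | i <;> rcases j with j | j
    · simpa [he, harr, unframeGen, e, arr] using
        quot_rel (Rel.arr_vertex (S := S) (K := K) i j k)
    all_goals simp [he, harr, unframeGen]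
  | arr_zero i j k h =>
    rcases i with i | i <;> rcases j with j | j
    · simpa [harr, unframeGen, arr] using quot_rel (Rel.arr_zero (S := S) (K := K) i j k h)
    all_goals simp [harr, unframeGen]
  | nilp i =>
    rcases i with i | i
    · simpa [heps, unframeGen, eps, framed] using quot_rel (Rel.nilp (S := S) (K := K) i)
    · have := S.c_pos i
      have h0 : S.framed.c (Sum.inr i) ≠ 0 := by
        change S.c i ≠ 0
        omega
      simp [heps, unframeGen, h0]
  | comm i j k h hk =>
    rcases i with i | i <;> rcases j with j | j
    · have h1 := quot_rel (Rel.comm (S := S) (K := K) i j k h hk)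
      simp only [map_mul, map_pow, heps, harr, unframeGen] at h1 ⊢
      exact h1
    all_goals simp [heps, harr, unframeGen]
  | mesh i =>
    rcases i with i | i
    · have h1 := quot_rel (Rel.mesh (S := S) (K := K) i)
      simp only [Finset.sum_filter, Fintype.sum_sum_type, map_add, map_sum, apply_ite (S.quot K),
        apply_ite (FreeAlgebra.lift K (S.unframeGen K)), map_smul, map_mul, map_pow,
        heps, harr, unframeGen, map_zero, mul_zero, zero_mul, smul_zero, Finset.sum_const_zero,
        ite_self, add_zero] at h1 ⊢
      exact h1
    · simp only [Finset.sum_filter, Fintype.sum_sum_type, map_add, map_sum,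
        apply_ite (FreeAlgebra.lift K (S.unframeGen K)), map_smul, map_mul, map_pow,
        harr, unframeGen, map_zero, mul_zero, zero_mul, smul_zero, Finset.sum_const_zero,
        ite_self, add_zero]

/-- The canonical surjection from the framed algebra to `Π`, with kernel generated by the
idempotents at the framing vertices. -/
noncomputable def unframe : S.FPreproj K →ₐ[K] S.Preproj K :=
  RingQuot.liftAlgHom K ⟨FreeAlgebra.lift K (S.unframeGen K), S.unframe_rel K⟩

variable (T : Type v) [AddCommGroup T] [Module K T] [Module (S.FPreproj K) T]
  [IsScalarTower K (S.FPreproj K) T]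

/-- `T` is a stable module over the framed algebra: it is `𝔼`-filtered, and `sub_i T = 0` for every
original vertex `i`. -/
def IsStable : Prop :=
  S.framed.IsEFiltered K T ∧ ∀ i : ι, S.framed.subAt K T (Sum.inl i) = ⊥

end Framed

end CartanDatum

set_option linter.unusedSectionVars false

/-! The modules are built, and recognised, by reflections along a reduced expression of `w`. At a
vertex `i`, the mesh relation says that the maps M_out and M_in between `M_i` and the sum of the
twisted neighbouring spaces (`tout` and `tin` on `tilde`) form a complex. Replacing `M_i` by the
kernel of M_in gives a module `Refl`, into which `M` embeds if M_out is injective. Conversely, a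
module with M_out injective and the complex exact in the middle is the reflection of every submodule
containing the spaces at the other vertices (`nonempty_equiv_refl`). The submodule used is `genSub`,
whose space at `i` is the image of M_in.

The rank vectors `(wλ - λ, λ)` are special because they are extremal. The dimensions of a framed
module define a point `dimWeight` in the span of roots and weights. Since M_in kills the image of
M_out, `s_i` sends the point of `T` to the point of `genSub` plus a multiple of `α_i`, which is
nonnegative when M_out is injective and vanishes exactly when the complex is then exact in the
middle (`s_dimWeight`). If M_out is injective at all original vertices (`Prestable`), induction
shows that `u⁻¹` of this point has a nonnegative root part for every `u` reached by
length-increasing steps (`Red.dimWeight_nonneg`). At an extremal weight this leaves no room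
(`Red.eq_zero_of_dimWeight`): a module of weight `s_i u λ` is exact in the middle at `i` and its
`genSub` has weight `u λ` (`Red.midExact`), while for a module of weight `u λ` the map M_in is onto
and the reflection has weight `s_i u λ` (`Red.exists_model`). Uniqueness and existence follow by
induction on `w`, starting from a module supported on the framing. Every `w` is reached, by the
positivity theorem for roots (`wordProd_root_nonneg`), which reduces to dihedral subgroups.

Stable means `𝔼`-filtered and prestable, because `sub_i` is the kernel of M_out at `i`
(`subAt_eq_outKer`); uniqueness needs only prestability and the rank vector. A reflection step adds
to the module a factor which is concentrated at `i` and free over `H_i`, so filtrations extend, both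
for the framed modules and for their quotients. The framing part remains a submodule without arrows,
and the quotient by it is a `Π`-module.

For `λ = -ϖ_i` the first step that changes the module attaches a copy of `H_i` on which the framing
arrow is bijective. This copy gives the socle of the quotient (`IsUnframing.isGenSimple_sub`).
Conversely, a functional detecting the socle of a module `M` with socle `E_i` yields an `H_i`-linear
map from `M` to `H_i` which is injective on the socle; it makes `M` the quotient of a prestable
framed module (`Coframe`), and uniqueness applies. Part (3) is uniqueness applied to the product of
two of the stable modules. -/

namespace CartanDatum

/-! ### The Weyl group: positivity of roots and the anti-dominant chamber -/

section WeylGroup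

variable {ι : Type w} [Fintype ι] [DecidableEq ι] (S : CartanDatum ι)

/-- The simple root `α_i` in the extended lattice. -/
def root (i : ι) : ExtLattice ι := (Pi.single i 1, 0)

theorem s_apply (i : ι) (x : ExtLattice ι) : S.s i x = x - S.coroot i x • root i := rfl

theorem coroot_apply (i : ι) (x : ExtLattice ι) : S.coroot i x = S.C.mulVec x.1 i + x.2 i := rfl

theorem coroot_root (i j : ι) : S.coroot i (root j) = S.C i j := by
  simp [coroot_apply, root]

theorem s_s (i : ι) (x : ExtLattice ι) : S.s i (S.s i x) = x := by
  rw [s_apply, s_apply]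
  simp only [map_sub, map_smul, coroot_root, S.diag, smul_eq_mul]
  module

theorem s_mul_s (i : ι) : S.s i * S.s i = 1 := by
  ext1 x; exact S.s_s i x

theorem s_inv (i : ι) : (S.s i)⁻¹ = S.s i :=
  inv_eq_of_mul_eq_one_left (S.s_mul_s i)

theorem s_comb (i j : ι) (x : ExtLattice ι) (a b : ℤ) :
    S.s i (x + a • root i + b • root j) =
      x + (-a - S.coroot i x - S.C i j * b) • root i + b • root j := by
  rw [s_apply]
  simp only [map_add, map_smul, coroot_root, S.diag, smul_eq_mul]
  module

theorem s_comb' (i j : ι) (x : ExtLattice ι) (a b : ℤ) :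
    S.s j (x + a • root i + b • root j) =
      x + a • root i + (-b - S.coroot j x - S.C j i * a) • root j := by
  rw [s_apply]
  simp only [map_add, map_smul, coroot_root, S.diag, smul_eq_mul]
  module

/-- The product of the simple reflections of a word. -/
def wordProd (a : List ι) : ExtLattice ι ≃ₗ[ℤ] ExtLattice ι := (a.map S.s).prod

theorem wordProd_nil : S.wordProd [] = 1 := rfl

theorem wordProd_cons (i : ι) (a : List ι) : S.wordProd (i :: a) = S.s i * S.wordProd a := by
  simp [wordProd]

theorem wordProd_append (a b : List ι) :
    S.wordProd (a ++ b) = S.wordProd a * S.wordProd b := by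
  simp [wordProd]

theorem wordProd_singleton (i : ι) : S.wordProd [i] = S.s i := by
  simp [wordProd]

theorem wordProd_reverse (a : List ι) : S.wordProd a.reverse = (S.wordProd a)⁻¹ := by
  induction a with
  | nil => simp [wordProd]
  | cons i a ih =>
    rw [List.reverse_cons, wordProd_append, wordProd_singleton, ih, wordProd_cons, mul_inv_rev,
      s_inv]

theorem exists_wordProd {x : ExtLattice ι ≃ₗ[ℤ] ExtLattice ι} (hx : x ∈ S.W) :
    ∃ a, S.wordProd a = x := by
  induction hx using Subgroup.closure_induction with
  | mem x hx => obtain ⟨i, rfl⟩ := hx; exact ⟨[i], S.wordProd_singleton i⟩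
  | one => exact ⟨[], rfl⟩
  | mul x y _ _ hx hy =>
    obtain ⟨a, rfl⟩ := hx
    obtain ⟨b, rfl⟩ := hy
    exact ⟨a ++ b, S.wordProd_append a b⟩
  | inv x _ hx =>
    obtain ⟨a, rfl⟩ := hx
    exact ⟨a.reverse, S.wordProd_reverse a⟩

/-- The word `a` is at most as long as every word for the element `x`. -/
def ShortFor (a : List ι) (x : ExtLattice ι ≃ₗ[ℤ] ExtLattice ι) : Prop :=
  ∀ b, S.wordProd b = x → a.length ≤ b.length

/-- The alternating product `⋯ s_i s_j s_i` with `k` factors, ending in `s_i`. -/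
def alt : ℕ → ι → ι → (ExtLattice ι ≃ₗ[ℤ] ExtLattice ι)
  | 0, _, _ => 1
  | k + 1, i, j => alt k j i * S.s i

/-- The alternating word `⋯, i, j, i` with `k` letters. -/
def altWord : ℕ → ι → ι → List ι
  | 0, _, _ => []
  | k + 1, i, j => altWord k j i ++ [i]

theorem altWord_length (k : ℕ) (i j : ι) : (altWord k i j).length = k := by
  induction k generalizing i j with
  | zero => rfl
  | succ k ih => simp [altWord, ih]

theorem wordProd_altWord (k : ℕ) (i j : ι) : S.wordProd (altWord k i j) = S.alt k i j := by
  induction k generalizing i j with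
  | zero => rfl
  | succ k ih => rw [altWord, wordProd_append, ih, wordProd_singleton, alt]

/-- A reduced word in two letters `i, j` which does not end in `i` is alternating. -/
theorem eq_altWord (i j : ι) (d : List ι) (hd : ∀ x ∈ d, x = i ∨ x = j)
    (h1 : S.ShortFor d (S.wordProd d)) (h2 : S.ShortFor d (S.wordProd d * S.s i)) :
    d = altWord d.length j i := by
  induction d using List.reverseRecOn generalizing i j with
  | nil => rfl
  | append_singleton d x ih =>
    have hx : x = j := by
      rcases hd x (by simp) with rfl | rfl
      · have := h2 d (by rw [wordProd_append, wordProd_singleton, mul_assoc, s_mul_s, mul_one])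
        simp at this
      · rfl
    subst hx
    have hd' : ∀ y ∈ d, y = x ∨ y = i := fun y hy => (hd y (by simp [hy])).symm
    have e := ih x i hd' ?_ ?_
    · rw [List.length_append, List.length_singleton, altWord]
      rw [← e]
    · intro b hb
      have := h1 (b ++ [x]) (by rw [wordProd_append, wordProd_append, hb])
      simpa using this
    · intro b hb
      have := h1 b (by rw [hb, wordProd_append, wordProd_singleton])
      simp at this
      omega

theorem alt_add (m k : ℕ) (i j : ι) : ∃ i' j', S.alt (k + m) i j = S.alt k i' j' * S.alt m i j := by
  induction m generalizing i j with
  | zero => exact ⟨i, j, by simp [alt]⟩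
  | succ m ih =>
    obtain ⟨i', j', h⟩ := ih j i
    exact ⟨i', j', by rw [← add_assoc, alt, h, alt, mul_assoc]⟩

/-- A longer alternating word has `m + 1` final letters to which the braid relation applies.
Afterwards it ends in `i`, so multiplication by `s_i` cancels a letter, and the product has a word
of length `k - 1`. -/
theorem lt_of_braid (m k : ℕ) (i j : ι) (hb : S.alt (m + 1) i j = S.alt (m + 1) j i)
    (h : S.ShortFor (altWord k j i) (S.alt k j i * S.s i)) : k ≤ m := by
  by_contra! hk
  obtain ⟨r, rfl⟩ : ∃ r, k = r + (m + 1) := ⟨k - (m + 1), by omega⟩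
  obtain ⟨i', j', e⟩ := S.alt_add (m + 1) r j i
  have e2 : S.alt (r + (m + 1)) j i * S.s i = S.alt r i' j' * S.alt m j i := by
    rw [e, ← hb, alt, mul_assoc, mul_assoc, s_mul_s, mul_one]
  have := h (altWord r i' j' ++ altWord m j i) (by
    rw [wordProd_append, wordProd_altWord, wordProd_altWord, e2])
  simp [altWord_length] at this

theorem comb_zero (i j : ι) (x : ExtLattice ι) :
    x = x + (0 : ℤ) • root i + (0 : ℤ) • root j := by
  simp

/-- The braid relations of the finite rank two types. Both sides change only the coefficients of
`α_i` and `α_j`, by affine expressions in the two coroot values, which are compared directly. -/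
theorem braid2 (i j : ι) (h1 : S.C i j = 0) (h2 : S.C j i = 0) :
    S.alt 2 i j = S.alt 2 j i := by
  ext1 x
  simp only [alt, LinearEquiv.mul_apply, LinearEquiv.coe_one, id]
  -- The zero multiples bring the vector into the normal form on which `s_comb` and `s_comb'`
  -- rewrite.
  rw [comb_zero i j x]
  simp only [s_comb, s_comb', h1, h2]
  module

theorem braid3 (i j : ι) (h1 : S.C i j = -1) (h2 : S.C j i = -1) :
    S.alt 3 i j = S.alt 3 j i := by
  ext1 x
  simp only [alt, LinearEquiv.mul_apply, LinearEquiv.coe_one, id]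
  rw [comb_zero i j x]
  simp only [s_comb, s_comb', h1, h2]
  module

theorem braid4 (i j : ι) (h1 : S.C i j = -1) (h2 : S.C j i = -2) :
    S.alt 4 i j = S.alt 4 j i := by
  ext1 x
  simp only [alt, LinearEquiv.mul_apply, LinearEquiv.coe_one, id]
  rw [comb_zero i j x]
  simp only [s_comb, s_comb', h1, h2]
  module

theorem braid6 (i j : ι) (h1 : S.C i j = -1) (h2 : S.C j i = -3) :
    S.alt 6 i j = S.alt 6 j i := by
  ext1 x
  simp only [alt, LinearEquiv.mul_apply, LinearEquiv.coe_one, id]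
  rw [comb_zero i j x]
  simp only [s_comb, s_comb', h1, h2]
  module

/-- Nonnegative combinations of two simple roots. -/
def InCone (i j : ι) (x : ExtLattice ι) : Prop :=
  ∃ a b : ℤ, 0 ≤ a ∧ 0 ≤ b ∧ x = a • root i + b • root j

theorem s_comb0 (i j : ι) (a b : ℤ) :
    S.s i (a • root i + b • root j) = (-a - S.C i j * b) • root i + b • root j := by
  have := S.s_comb i j 0 a b
  simpa using this

/-- The infinite dihedral case. The reflection replaces `a` by `a' = -a - c_ij b`, and `2a ≤ -c_ij
b` gives `2a' ≥ -c_ij b`. Since `c_ij c_ji ≥ 4`, this yields `2b ≤ -c_ji a'`, the same inequality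
with the letters exchanged. -/
theorem alt_cone_aux (i j : ι) (k : ℕ) (a b : ℤ) (ha : 0 ≤ a) (hb : 0 ≤ b)
    (hij : S.C i j ≤ 0) (hji : S.C j i ≤ 0) (h4 : 4 ≤ S.C i j * S.C j i)
    (hab : 2 * a ≤ -S.C i j * b) :
    InCone i j (S.alt k i j (a • root i + b • root j)) := by
  induction k generalizing i j a b with
  | zero => exact ⟨a, b, ha, hb, rfl⟩
  | succ k ih =>
    rw [alt, LinearEquiv.mul_apply, s_comb0, add_comm]
    have hcj : S.C j i < 0 := by
      rcases hji.lt_or_eq with h | h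
      · exact h
      · rw [h] at h4; omega
    have ha' : 0 ≤ -a - S.C i j * b := by nlinarith
    obtain ⟨x, y, hx, hy, e⟩ := ih j i b (-a - S.C i j * b) hb ha' hji hij (by linarith) (by
      nlinarith)
    exact ⟨y, x, hy, hx, by rw [e, add_comm]⟩

/-- Positivity in rank two. If `c_ij c_ji ≥ 4`, every alternating product keeps the root positive.
Otherwise a braid relation bounds `k`, and the finitely many remaining roots are computed. -/
theorem alt_root_cone (i j : ι) (k : ℕ) (hij : i ≠ j)
    (h : S.ShortFor (altWord k j i) (S.alt k j i * S.s i)) :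
    InCone i j (S.alt k j i (root i)) := by
  have hp := S.nonpos i j hij
  have hq := S.nonpos j i hij.symm
  by_cases h4 : 4 ≤ S.C i j * S.C j i
  · cases k with
    | zero => exact ⟨1, 0, by norm_num, le_rfl, by simp [alt]⟩
    | succ k =>
      obtain ⟨x, y, hx, hy, e⟩ := S.alt_cone_aux j i (k + 1) 0 1 le_rfl zero_le_one hq hp
        (by linarith) (by simpa using hq)
      refine ⟨y, x, hy, hx, ?_⟩
      rw [add_comm (y • root i), ← e]
      simp
  have key : ∀ m, (∀ k ≤ m, InCone i j (S.alt k j i (root i))) →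
      S.alt (m + 1) i j = S.alt (m + 1) j i → InCone i j (S.alt k j i (root i)) :=
    fun m h1 h2 => h1 k (S.lt_of_braid m k i j h2 h)
  have hcomp : ∀ k, S.alt k j i (root i) = S.alt k j i ((1 : ℤ) • root i + (0 : ℤ) • root j) := by
    intro k; simp
  have e1 := S.s_comb0 i j
  have e2 : ∀ a b : ℤ, S.s j (a • root i + b • root j) =
      a • root i + (-b - S.C j i * a) • root j := fun a b => by
    rw [add_comm, s_comb0, add_comm]
  have hzero := S.zero_iff i j
  -- Both entries are nonpositive and vanish together, and their product is less than 4: the types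
  -- A₁ × A₁, A₂, B₂ and G₂.
  obtain ⟨h1, h2⟩ | ⟨h1, h2⟩ | ⟨h1, h2⟩ | ⟨h1, h2⟩ | ⟨h1, h2⟩ | ⟨h1, h2⟩ :
      (S.C i j = 0 ∧ S.C j i = 0) ∨ (S.C i j = -1 ∧ S.C j i = -1) ∨
      (S.C i j = -1 ∧ S.C j i = -2) ∨ (S.C i j = -2 ∧ S.C j i = -1) ∨
      (S.C i j = -1 ∧ S.C j i = -3) ∨ (S.C i j = -3 ∧ S.C j i = -1) := by
    rcases hp.lt_or_eq with hp' | hp'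
    · have hq' : S.C j i < 0 := lt_of_le_of_ne hq fun h0 => hp'.ne (hzero.mpr h0)
      have b1 : -3 ≤ S.C i j := by nlinarith
      have b2 : -3 ≤ S.C j i := by nlinarith
      generalize S.C i j = p at *
      generalize S.C j i = q at *
      interval_cases p <;> interval_cases q <;> simp_all
    · exact Or.inl ⟨hp', hzero.mp hp'⟩
  all_goals rw [h1] at e1; rw [h2] at e2
  · refine key 1 (fun k hk => ?_) (S.braid2 i j h1 h2)
    rw [hcomp]
    interval_cases k <;> simp only [alt, LinearEquiv.mul_apply, LinearEquiv.coe_one, id, e2] <;>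
      exact ⟨_, _, by norm_num, by norm_num, rfl⟩
  · refine key 2 (fun k hk => ?_) (S.braid3 i j h1 h2)
    rw [hcomp]
    interval_cases k <;> simp only [alt, LinearEquiv.mul_apply, LinearEquiv.coe_one, id, e1, e2] <;>
      exact ⟨_, _, by norm_num, by norm_num, rfl⟩
  · refine key 3 (fun k hk => ?_) (S.braid4 i j h1 h2)
    rw [hcomp]
    interval_cases k <;> simp only [alt, LinearEquiv.mul_apply, LinearEquiv.coe_one, id, e1, e2] <;>
      exact ⟨_, _, by norm_num, by norm_num, rfl⟩
  · refine key 3 (fun k hk => ?_) (S.braid4 j i h2 h1).symm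
    rw [hcomp]
    interval_cases k <;> simp only [alt, LinearEquiv.mul_apply, LinearEquiv.coe_one, id, e1, e2] <;>
      exact ⟨_, _, by norm_num, by norm_num, rfl⟩
  · refine key 5 (fun k hk => ?_) (S.braid6 i j h1 h2)
    rw [hcomp]
    interval_cases k <;> simp only [alt, LinearEquiv.mul_apply, LinearEquiv.coe_one, id, e1, e2] <;>
      exact ⟨_, _, by norm_num, by norm_num, rfl⟩
  · refine key 5 (fun k hk => ?_) (S.braid6 j i h2 h1).symm
    rw [hcomp]
    interval_cases k <;> simp only [alt, LinearEquiv.mul_apply, LinearEquiv.coe_one, id, e1, e2] <;>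
      exact ⟨_, _, by norm_num, by norm_num, rfl⟩

/-- If `a` is a reduced word for `x` and `x s_i` is not shorter than `x`, then `x α_i` is a
nonnegative combination of simple roots. -/
theorem wordProd_root_nonneg (a : List ι) (i : ι) (h1 : S.ShortFor a (S.wordProd a))
    (h2 : S.ShortFor a (S.wordProd a * S.s i)) : ∀ t, 0 ≤ (S.wordProd a (root i)).1 t := by
  induction hn : a.length using Nat.strong_induction_on generalizing a i with
  | _ n IH =>
  rcases List.eq_nil_or_concat' a with rfl | ⟨a0, j, rfl⟩
  · intro t
    by_cases ht : t = i
    · subst ht; simp [wordProd_nil, root]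
    · simp [wordProd_nil, root, ht]
  have hij : i ≠ j := by
    rintro rfl
    have := h2 a0 (by rw [wordProd_append, wordProd_singleton, mul_assoc, s_mul_s, mul_one])
    simp at this
  set a := a0 ++ [j] with ha
  -- Factor the element as `v d` with `d` in the subgroup generated by `s_i` and `s_j`, lengths
  -- adding up, and `v` as short as possible. Thus `v` is a minimal coset representative.
  let P : ℕ → Prop := fun m => ∃ v d : List ι, v.length = m ∧ (∀ x ∈ d, x = i ∨ x = j) ∧
    S.wordProd v * S.wordProd d = S.wordProd a ∧ v.length + d.length = a.length
  classical
  have hP : ∃ m, P m := ⟨a0.length, a0, [j], rfl, by simp, by rw [ha, wordProd_append], by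
    simp [ha]⟩
  obtain ⟨v, d, hv, hd, hvd, hl⟩ := Nat.find_spec hP
  have hmin : ∀ v' d' : List ι, (∀ x ∈ d', x = i ∨ x = j) →
      S.wordProd v' * S.wordProd d' = S.wordProd a → v'.length + d'.length = a.length →
      v.length ≤ v'.length := by
    intro v' d' a1 a2 a3
    rw [hv]
    exact Nat.find_min' hP ⟨v', d', rfl, a1, a2, a3⟩
  have hvn : v.length < n := by
    have := hmin a0 [j] (by simp) (by rw [ha, wordProd_append]) (by simp [ha])
    rw [← hn]
    simp [ha]
    omega
  have hvr : S.ShortFor v (S.wordProd v) := by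
    intro b hb
    have := h1 (b ++ d) (by rw [wordProd_append, hb, hvd])
    simp at this
    omega
  -- If `v s_k` were shorter, the letter `k` could be moved to `d`, against the minimality of `v`.
  have hvk : ∀ k, (k = i ∨ k = j) → S.ShortFor v (S.wordProd v * S.s k) := by
    intro k hk b hb
    by_contra! hlt
    have e : S.wordProd b * S.wordProd (k :: d) = S.wordProd a := by
      rw [hb, wordProd_cons, mul_assoc, ← mul_assoc (S.s k), s_mul_s, one_mul, hvd]
    have l1 := h1 (b ++ k :: d) (by rw [wordProd_append, e])
    simp at l1
    have := hmin b (k :: d) (by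
      intro x hx
      rcases List.mem_cons.mp hx with rfl | hx
      · exact hk
      · exact hd x hx) e (by simp; omega)
    omega
  -- By induction `v` keeps both `α_i` and `α_j` positive, so it remains to see that `d α_i` is a
  -- nonnegative combination of these two roots.
  have ri := IH _ hvn v i hvr (hvk i (Or.inl rfl)) rfl
  have rj := IH _ hvn v j hvr (hvk j (Or.inr rfl)) rfl
  have hd1 : S.ShortFor d (S.wordProd d) := by
    intro b hb
    have := h1 (v ++ b) (by rw [wordProd_append, hb, hvd])
    simp at this
    omega
  have hd2 : S.ShortFor d (S.wordProd d * S.s i) := by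
    intro b hb
    have := h2 (v ++ b) (by rw [wordProd_append, hb, ← mul_assoc, hvd])
    simp at this
    omega
  have e := S.eq_altWord i j d hd hd1 hd2
  have ew : S.wordProd d = S.alt d.length j i := by
    rw [← wordProd_altWord, ← e]
  obtain ⟨x, y, hx, hy, exy⟩ := S.alt_root_cone i j d.length hij (by
    rw [← e, ← ew]; exact hd2)
  intro t
  rw [← hvd, LinearEquiv.mul_apply, ew, exy, map_add, map_smul, map_smul]
  simp only [Prod.fst_add, Prod.smul_fst, Pi.add_apply, Pi.smul_apply, smul_eq_mul]
  have := ri t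
  have := rj t
  positivity

/-- The elements obtained from `1` by successive left multiplication with simple reflections which
increase the length. -/
inductive Red : (ExtLattice ι ≃ₗ[ℤ] ExtLattice ι) → Prop
  | one : Red 1
  | step (u) (i : ι) (hu : Red u) (h : ∀ t, 0 ≤ (u⁻¹ (root i)).1 t) : Red (S.s i * u)

/-- Peel off the first letter `i` of a shortest word. The reverse of the remaining word is a
shortest word for `u⁻¹`, and `u⁻¹ s_i` is not shorter, so positivity of roots applies to `u⁻¹ α_i`.
-/
theorem red_of_mem {x : ExtLattice ι ≃ₗ[ℤ] ExtLattice ι} (hx : x ∈ S.W) : S.Red x := by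
  classical
  obtain ⟨a, rfl⟩ := S.exists_wordProd hx
  induction hn : a.length using Nat.strong_induction_on generalizing a with
  | _ n IH =>
  by_cases hs : S.ShortFor a (S.wordProd a)
  · cases a with
    | nil => exact Red.one
    | cons i a =>
      have hm : ∀ b, S.wordProd b ∈ S.W := fun b =>
        Subgroup.list_prod_mem _ (by
          intro y hy
          obtain ⟨k, _, rfl⟩ := List.mem_map.mp hy
          exact Subgroup.subset_closure ⟨k, rfl⟩)
      rw [wordProd_cons]
      refine Red.step _ _ (IH a.length (by rw [← hn]; simp) a (hm a) rfl) ?_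
      rw [← wordProd_reverse]
      apply S.wordProd_root_nonneg
      · intro b hb
        have := hs (i :: b.reverse) (by
          rw [wordProd_cons, wordProd_reverse, hb, wordProd_reverse, inv_inv, wordProd_cons])
        simp at this ⊢
        omega
      · intro b hb
        have := hs b.reverse (by
          rw [wordProd_reverse, hb, wordProd_reverse, wordProd_cons, mul_inv_rev, inv_inv, s_inv])
        simp at this ⊢
        omega
  · simp only [ShortFor, not_forall, not_le] at hs
    obtain ⟨b, hb, hlt⟩ := hs
    have := IH b.length (hn ▸ hlt) b (hb ▸ hx) rfl
    rwa [hb] at this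

/-- The invariant pairing of the root lattice with the extended lattice. -/
def pair (β : ι → ℤ) (x : ExtLattice ι) : ℤ := ∑ j, S.c j * β j * S.coroot j x

theorem s_snd (i : ι) (x : ExtLattice ι) : (S.s i x).2 = x.2 := by
  simp [s_apply, root]

theorem Red.snd {x : ExtLattice ι ≃ₗ[ℤ] ExtLattice ι} (hx : S.Red x) (y : ExtLattice ι) :
    (x y).2 = y.2 := by
  induction hx with
  | one => rfl
  | step u i _ _ ih => rw [LinearEquiv.mul_apply, s_snd, ih]

/-- Symmetrizability makes the form invariant. The first argument has to lie in the root lattice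
because only its root coefficients enter the form. -/
theorem pair_s (i : ι) (x y : ExtLattice ι) (hx : x.2 = 0) :
    S.pair (S.s i x).1 (S.s i y) = S.pair x.1 y := by
  have h1 : ∀ j, S.coroot j (S.s i y) = S.coroot j y - S.coroot i y * S.C j i := by
    intro j
    rw [s_apply, map_sub, map_smul, coroot_root, smul_eq_mul]
  have h2 : S.coroot i x = ∑ j, S.C i j * x.1 j := by
    rw [coroot_apply, hx]
    simp [Matrix.mulVec, dotProduct]
  have h3 : (∑ j, (S.c j : ℤ) * x.1 j * S.C j i) = S.c i * S.coroot i x := by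
    rw [h2, Finset.mul_sum]
    refine Finset.sum_congr rfl fun j _ => ?_
    linear_combination -x.1 j * S.symm i j
  have h4 : ∀ j, (S.s i x).1 j = x.1 j - S.coroot i x * (Pi.single i 1 : ι → ℤ) j := by
    intro j
    simp [s_apply, root]
  have h5 : (∑ j, (S.c j : ℤ) * (S.coroot i x * (Pi.single i 1 : ι → ℤ) j) *
      (S.coroot j y - S.coroot i y * S.C j i)) = -(S.c i * S.coroot i x * S.coroot i y) := by
    rw [Finset.sum_eq_single i]
    · simp [S.diag]; ring
    · intro j _ hj; simp [hj]
    · simp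
  simp only [pair, h1, h4, mul_sub (S.c _ : ℤ), sub_mul, Finset.sum_sub_distrib, h5]
  simp only [mul_sub, Finset.sum_sub_distrib]
  have h6 : (∑ j, (S.c j : ℤ) * x.1 j * (S.coroot i y * S.C j i)) =
      S.coroot i y * (S.c i * S.coroot i x) := by
    rw [← h3, Finset.mul_sum]
    exact Finset.sum_congr rfl fun j _ => by ring
  simp only [mul_sub] at h5
  rw [Finset.sum_sub_distrib] at h5
  linarith

theorem Red.pair {x : ExtLattice ι ≃ₗ[ℤ] ExtLattice ι} (hx : S.Red x) (y z : ExtLattice ι)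
    (hy : y.2 = 0) : S.pair (x y).1 (x z) = S.pair y.1 z := by
  induction hx with
  | one => rfl
  | step u i hu _ ih =>
    rw [LinearEquiv.mul_apply, LinearEquiv.mul_apply, pair_s _ _ _ _ (by rw [hu.snd, hy]), ih]

theorem Red.inv_snd {x : ExtLattice ι ≃ₗ[ℤ] ExtLattice ι} (hx : S.Red x) (y : ExtLattice ι) :
    (x⁻¹ y).2 = y.2 := by
  conv_rhs => rw [← LinearEquiv.apply_symm_apply x y]
  exact (hx.snd S _).symm

theorem pair_root (i : ι) (x : ExtLattice ι) : S.pair (root i).1 x = S.c i * S.coroot i x := by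
  rw [pair, Finset.sum_eq_single i]
  · simp [root]
  · intro j _ hj; simp [root, hj]
  · simp

/-- By invariance, `c_i` times the coroot value equals the pairing of `u⁻¹ α_i` with `l`, a positive
root paired with an anti-dominant weight. -/
theorem Red.coroot_nonpos {u : ExtLattice ι ≃ₗ[ℤ] ExtLattice ι} (hu : S.Red u) (i : ι)
    (h : ∀ t, 0 ≤ (u⁻¹ (root i)).1 t) {l : ι → ℤ} (hl : AntiDominant l) :
    S.coroot i (u (0, l)) ≤ 0 := by
  have e := hu.pair S (u⁻¹ (root i)) (0, l) (by rw [hu.inv_snd]; rfl)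
  have e1 : u (u⁻¹ (root i)) = root i := LinearEquiv.apply_symm_apply u _
  rw [e1, pair_root] at e
  have : S.pair (u⁻¹ (root i)).1 (0, l) ≤ 0 := by
    refine Finset.sum_nonpos fun j _ => mul_nonpos_of_nonneg_of_nonpos ?_ ?_
    · have := h j
      positivity
    · simpa [coroot_apply] using hl j
  have hc := S.c_pos i
  rw [← e] at this
  by_contra! h0
  have : (0 : ℤ) < S.c i * S.coroot i (u (0, l)) := by
    have : (0 : ℤ) < S.c i := by exact_mod_cast hc
    positivity
  omega

theorem toWeight_apply (x : ExtLattice ι) (i : ι) : S.toWeight x i = S.coroot i x := rfl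

theorem act_one (l : ι → ℤ) : S.act 1 l = l := by
  ext i; simp [act, toWeight]

theorem disp_one (l : ι → ℤ) : disp 1 l = 0 := by
  simp [disp]

/-- In the last step `s_i u`, the value of the coroot `α_i^∨` on `u l` is nonpositive, and so is its
negative, the value on `s_i u l`. It vanishes, the last reflection does nothing, and induction
applies. -/
theorem Red.fix {x : ExtLattice ι ≃ₗ[ℤ] ExtLattice ι} (hx : S.Red x) {l : ι → ℤ}
    (hl : AntiDominant l) (hm : AntiDominant (S.act x l)) : x (0, l) = (0, l) := by
  induction hx with
  | one => rfl
  | step u i hu h ih =>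
    have h1 := hu.coroot_nonpos S i h hl
    have h2 : S.coroot i (S.s i (u (0, l))) ≤ 0 := hm i
    rw [s_apply, map_sub, map_smul, coroot_root, S.diag, smul_eq_mul] at h2
    have h3 : S.coroot i (u (0, l)) = 0 := by omega
    have h4 : S.s i (u (0, l)) = u (0, l) := by rw [s_apply, h3]; simp
    have h5 : S.act (S.s i * u) l = S.act u l := by
      simp only [act, LinearEquiv.mul_apply, h4]
    rw [LinearEquiv.mul_apply, h4]
    exact ih (h5 ▸ hm)

/-- Elements with the same weight differ by a vector killed by all coroots, and such vectors are
fixed by the Weyl group. This handles the case of a singular Cartan matrix. -/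
theorem toWeight_congr {z : ExtLattice ι ≃ₗ[ℤ] ExtLattice ι} (hz : S.Red z) {x y : ExtLattice ι}
    (h : S.toWeight x = S.toWeight y) : z x - z y = x - y := by
  have h0 : ∀ i, S.coroot i (x - y) = 0 := fun i => by
    rw [map_sub, ← toWeight_apply, ← toWeight_apply, h, sub_self]
  rw [← map_sub]
  induction hz with
  | one => rfl
  | step u i _ _ ih => rw [LinearEquiv.mul_apply, ih, s_apply, h0]; simp

/-- The anti-dominant chamber is a fundamental domain. The second conclusion lives in the extended
lattice, where `toWeight` may not be injective; it shows that the element `w λ - λ` depends on the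
weight `w λ` alone, so the modules may be indexed by weights. -/
theorem act_inj {x y : ExtLattice ι ≃ₗ[ℤ] ExtLattice ι} (hx : x ∈ S.W) (hy : y ∈ S.W)
    {l m : ι → ℤ} (hl : AntiDominant l) (hm : AntiDominant m) (h : S.act x l = S.act y m) :
    l = m ∧ x (0, l) = y (0, m) := by
  have hz : S.Red (y⁻¹ * x) := S.red_of_mem (S.W.mul_mem (S.W.inv_mem hy) hx)
  have e := S.toWeight_congr (S.red_of_mem (S.W.inv_mem hy)) h
  have e1 : y⁻¹ (y (0, m)) = (0, m) := LinearEquiv.symm_apply_apply y _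
  rw [e1] at e
  have e2 : S.act (y⁻¹ * x) l = m := by
    have h0 : ∀ i, S.coroot i (x (0, l) - y (0, m)) = 0 := fun i => by
      rw [map_sub, ← toWeight_apply, ← toWeight_apply]
      change S.act x l i - S.act y m i = 0
      rw [h, sub_self]
    ext i
    change S.coroot i (y⁻¹ (x (0, l))) = m i
    rw [sub_eq_iff_eq_add.mp e, map_add, h0, zero_add]
    simp [coroot_apply]
  have e3 := hz.fix S hl (e2 ▸ hm)
  have e4 : y (y⁻¹ (x (0, l))) = x (0, l) := LinearEquiv.apply_symm_apply y _
  have e5 : l = m := by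
    rw [← e2]
    change l = S.toWeight ((y⁻¹ * x) (0, l))
    rw [e3]
    ext i
    simp [toWeight]
  refine ⟨e5, ?_⟩
  subst e5
  rw [← e4]
  exact congrArg y e3

end WeylGroup
end CartanDatum

/-! ### Free modules over truncated polynomial rings -/

section NilFree

open Polynomial

variable {K : Type u} [Field K]

/-- The operator `N` satisfies `N ^ c = 0`, and makes `V` a free module over `K[X]/(X ^ c)`: the
kernel of `N` is contained in the image of `N ^ (c - 1)`. -/
structure NilFree {V : Type*} [AddCommGroup V] [Module K V] (N : Module.End K V) (c : ℕ) :
    Prop where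
  pow_eq : N ^ c = 0
  ker_le : ∀ x, N x = 0 → ∃ y, (N ^ (c - 1)) y = x

namespace NilFree

variable {V V' : Type*} [AddCommGroup V] [Module K V] [AddCommGroup V'] [Module K V']
  {N : Module.End K V} {N' : Module.End K V'} {c : ℕ}

/-- Induction on `a`: the kernel condition gives a preimage of `N^a x` under `N^(c-1)`, and
subtracting the corresponding element in the image of `N^(c-a-1)` from `x` lowers the power that
kills it. -/
theorem exists_of_pow (h : NilFree N c) (a : ℕ) (ha : a ≤ c) (x : V) (hx : (N ^ a) x = 0) :
    ∃ y, (N ^ (c - a)) y = x := by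
  induction a generalizing x with
  | zero =>
    refine ⟨0, ?_⟩
    rw [pow_zero] at hx
    simpa using hx.symm
  | succ a ih =>
    rw [pow_succ', Module.End.mul_apply] at hx
    obtain ⟨y, hy⟩ := h.ker_le _ hx
    have e : c - 1 = a + (c - (a + 1)) := by omega
    obtain ⟨z, hz⟩ := ih (by omega) (x - (N ^ (c - (a + 1))) y) (by
      rw [map_sub, ← Module.End.mul_apply, ← pow_add, ← e, hy, sub_self])
    refine ⟨y + N z, ?_⟩
    have e2 : c - a = c - (a + 1) + 1 := by omega
    rw [e2, pow_succ, Module.End.mul_apply] at hz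
    rw [map_add, hz]
    abel

theorem pow_intertwine (f : V →ₗ[K] V') (hf : ∀ x, f (N x) = N' (f x)) (k : ℕ) (x : V) :
    f ((N ^ k) x) = (N' ^ k) (f x) := by
  induction k with
  | zero => rfl
  | succ k ih => rw [pow_succ', Module.End.mul_apply, hf, ih, pow_succ', Module.End.mul_apply]

/-- Lifting of elements of the kernel along the cokernel of an injective map between free
modules. -/
theorem coker (hc : 1 ≤ c) (h : NilFree N c) (h' : NilFree N' c) (f : V →ₗ[K] V')
    (hf : ∀ x, f (N x) = N' (f x)) (hi : Function.Injective f) (x : V') (z : V)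
    (hx : N' x = f z) : ∃ y w, x = (N' ^ (c - 1)) y + f w := by
  have hz : (N ^ (c - 1)) z = 0 := by
    apply hi
    rw [pow_intertwine f hf, ← hx, ← Module.End.mul_apply, ← pow_succ, Nat.sub_add_cancel hc,
      h'.pow_eq]
    simp
  obtain ⟨w, hw⟩ := h.exists_of_pow (c - 1) (by omega) z hz
  rw [show c - (c - 1) = 1 by omega, pow_one] at hw
  obtain ⟨y, hy⟩ := h'.ker_le (x - f w) (by rw [map_sub, hx, ← hw, hf, sub_self])
  exact ⟨y, w, by rw [hy]; abel⟩

/-- Lifting of elements of the kernel inside the kernel of a surjective map between free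
modules. -/
theorem ker_map (hc : 1 ≤ c) (h : NilFree N c) (h' : NilFree N' c) (f : V →ₗ[K] V')
    (hf : ∀ x, f (N x) = N' (f x)) (hs : Function.Surjective f) (x : V) (hx : N x = 0)
    (hfx : f x = 0) : ∃ y, f y = 0 ∧ (N ^ (c - 1)) y = x := by
  obtain ⟨t, ht⟩ := h.ker_le x hx
  obtain ⟨s, hs'⟩ := h'.exists_of_pow (c - 1) (by omega) (f t) (by
    rw [← pow_intertwine f hf, ht, hfx])
  rw [show c - (c - 1) = 1 by omega, pow_one] at hs'
  obtain ⟨s, rfl⟩ := hs s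
  refine ⟨t - N s, by rw [map_sub, hf, hs', sub_self], ?_⟩
  have : (N ^ (c - 1)) (N s) = 0 := by
    rw [← Module.End.mul_apply, ← pow_succ, Nat.sub_add_cancel hc, h.pow_eq]
    rfl
  rw [map_sub, this, sub_zero, ht]

end NilFree

section Truncated

/-- The truncated polynomial ring. -/
abbrev Truncated (K : Type u) [Field K] (c : ℕ) : Type u :=
  K[X] ⧸ Ideal.span {(X ^ c : K[X])}

theorem truncated_decomp (c : ℕ) (p : Truncated K c) :
    ∃ (a : K) (q : Truncated K c), p = algebraMap K _ a + Ideal.Quotient.mk _ X * q := by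
  obtain ⟨p, rfl⟩ := Ideal.Quotient.mk_surjective p
  refine ⟨p.coeff 0, Ideal.Quotient.mk _ p.divX, ?_⟩
  conv_lhs => rw [← Polynomial.X_mul_divX_add p]
  rw [map_add, map_mul, add_comm]
  rfl

theorem truncated_ker {c : ℕ} (hc : 1 ≤ c) (p : Truncated K c) (hp : Ideal.Quotient.mk _ X * p = 0) :
    ∃ q, p = Ideal.Quotient.mk _ X ^ (c - 1) * q := by
  obtain ⟨p, rfl⟩ := Ideal.Quotient.mk_surjective p
  rw [← map_mul, Ideal.Quotient.eq_zero_iff_mem, Ideal.mem_span_singleton] at hp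
  obtain ⟨c, rfl⟩ : ∃ d, c = d + 1 := ⟨c - 1, by omega⟩
  rw [pow_succ', mul_dvd_mul_iff_left X_ne_zero] at hp
  obtain ⟨q, rfl⟩ := hp
  exact ⟨Ideal.Quotient.mk _ q, by simp⟩

theorem truncated_X_pow (c : ℕ) : (Ideal.Quotient.mk _ X : Truncated K c) ^ c = 0 := by
  rw [← map_pow, Ideal.Quotient.eq_zero_iff_mem]
  exact Ideal.mem_span_singleton_self _

theorem truncated_X_pow_ne {c : ℕ} (hc : 1 ≤ c) :
    (Ideal.Quotient.mk _ X : Truncated K c) ^ (c - 1) ≠ 0 := by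
  rw [← map_pow, Ne, Ideal.Quotient.eq_zero_iff_mem, Ideal.mem_span_singleton]
  intro h
  have := (pow_dvd_pow_iff (X_ne_zero (R := K)) not_isUnit_X).mp h
  omega

theorem truncated_finrank (c : ℕ) : Module.finrank K (Truncated K c) = c := by
  rw [finrank_quotient_span_eq_natDegree, natDegree_X_pow]

theorem truncated_finite (c : ℕ) : Module.Finite K (Truncated K c) :=
  (monic_X_pow c).finite_quotient

variable {c : ℕ} {V : Type*} [AddCommGroup V] [Module K V] [Module (Truncated K c) V]
  [IsScalarTower K (Truncated K c) V] {N : Module.End K V}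

theorem truncated_pow_smul (hN : ∀ v : V, N v = (Ideal.Quotient.mk _ X : Truncated K c) • v) (k : ℕ) (v : V) :
    (N ^ k) v = (Ideal.Quotient.mk _ X : Truncated K c) ^ k • v := by
  induction k with
  | zero => simp
  | succ k ih => rw [pow_succ', Module.End.mul_apply, ih, hN, pow_succ', mul_smul]

theorem NilFree.of_free (hc : 1 ≤ c) (hN : ∀ v : V, N v = (Ideal.Quotient.mk _ X : Truncated K c) • v)
    [Module.Free (Truncated K c) V] : NilFree N c := by
  refine ⟨?_, fun x hx => ?_⟩
  · ext v
    rw [truncated_pow_smul hN, truncated_X_pow]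
    exact zero_smul (Truncated K c) v
  · let b := Module.Free.chooseBasis (Truncated K c) V
    have h : ∀ t, ∃ q, b.repr x t = Ideal.Quotient.mk _ X ^ (c - 1) * q := by
      intro t
      apply truncated_ker hc
      rw [hN] at hx
      have := congrArg (fun z => b.repr z t) hx
      simpa using this
    choose q hq using h
    refine ⟨∑ t ∈ (b.repr x).support, q t • b t, ?_⟩
    rw [truncated_pow_smul hN, Finset.smul_sum]
    conv_rhs => rw [← b.linearCombination_repr x, Finsupp.linearCombination_apply, Finsupp.sum]
    exact Finset.sum_congr rfl fun t _ => by rw [hq, mul_smul]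

/-- Lifts of a `K`-basis of the socle `ker N` along `N^(c-1)` form a basis over the truncated ring.
-/
theorem NilFree.exists_basis (hc : 1 ≤ c) (hN : ∀ v : V, N v = (Ideal.Quotient.mk _ X : Truncated K c) • v)
    [Module.Finite K V] (h : NilFree N c) :
    Nonempty (Module.Basis (Fin (Module.finrank K (LinearMap.ker N))) (Truncated K c) V) := by
  let v := Module.finBasis K (LinearMap.ker N)
  have hy : ∀ s, ∃ y, (N ^ (c - 1)) y = v s := fun s => h.ker_le _ (v s).2
  choose y hy using hy
  have hXv : ∀ s, (Ideal.Quotient.mk _ X : Truncated K c) • (v s : V) = 0 := fun s => by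
    rw [← hN]; exact (v s).2
  have hli : LinearIndependent (Truncated K c) y := by
    rw [Fintype.linearIndependent_iff]
    intro g hg
    -- If all coefficients are divisible by `X^k`, multiplying the relation by `X^(c-1-k)` leaves a
    -- relation in the socle between their next coefficients, which must vanish. In the end all are
    -- divisible by `X^c = 0`.
    have key : ∀ k ≤ c, ∀ s, ∃ q, g s = Ideal.Quotient.mk _ X ^ k * q := by
      intro k
      induction k with
      | zero => exact fun _ s => ⟨g s, by simp⟩
      | succ k ih =>
        intro hk
        choose q hq using ih (by omega)
        choose a r hr using fun s => truncated_decomp c (q s)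
        have h1 : ∑ s, a s • v s = 0 := by
          apply Subtype.ext
          have := congrArg (fun z => (Ideal.Quotient.mk _ X : Truncated K c) ^ (c - 1 - k) • z) hg
          simp only [Finset.smul_sum, smul_zero] at this
          rw [AddSubmonoidClass.coe_finsetSum, ZeroMemClass.coe_zero, ← this]
          refine Finset.sum_congr rfl fun s _ => ?_
          rw [hq, smul_smul, ← mul_assoc, ← pow_add, show c - 1 - k + k = c - 1 by omega, hr,
            mul_comm, mul_smul, ← truncated_pow_smul hN, hy, add_smul, mul_comm, mul_smul, hXv,
            smul_zero, add_zero, algebraMap_smul, Submodule.coe_smul]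
        have h2 := Fintype.linearIndependent_iff.mp v.linearIndependent a h1
        intro s
        refine ⟨r s, ?_⟩
        rw [hq, hr, h2, map_zero, zero_add, ← mul_assoc, pow_succ]
    intro s
    obtain ⟨q, hq⟩ := key c le_rfl s
    rw [hq, truncated_X_pow, zero_mul]
  -- Spanning, by induction on the power of `N` that kills `x`: the socle element `N^k x` lifts to
  -- the span, and subtracting a suitable power of `X` times the lift lowers the power.
  have hsp : ∀ k ≤ c, ∀ x, (N ^ k) x = 0 → x ∈ Submodule.span (Truncated K c) (Set.range y) := by
    intro k
    induction k with
    | zero =>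
      intro _ x hx
      rw [pow_zero, Module.End.one_apply] at hx
      rw [hx]
      exact zero_mem _
    | succ k ih =>
      intro hk x hx
      rw [pow_succ', Module.End.mul_apply] at hx
      set z : LinearMap.ker N := ⟨(N ^ k) x, hx⟩ with hz
      let t : V := ∑ s, (algebraMap K (Truncated K c) (v.repr z s)) • y s
      have ht : t ∈ Submodule.span (Truncated K c) (Set.range y) :=
        Submodule.sum_mem _ fun s _ => Submodule.smul_mem _ _ (Submodule.subset_span ⟨s, rfl⟩)
      have htz : (N ^ (c - 1)) t = z := by
        conv_rhs => rw [← v.sum_repr z]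
        rw [map_sum, AddSubmonoidClass.coe_finsetSum]
        exact Finset.sum_congr rfl fun s _ => by
          rw [algebraMap_smul, map_smul, hy, Submodule.coe_smul]
      have h1 := ih (by omega) (x - (N ^ (c - 1 - k)) t) (by
        rw [map_sub, ← Module.End.mul_apply, ← pow_add, show k + (c - 1 - k) = c - 1 by omega,
          htz, hz, sub_self])
      have h2 : (N ^ (c - 1 - k)) t ∈ Submodule.span (Truncated K c) (Set.range y) := by
        rw [truncated_pow_smul hN]
        exact Submodule.smul_mem _ _ ht
      simpa using add_mem h1 h2
  refine ⟨Module.Basis.mk hli fun x _ => hsp c le_rfl x ?_⟩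
  rw [h.pow_eq]
  rfl

/-- This replaces freeness of given rank by a kernel condition and a dimension over `K`, the only
form in which local freeness is used later. -/
theorem truncated_free_iff (hc : 1 ≤ c) (hN : ∀ v : V, N v = (Ideal.Quotient.mk _ X : Truncated K c) • v)
    (r : ℤ) :
    (Module.Free (Truncated K c) V ∧ Module.Finite (Truncated K c) V ∧ (Module.finrank (Truncated K c) V : ℤ) = r) ↔
      (Module.Finite K V ∧ NilFree N c ∧ (Module.finrank K V : ℤ) = c * r) := by
  have := truncated_finite (K := K) c
  have hnt : Nontrivial (Truncated K c) := by
    refine ⟨_, 0, truncated_X_pow_ne hc⟩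
  have hfr : ∀ [Module.Free (Truncated K c) V], Module.finrank K V = c * Module.finrank (Truncated K c) V := by
    intro _
    have := Module.finrank_mul_finrank K (Truncated K c) V
    rw [truncated_finrank] at this
    exact this.symm
  constructor
  · rintro ⟨h1, h2, rfl⟩
    refine ⟨Module.Finite.trans (Truncated K c) V, NilFree.of_free hc hN, ?_⟩
    rw [hfr]; push_cast; rfl
  · rintro ⟨h1, h2, h3⟩
    obtain ⟨b⟩ := h2.exists_basis hc hN
    have hf := Module.Free.of_basis b
    refine ⟨hf, Module.Finite.of_basis b, ?_⟩
    rw [hfr] at h3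
    push_cast at h3
    have : (c : ℤ) ≠ 0 := by exact_mod_cast (by omega : c ≠ 0)
    exact mul_left_cancel₀ this h3

end Truncated

end NilFree

namespace CartanDatum

/-! ### Idempotents, loops and arrows; local freeness at a vertex -/

section Generators

variable {ι : Type w} [Fintype ι] (S : CartanDatum ι) (K : Type u) [Field K]

theorem e_mul_self (i : ι) : S.e K i * S.e K i = S.e K i := by
  have h := quot_rel (Rel.idem (S := S) (K := K) i)
  rwa [map_mul] at h

theorem e_mul_ne {i j : ι} (hij : i ≠ j) : S.e K i * S.e K j = 0 := by
  have h := quot_rel (Rel.orth (S := S) (K := K) i j hij)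
  rwa [map_mul, map_zero] at h

theorem sum_e : ∑ i, S.e K i = 1 := by
  have h := quot_rel (Rel.one (S := S) (K := K))
  rwa [map_sum, map_one] at h

theorem eps_mul_e (i : ι) : S.eps K i * S.e K i = S.eps K i := by
  have h : S.e K i * S.eps K i * S.e K i = S.eps K i := by
    have h := quot_rel (Rel.eps_vertex (S := S) (K := K) i)
    rwa [map_mul, map_mul] at h
  rw [← h, mul_assoc, e_mul_self]

theorem e_arr_e (i j : ι) (k : ℕ) : S.e K i * S.arr K i j k * S.e K j = S.arr K i j k := by
  have h := quot_rel (Rel.arr_vertex (S := S) (K := K) i j k)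
  rwa [map_mul, map_mul] at h

theorem e_mul_arr (i j : ι) (k : ℕ) : S.e K i * S.arr K i j k = S.arr K i j k := by
  conv_lhs => rw [← e_arr_e, ← mul_assoc, ← mul_assoc, e_mul_self]
  exact S.e_arr_e K i j k

theorem arr_mul_e (i j : ι) (k : ℕ) : S.arr K i j k * S.e K j = S.arr K i j k := by
  conv_lhs => rw [← e_arr_e, mul_assoc, e_mul_self]
  exact S.e_arr_e K i j k

theorem arr_eq_zero (i j : ι) (k : ℕ) (h : ¬ (S.C i j < 0 ∧ k < S.g i j)) :
    S.arr K i j k = 0 := by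
  have h := quot_rel (Rel.arr_zero (S := S) (K := K) i j k h)
  rwa [map_zero] at h

theorem eps_arr (i j : ι) (k : ℕ) :
    S.eps K i ^ S.f j i * S.arr K i j k = S.arr K i j k * S.eps K j ^ S.f i j := by
  by_cases hk : S.C i j < 0 ∧ k < S.g i j
  · have h := quot_rel (Rel.comm (S := S) (K := K) i j k hk.1 hk.2)
    rwa [map_mul, map_mul, map_pow, map_pow] at h
  · rw [arr_eq_zero S K i j k hk]; simp

theorem mesh (i : ι) :
    ∑ j with S.C j i < 0, ∑ k ∈ Finset.range (S.g i j), ∑ l ∈ Finset.range (S.f j i),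
      S.sgn K i j • (S.eps K i ^ l * S.arr K i j k * S.arr K j i k *
        S.eps K i ^ (S.f j i - 1 - l)) = 0 := by
  have h := quot_rel (Rel.mesh (S := S) (K := K) i)
  simp only [map_sum, map_smul, map_mul, map_pow, map_zero] at h
  exact h

theorem neg_comm (i j : ι) : S.C i j < 0 ↔ S.C j i < 0 := by
  rw [← S.orient, ← S.orient, or_comm]

theorem g_comm (i j : ι) : S.g i j = S.g j i := Int.gcd_comm _ _

theorem ne_of_neg {i j : ι} (h : S.C i j < 0) : i ≠ j := by
  rintro rfl
  rw [S.diag] at h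
  omega

theorem g_pos {i j : ι} (h : S.C i j < 0) : 0 < S.g i j :=
  Int.gcd_pos_of_ne_zero_left _ h.ne

theorem g_mul_f (i j : ι) : S.g i j * S.f i j = (S.C i j).natAbs :=
  Nat.mul_div_cancel' (Int.gcd_dvd_natAbs_left _ _)

theorem f_pos {i j : ι} (h : S.C i j < 0) : 0 < S.f i j := by
  have := S.g_mul_f i j
  rcases Nat.eq_zero_or_pos (S.f i j) with h0 | h0
  · rw [h0] at this; omega
  · exact h0

theorem c_mul_f {i j : ι} (h : S.C i j < 0) : S.c i * S.f i j = S.c j * S.f j i := by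
  have h1 := congrArg Int.natAbs (S.symm i j)
  rw [Int.natAbs_mul, Int.natAbs_mul, ← g_mul_f, ← g_mul_f, g_comm S j i] at h1
  simp only [Int.natAbs_natCast] at h1
  have := S.g_pos h
  apply Nat.eq_of_mul_eq_mul_left this
  linarith

/-- The common factor `k_{ij}` of `c_i = k_{ij} f_{ji}` and `c_j = k_{ij} f_{ij}`. -/
theorem exists_c_eq {i j : ι} (h : S.C i j < 0) :
    ∃ k, S.c i = k * S.f j i ∧ S.c j = k * S.f i j := by
  have hc := S.c_mul_f h
  have hcop : Nat.Coprime (S.f i j) (S.f j i) := by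
    have := S.g_pos h
    rw [f, f, S.g_comm j i]
    exact Nat.coprime_div_gcd_div_gcd this
  have hd : S.f j i ∣ S.c i := hcop.symm.dvd_of_dvd_mul_right ⟨S.c j, by rw [hc, mul_comm]⟩
  obtain ⟨k, hk⟩ := hd
  refine ⟨k, by rw [hk, mul_comm], ?_⟩
  have := S.f_pos ((S.neg_comm i j).mp h)
  apply Nat.eq_of_mul_eq_mul_right this
  rw [← hc, hk]
  ring

theorem sgn_mul_self (i j : ι) : S.sgn K i j * S.sgn K i j = 1 := by
  unfold sgn
  split_ifs <;> simp

variable {M : Type v} [AddCommGroup M] [Module K M] [Module (S.Preproj K) M]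
  [IsScalarTower K (S.Preproj K) M]

theorem e_e_smul (i : ι) (x : M) : S.e K i • S.e K i • x = S.e K i • x := by
  rw [← mul_smul, e_mul_self]

theorem e_e_smul_ne {i j : ι} (h : i ≠ j) (x : M) : S.e K i • S.e K j • x = 0 := by
  rw [← mul_smul, e_mul_ne S K h, zero_smul]

theorem sum_e_smul (x : M) : ∑ i, S.e K i • x = x := by
  rw [← Finset.sum_smul, sum_e, one_smul]

theorem e_eps_smul (i : ι) (x : M) : S.e K i • S.eps K i • x = S.eps K i • x := by
  rw [← mul_smul, e_mul_eps]

theorem eps_e_smul (i : ι) (x : M) : S.eps K i • S.e K i • x = S.eps K i • x := by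
  rw [← mul_smul, eps_mul_e]

theorem e_eps_smul_ne {i j : ι} (h : i ≠ j) (x : M) : S.e K i • S.eps K j • x = 0 := by
  rw [← e_eps_smul, e_e_smul_ne S K h]

theorem eps_e_smul_ne {i j : ι} (h : i ≠ j) (x : M) : S.eps K i • S.e K j • x = 0 := by
  rw [← eps_e_smul, e_e_smul_ne S K h, smul_zero]

theorem e_arr_smul (i j : ι) (k : ℕ) (x : M) : S.e K i • S.arr K i j k • x = S.arr K i j k • x := by
  rw [← mul_smul, e_mul_arr]

theorem arr_e_smul (i j : ι) (k : ℕ) (x : M) : S.arr K i j k • S.e K j • x = S.arr K i j k • x := by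
  rw [← mul_smul, arr_mul_e]

theorem e_arr_smul_ne {i j : ι} (h : i ≠ j) (l : ι) (k : ℕ) (x : M) :
    S.e K i • S.arr K j l k • x = 0 := by
  rw [← e_arr_smul, e_e_smul_ne S K h]

theorem arr_e_smul_ne {i j : ι} (h : i ≠ j) (l : ι) (k : ℕ) (x : M) :
    S.arr K l i k • S.e K j • x = 0 := by
  rw [← arr_e_smul, e_e_smul_ne S K h, smul_zero]

theorem e_eps_pow_smul (i : ι) (n : ℕ) (x : M) (hx : S.e K i • x = x) :
    S.e K i • S.eps K i ^ n • x = S.eps K i ^ n • x := by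
  cases n with
  | zero => simpa using hx
  | succ n => rw [pow_succ', mul_smul, e_eps_smul]

theorem eps_arr_smul (i j : ι) (k : ℕ) (x : M) :
    S.eps K i ^ S.f j i • S.arr K i j k • x = S.arr K i j k • S.eps K j ^ S.f i j • x := by
  rw [← mul_smul, eps_arr, mul_smul]

theorem mem_vertexSpace {i : ι} {x : M} : x ∈ S.vertexSpace K M i ↔ S.e K i • x = x := by
  constructor
  · rintro ⟨y, rfl⟩
    exact S.e_e_smul K i y
  · intro h
    exact ⟨x, h⟩

theorem smul_comm_K (a : S.Preproj K) (t : K) (x : M) : a • t • x = t • a • x := by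
  rw [← algebraMap_smul (S.Preproj K) t x, ← mul_smul, ← Algebra.commutes, mul_smul,
    algebraMap_smul]

theorem vertexModule_X_smul (i : ι) (x : S.vertexSpace K M i) :
    (Ideal.Quotient.mk _ Polynomial.X : S.H K i) • x = S.epsEnd K M i x := by
  change S.HAction K M i (Ideal.Quotient.mk _ Polynomial.X) x = _
  unfold HAction
  change Polynomial.aeval (S.epsEnd K M i) Polynomial.X x = _
  rw [Polynomial.aeval_X]

theorem vertexModule_isScalarTower (i : ι) :
    IsScalarTower K (S.H K i) (S.vertexSpace K M i) := by
  have h : ∀ (t : K) (x : S.vertexSpace K M i), algebraMap K (S.H K i) t • x = t • x := by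
    intro t x
    change S.HAction K M i (algebraMap K _ t) x = _
    rw [AlgHom.commutes]
    rfl
  exact IsScalarTower.of_algebraMap_smul h

variable (M)

/-- Local freeness at one vertex, with finite rank. -/
theorem hasRankVec_iff (r : ι → ℤ) :
    S.HasRankVec K M r ↔ ∀ i, Module.Finite K (S.vertexSpace K M i) ∧
      NilFree (S.epsEnd K M i) (S.c i) ∧
      (Module.finrank K (S.vertexSpace K M i) : ℤ) = S.c i * r i := by
  refine forall_congr' fun i => ?_
  have := S.vertexModule_isScalarTower K (M := M) i
  exact truncated_free_iff (V := S.vertexSpace K M i) (S.c_pos i)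
    (fun v => (S.vertexModule_X_smul K i v).symm) (r i)

/-- The module is free over `H_i` at the vertex `i`. -/
def LocFree (i : ι) : Prop :=
  ∀ x : M, S.e K i • x = x → S.eps K i • x = 0 →
    ∃ y : M, S.e K i • y = y ∧ S.eps K i ^ (S.c i - 1) • y = x

theorem nilFree_epsEnd_iff (i : ι) :
    NilFree (S.epsEnd K M i) (S.c i) ↔ S.LocFree K M i := by
  constructor
  · intro h x hx hx0
    obtain ⟨y, hy⟩ := h.ker_le ⟨x, (S.mem_vertexSpace K).mpr hx⟩ (Subtype.ext hx0)
    refine ⟨y, (S.mem_vertexSpace K).mp y.2, ?_⟩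
    rw [← epsEnd_pow_apply, hy]
  · intro h
    refine ⟨?_, fun x hx => ?_⟩
    · ext x
      rw [epsEnd_pow_apply, eps_pow, zero_smul]
      rfl
    · obtain ⟨y, hy, hyx⟩ := h x ((S.mem_vertexSpace K).mp x.2) (congrArg Subtype.val hx)
      refine ⟨⟨y, (S.mem_vertexSpace K).mpr hy⟩, Subtype.ext ?_⟩
      rw [epsEnd_pow_apply]
      exact hyx

/-- The dimension of `e_i M`. -/
noncomputable def vdim (i : ι) : ℕ := Module.finrank K (S.vertexSpace K M i)

theorem hasRankVec_iff' [Module.Finite K M] (r : ι → ℤ) :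
    S.HasRankVec K M r ↔ ∀ i, S.LocFree K M i ∧ (S.vdim K M i : ℤ) = S.c i * r i := by
  rw [hasRankVec_iff]
  refine forall_congr' fun i => ?_
  rw [nilFree_epsEnd_iff]
  exact ⟨fun h => h.2, fun h => ⟨inferInstance, h⟩⟩

variable {M}

theorem HasRankVec.finite {r : ι → ℤ} (h : S.HasRankVec K M r) : Module.Finite K M := by
  rw [hasRankVec_iff] at h
  have := fun i => (h i).1
  let φ : (∀ i, S.vertexSpace K M i) →ₗ[K] M :=
    ∑ i, (S.vertexSpace K M i).subtype ∘ₗ LinearMap.proj i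
  refine Module.Finite.of_surjective φ fun x => ?_
  refine ⟨fun i => ⟨S.e K i • x, x, rfl⟩, ?_⟩
  simp only [φ, LinearMap.sum_apply, LinearMap.comp_apply, LinearMap.proj_apply,
    Submodule.subtype_apply]
  exact S.sum_e_smul K x

variable {M' : Type*} [AddCommGroup M'] [Module K M'] [Module (S.Preproj K) M']
  [IsScalarTower K (S.Preproj K) M']

/-- Induction over the elements of `Π`. -/
theorem preproj_induction {P : S.Preproj K → Prop} (he : ∀ i, P (S.e K i))
    (heps : ∀ i, P (S.eps K i)) (harr : ∀ i j k, P (S.arr K i j k))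
    (halg : ∀ t : K, P (algebraMap K _ t)) (hadd : ∀ a b, P a → P b → P (a + b))
    (hmul : ∀ a b, P a → P b → P (a * b)) (a : S.Preproj K) : P a := by
  obtain ⟨a, rfl⟩ := RingQuot.mkAlgHom_surjective K (S.Rel K) a
  change P (S.quot K a)
  induction a using FreeAlgebra.induction with
  | grade0 t => rw [AlgHom.commutes]; exact halg t
  | grade1 x =>
    cases x with
    | e i => exact he i
    | eps i => exact heps i
    | arr i j k => exact harr i j k
  | mul a b ha hb => rw [map_mul]; exact hmul _ _ ha hb
  | add a b ha hb => rw [map_add]; exact hadd _ _ ha hb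

/-- A `K`-linear map which commutes with the generators is `Π`-linear. -/
theorem map_smul_of_gens (f : M →ₗ[K] M') (he : ∀ i x, f (S.e K i • x) = S.e K i • f x)
    (heps : ∀ i x, f (S.eps K i • x) = S.eps K i • f x)
    (harr : ∀ i j k x, f (S.arr K i j k • x) = S.arr K i j k • f x) (a : S.Preproj K) (x : M) :
    f (a • x) = a • f x := by
  induction a using S.preproj_induction K generalizing x with
  | he i => exact he i x
  | heps i => exact heps i x
  | harr i j k => exact harr i j k x
  | halg t => rw [algebraMap_smul, algebraMap_smul, map_smul]
  | hadd a b ha hb => rw [add_smul, add_smul, map_add, ha, hb]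
  | hmul a b ha hb => rw [mul_smul, mul_smul, ha, hb]

/-- The `Π`-linear map defined by a `K`-linear map commuting with the generators. -/
noncomputable def homOfGens (f : M →ₗ[K] M') (he : ∀ i x, f (S.e K i • x) = S.e K i • f x)
    (heps : ∀ i x, f (S.eps K i • x) = S.eps K i • f x)
    (harr : ∀ i j k x, f (S.arr K i j k • x) = S.arr K i j k • f x) : M →ₗ[S.Preproj K] M' where
  toFun := f
  map_add' := map_add f
  map_smul' := S.map_smul_of_gens K f he heps harr

/-- The submodule defined by a subspace stable under the generators. -/
noncomputable def submoduleOfGens (N : Submodule K M) (he : ∀ i, ∀ x ∈ N, S.e K i • x ∈ N)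
    (heps : ∀ i, ∀ x ∈ N, S.eps K i • x ∈ N)
    (harr : ∀ i j k, ∀ x ∈ N, S.arr K i j k • x ∈ N) : Submodule (S.Preproj K) M where
  carrier := N
  add_mem' := N.add_mem
  zero_mem' := N.zero_mem
  smul_mem' a x hx := by
    induction a using S.preproj_induction K generalizing x with
    | he i => exact he i x hx
    | heps i => exact heps i x hx
    | harr i j k => exact harr i j k x hx
    | halg t => rw [algebraMap_smul]; exact N.smul_mem t hx
    | hadd a b ha hb => rw [add_smul]; exact N.add_mem (ha x hx) (hb x hx)
    | hmul a b ha hb => rw [mul_smul]; exact ha _ (hb x hx)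

/-- Two modules are isomorphic if they are embedded, as vector spaces, onto the same subspace of a
third space, compatibly with the generators. -/
theorem nonempty_equiv_of_range_eq {X : Type*} [AddCommGroup X] [Module K X] (J : M →ₗ[K] X)
    (J' : M' →ₗ[K] X) (hJ : Function.Injective J) (hJ' : Function.Injective J')
    (hr : LinearMap.range J = LinearMap.range J')
    (he : ∀ i x y, J x = J' y → J (S.e K i • x) = J' (S.e K i • y))
    (heps : ∀ i x y, J x = J' y → J (S.eps K i • x) = J' (S.eps K i • y))
    (harr : ∀ i j k x y, J x = J' y → J (S.arr K i j k • x) = J' (S.arr K i j k • y)) :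
    Nonempty (M ≃ₗ[S.Preproj K] M') := by
  let φ : M ≃ₗ[K] M' := (LinearEquiv.ofInjective J hJ).trans
    ((LinearEquiv.ofEq _ _ hr).trans (LinearEquiv.ofInjective J' hJ').symm)
  have hφ : ∀ x, J' (φ x) = J x := fun x => by
    have h : LinearEquiv.ofInjective J' hJ' (φ x) =
        LinearEquiv.ofEq _ _ hr (LinearEquiv.ofInjective J hJ x) := by
      simp [φ]
    exact congrArg Subtype.val h
  refine ⟨LinearEquiv.ofBijective (S.homOfGens K φ.toLinearMap (fun i x => ?_) (fun i x => ?_)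
    fun i j k x => ?_) φ.bijective⟩
  · exact hJ' ((hφ _).trans (he i _ _ (hφ x).symm))
  · exact hJ' ((hφ _).trans (heps i _ _ (hφ x).symm))
  · exact hJ' ((hφ _).trans (harr i j k _ _ (hφ x).symm))

/-- The restriction of a homomorphism to the spaces at a vertex. -/
noncomputable def vmap (f : M →ₗ[S.Preproj K] M') (i : ι) : S.vertexSpace K M i →ₗ[K] S.vertexSpace K M' i :=
  (f.restrictScalars K).restrict fun x hx => by
    rw [mem_vertexSpace] at hx ⊢
    change S.e K i • f x = f x
    rw [← map_smul, hx]

theorem vmap_injective {f : M →ₗ[S.Preproj K] M'} (hf : Function.Injective f) (i : ι) :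
    Function.Injective (S.vmap K f i) := fun _ _ h =>
  Subtype.ext (hf (congrArg Subtype.val h))

theorem LocFree.of_equiv (f : M ≃ₗ[S.Preproj K] M') {i : ι} (h : S.LocFree K M i) :
    S.LocFree K M' i := by
  intro x hx hx0
  obtain ⟨y, hy, hyx⟩ := h (f.symm x) (by rw [← map_smul, hx]) (by rw [← map_smul, hx0, map_zero])
  exact ⟨f y, by rw [← map_smul, hy], by rw [← map_smul, hyx, f.apply_symm_apply]⟩

theorem vdim_eq_of_equiv (f : M ≃ₗ[S.Preproj K] M') (i : ι) : S.vdim K M i = S.vdim K M' i := by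
  refine LinearEquiv.finrank_eq (LinearEquiv.ofBijective (S.vmap K f.toLinearMap i)
    ⟨S.vmap_injective K f.injective i, fun y => ?_⟩)
  refine ⟨⟨f.symm y, ?_⟩, Subtype.ext (f.apply_symm_apply _)⟩
  rw [mem_vertexSpace, ← map_smul, (S.mem_vertexSpace K).mp y.2]

theorem HasRankVec.of_equiv (f : M ≃ₗ[S.Preproj K] M') {r : ι → ℤ} (h : S.HasRankVec K M r) :
    S.HasRankVec K M' r := by
  have := h.finite
  have : Module.Finite K M' := Module.Finite.equiv (f.restrictScalars K)
  rw [hasRankVec_iff'] at h ⊢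
  exact fun i => ⟨(h i).1.of_equiv S K f, by rw [← S.vdim_eq_of_equiv K f, (h i).2]⟩

end Generators

/-! ### Modules given by operators that satisfy the relations -/

section Rep

variable {ι : Type w} [Fintype ι] (S : CartanDatum ι) (K : Type u) [Field K]
  {V : Type v} [AddCommGroup V] [Module K V]

/-- The operators `ρ` satisfy the defining relations of `Π`. -/
structure IsRep (ρ : Gen ι → Module.End K V) : Prop where
  idem : ∀ i x, ρ (.e i) (ρ (.e i) x) = ρ (.e i) x
  orth : ∀ i j x, i ≠ j → ρ (.e i) (ρ (.e j) x) = 0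
  one : ∀ x, ∑ i, ρ (.e i) x = x
  eps_vertex : ∀ i x, ρ (.e i) (ρ (.eps i) (ρ (.e i) x)) = ρ (.eps i) x
  arr_vertex : ∀ i j k x, ρ (.e i) (ρ (.arr i j k) (ρ (.e j) x)) = ρ (.arr i j k) x
  arr_zero : ∀ i j k, ¬ (S.C i j < 0 ∧ k < S.g i j) → ∀ x, ρ (.arr i j k) x = 0
  nilp : ∀ i x, (ρ (.eps i) ^ S.c i) x = 0
  comm : ∀ i j k, S.C i j < 0 → k < S.g i j → ∀ x,
    (ρ (.eps i) ^ S.f j i) (ρ (.arr i j k) x) = ρ (.arr i j k) ((ρ (.eps j) ^ S.f i j) x)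
  mesh : ∀ i x, ∑ j with S.C j i < 0, ∑ k ∈ Finset.range (S.g i j),
    ∑ l ∈ Finset.range (S.f j i), S.sgn K i j • (ρ (.eps i) ^ l) (ρ (.arr i j k)
      (ρ (.arr j i k) ((ρ (.eps i) ^ (S.f j i - 1 - l)) x))) = 0

variable {S K} {ρ : Gen ι → Module.End K V}

theorem IsRep.rel (h : S.IsRep K ρ) {a b : FreeAlgebra K (Gen ι)} (hab : S.Rel K a b) :
    FreeAlgebra.lift K ρ a = FreeAlgebra.lift K ρ b := by
  have he : ∀ i, FreeAlgebra.lift K ρ (fe K i) = ρ (.e i) := fun i => FreeAlgebra.lift_ι_apply _ _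
  have heps : ∀ i, FreeAlgebra.lift K ρ (feps K i) = ρ (.eps i) :=
    fun i => FreeAlgebra.lift_ι_apply _ _
  have harr : ∀ i j k, FreeAlgebra.lift K ρ (farr K i j k) = ρ (.arr i j k) :=
    fun i j k => FreeAlgebra.lift_ι_apply _ _
  ext x
  cases hab with
  | idem i => simp only [map_mul, he]; exact h.idem i x
  | orth i j hij => simp only [map_mul, he, map_zero]; exact h.orth i j x hij
  | one => simp only [map_sum, he, map_one, LinearMap.sum_apply]; exact h.one x
  | eps_vertex i => simp only [map_mul, he, heps]; exact h.eps_vertex i x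
  | arr_vertex i j k => simp only [map_mul, he, harr]; exact h.arr_vertex i j k x
  | arr_zero i j k hk => simp only [harr, map_zero]; exact h.arr_zero i j k hk x
  | nilp i => simp only [map_pow, heps, map_zero]; exact h.nilp i x
  | comm i j k hC hk =>
    simp only [map_mul, map_pow, heps, harr]; exact h.comm i j k hC hk x
  | mesh i =>
    simpa only [map_sum, map_smul, map_mul, map_pow, heps, harr, map_zero, LinearMap.sum_apply,
      LinearMap.smul_apply, Module.End.mul_apply, LinearMap.zero_apply] using h.mesh i x

/-- The space `V` with the `Π`-action given by the operators `ρ`. -/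
def RepMod (_ : S.IsRep K ρ) : Type v := V

namespace RepMod

variable (h : S.IsRep K ρ)

instance : AddCommGroup (RepMod h) := inferInstanceAs (AddCommGroup V)
instance : Module K (RepMod h) := inferInstanceAs (Module K V)

/-- The algebra homomorphism from `Π` to the endomorphisms of `V`. -/
noncomputable def hom : S.Preproj K →ₐ[K] Module.End K V :=
  RingQuot.liftAlgHom K ⟨FreeAlgebra.lift K ρ, fun _ _ hab => h.rel hab⟩

theorem hom_quot (a : FreeAlgebra K (Gen ι)) : hom h (S.quot K a) = FreeAlgebra.lift K ρ a :=
  RingQuot.liftAlgHom_mkAlgHom_apply ..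

noncomputable instance : Module (S.Preproj K) (RepMod h) :=
  Module.compHom (M := V) (R := Module.End K V) (hom h).toRingHom

instance : IsScalarTower K (S.Preproj K) (RepMod h) :=
  IsScalarTower.of_algebraMap_smul fun t (x : V) => by
    change hom h (algebraMap K _ t) x = t • x
    rw [AlgHom.commutes]
    rfl

/-- The identification of `V` with the module. -/
noncomputable def of : V ≃ₗ[K] RepMod h := LinearEquiv.refl K V

theorem e_smul (i : ι) (x : V) : S.e K i • of h x = of h (ρ (.e i) x) := by
  change hom h (S.quot K _) x = _
  rw [hom_quot, fe, FreeAlgebra.lift_ι_apply]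
  rfl

theorem eps_smul (i : ι) (x : V) : S.eps K i • of h x = of h (ρ (.eps i) x) := by
  change hom h (S.quot K _) x = _
  rw [hom_quot, feps, FreeAlgebra.lift_ι_apply]
  rfl

theorem arr_smul (i j : ι) (k : ℕ) (x : V) :
    S.arr K i j k • of h x = of h (ρ (.arr i j k) x) := by
  change hom h (S.quot K _) x = _
  rw [hom_quot, farr, FreeAlgebra.lift_ι_apply]
  rfl

theorem eps_pow_smul (i : ι) (n : ℕ) (x : V) :
    S.eps K i ^ n • of h x = of h ((ρ (.eps i) ^ n) x) := by
  induction n with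
  | zero => simp
  | succ n ih => rw [pow_succ', mul_smul, ih, eps_smul, pow_succ', Module.End.mul_apply]

end RepMod

end Rep

end CartanDatum

namespace CartanDatum

/-! ### The complex of M_out and M_in at a vertex -/

section Tilde

variable {ι : Type w} [Fintype ι] (S : CartanDatum ι) (K : Type u) [Field K]
  (M : Type v) [AddCommGroup M] [Module K M] [Module (S.Preproj K) M]
  [IsScalarTower K (S.Preproj K) M]

/-- A model of the `H_i`-module `⨁_j iHj ⊗ e_j M`: its elements are families of sequences in the
spaces `e_j M`, one for each arrow between `i` and `j`, which satisfy a linear recursion. The element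
`ε_i` acts by the shift. -/
noncomputable def tilde (i : ι) : Submodule K (ι → ℕ → ℕ → M) where
  carrier := {x | ∀ b k, (¬ (S.C b i < 0 ∧ k < S.g i b) → ∀ l, x b k l = 0) ∧
    ∀ l, S.e K b • x b k l = x b k l ∧ x b k (l + S.f b i) = S.eps K b ^ S.f i b • x b k l}
  add_mem' {x y} hx hy b k := by
    refine ⟨fun h l => ?_, fun l => ⟨?_, ?_⟩⟩
    · simp [(hx b k).1 h l, (hy b k).1 h l]
    · simp [((hx b k).2 l).1, ((hy b k).2 l).1]
    · simp [((hx b k).2 l).2, ((hy b k).2 l).2]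
  zero_mem' b k := by simp
  smul_mem' t x hx b k := by
    refine ⟨fun h l => ?_, fun l => ⟨?_, ?_⟩⟩
    · simp [(hx b k).1 h l]
    · simp [((hx b k).2 l).1, smul_comm_K]
    · simp [((hx b k).2 l).2, smul_comm_K]

variable {M}

/-- The shift of sequences. -/
noncomputable def shift : Module.End K (ι → ℕ → ℕ → M) where
  toFun x b k l := x b k (l + 1)
  map_add' _ _ := rfl
  map_smul' _ _ := rfl

theorem shift_apply (x : ι → ℕ → ℕ → M) (b : ι) (k l : ℕ) :
    shift K x b k l = x b k (l + 1) := rfl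

theorem shift_pow_apply (n : ℕ) (x : ι → ℕ → ℕ → M) (b : ι) (k l : ℕ) :
    (shift K ^ n) x b k l = x b k (l + n) := by
  induction n generalizing l with
  | zero => rfl
  | succ n ih =>
    rw [pow_succ', Module.End.mul_apply, shift_apply, ih]
    congr 1
    omega

/-- The map `M_in` at the vertex `i`. -/
noncomputable def tin (i : ι) : (ι → ℕ → ℕ → M) →ₗ[K] M where
  toFun x := ∑ b with S.C b i < 0, ∑ k ∈ Finset.range (S.g i b), ∑ l ∈ Finset.range (S.f b i),
    S.eps K i ^ l • S.arr K i b k • x b k (S.f b i - 1 - l)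
  map_add' x y := by simp only [Pi.add_apply, smul_add, Finset.sum_add_distrib]
  map_smul' t x := by
    simp only [Pi.smul_apply, smul_comm_K, ← Finset.smul_sum, RingHom.id_apply]

/-- The map `M_out` at the vertex `i`. -/
noncomputable def tout (i : ι) : M →ₗ[K] (ι → ℕ → ℕ → M) where
  toFun x b k l := S.sgn K i b • S.arr K b i k • S.eps K i ^ l • x
  map_add' x y := by ext b k l; simp only [Pi.add_apply, smul_add]
  map_smul' t x := by
    ext b k l
    simp only [Pi.smul_apply, smul_comm_K, RingHom.id_apply]
    rw [smul_comm]

variable {S K}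

theorem tout_apply (i : ι) (x : M) (b : ι) (k l : ℕ) :
    S.tout K i x b k l = S.sgn K i b • S.arr K b i k • S.eps K i ^ l • x := rfl

theorem tin_apply (i : ι) (x : ι → ℕ → ℕ → M) :
    S.tin K i x = ∑ b with S.C b i < 0, ∑ k ∈ Finset.range (S.g i b),
      ∑ l ∈ Finset.range (S.f b i), S.eps K i ^ l • S.arr K i b k • x b k (S.f b i - 1 - l) := rfl

theorem tilde_add_mul {i : ι} {x : ι → ℕ → ℕ → M} (hx : x ∈ S.tilde K M i) (b : ι) (k l n : ℕ) :
    x b k (l + n * S.f b i) = S.eps K b ^ (n * S.f i b) • x b k l := by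
  induction n with
  | zero => simp
  | succ n ih =>
    rw [add_mul, one_mul, ← add_assoc, ((hx b k).2 _).2, ih, ← mul_smul, ← pow_add, add_mul, one_mul,
      add_comm]

theorem tout_mem (i : ι) (x : M) : S.tout K i x ∈ S.tilde K M i := by
  refine fun b k => ⟨fun h l => ?_, fun l => ⟨?_, ?_⟩⟩
  · rw [tout_apply, arr_eq_zero _ _ _ _ _ (by rwa [S.g_comm b i]), zero_smul, smul_zero]
  · rw [tout_apply, smul_comm_K, e_arr_smul]
  · rw [tout_apply, tout_apply, smul_comm_K, eps_arr_smul, ← mul_smul (S.eps K i ^ _), ← pow_add,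
      add_comm]

/-- This is the mesh relation at `i`; its sign is carried by `tout` alone. -/
theorem tin_tout (i : ι) (x : M) : S.tin K i (S.tout K i x) = 0 := by
  have h := congrArg (fun a => a • x) (S.mesh K i)
  simp only [Finset.sum_smul, zero_smul] at h
  rw [← h, tin_apply]
  refine Finset.sum_congr rfl fun b _ => Finset.sum_congr rfl fun k _ =>
    Finset.sum_congr rfl fun l _ => ?_
  rw [tout_apply, smul_comm_K, smul_comm_K, smul_assoc, mul_smul, mul_smul, mul_smul]

theorem shift_mem {i : ι} {x : ι → ℕ → ℕ → M} (hx : x ∈ S.tilde K M i) :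
    shift K x ∈ S.tilde K M i := by
  refine fun b k => ⟨fun h l => (hx b k).1 h _, fun l => ⟨((hx b k).2 _).1, ?_⟩⟩
  rw [shift_apply, shift_apply, ← ((hx b k).2 _).2]
  congr 1
  omega

/-- The summands on the two sides match after a shift of the index. The boundary terms agree by the
commutation relation between arrows and loops together with the recursion that defines `tilde`. -/
theorem tin_shift {i : ι} {x : ι → ℕ → ℕ → M} (hx : x ∈ S.tilde K M i) :
    S.tin K i (shift K x) = S.eps K i • S.tin K i x := by
  simp only [tin_apply, Finset.smul_sum]
  refine Finset.sum_congr rfl fun b hb => Finset.sum_congr rfl fun k _ => ?_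
  obtain ⟨f, hf⟩ : ∃ f, S.f b i = f + 1 :=
    ⟨S.f b i - 1, by have := S.f_pos (Finset.mem_filter.mp hb).2; omega⟩
  rw [hf, Finset.sum_range_succ', Finset.sum_range_succ]
  congr 1
  · refine Finset.sum_congr rfl fun l hl => ?_
    rw [pow_succ', mul_smul, shift_apply]
    have := Finset.mem_range.mp hl
    congr 4
    omega
  · rw [shift_apply, ← mul_smul (S.eps K i), ← pow_succ', ← hf, eps_arr_smul, pow_zero, one_smul]
    congr 1
    have := ((hx b k).2 0).2
    rw [hf] at this ⊢
    simp only [zero_add] at this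
    simpa using this

theorem tout_eps (i : ι) (x : M) : S.tout K i (S.eps K i • x) = shift K (S.tout K i x) := by
  ext b k l
  rw [shift_apply, tout_apply, tout_apply, pow_succ, mul_smul]

theorem e_tin (i : ι) (x : ι → ℕ → ℕ → M) : S.e K i • S.tin K i x = S.tin K i x := by
  simp only [tin_apply, Finset.smul_sum]
  refine Finset.sum_congr rfl fun b _ => Finset.sum_congr rfl fun k _ =>
    Finset.sum_congr rfl fun l _ => ?_
  rw [e_eps_pow_smul _ _ _ _ _ (e_arr_smul ..)]

variable (S K) in
/-- The element of `tilde` whose values at the initial positions are prescribed by `y`. -/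
noncomputable def tildeExt (i : ι) (y : ι → ℕ → ℕ → M) : ι → ℕ → ℕ → M :=
  open Classical in fun b k l =>
  if S.C b i < 0 ∧ k < S.g i b then
    S.eps K b ^ (l / S.f b i * S.f i b) • S.e K b • y b k (l % S.f b i) else 0

theorem tildeExt_mem (i : ι) (y : ι → ℕ → ℕ → M) : S.tildeExt K i y ∈ S.tilde K M i := by
  refine fun b k => ⟨fun h l => if_neg h, fun l => ?_⟩
  by_cases h : S.C b i < 0 ∧ k < S.g i b
  · have hf := S.f_pos h.1
    simp only [tildeExt, if_pos h]
    refine ⟨e_eps_pow_smul _ _ _ _ _ (e_e_smul ..), ?_⟩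
    rw [Nat.add_div_right _ hf, Nat.add_mod_right, ← mul_smul (S.eps K b ^ S.f i b) (S.eps K b ^ _),
      ← pow_add, Nat.succ_mul, add_comm]
  · simp [tildeExt, if_neg h]

theorem tildeExt_apply_of_lt {i : ι} (y : ι → ℕ → ℕ → M) {b : ι} {k l : ℕ} (hb : S.C b i < 0)
    (hk : k < S.g i b) (hl : l < S.f b i) : S.tildeExt K i y b k l = S.e K b • y b k l := by
  rw [tildeExt, if_pos ⟨hb, hk⟩, Nat.div_eq_of_lt hl, Nat.mod_eq_of_lt hl]
  simp

theorem tilde_ext {i : ι} {x y : ι → ℕ → ℕ → M} (hx : x ∈ S.tilde K M i)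
    (hy : y ∈ S.tilde K M i)
    (h : ∀ b k l, S.C b i < 0 → k < S.g i b → l < S.f b i → x b k l = y b k l) : x = y := by
  ext b k l
  by_cases hbk : S.C b i < 0 ∧ k < S.g i b
  · have e : l = l % S.f b i + l / S.f b i * S.f b i := by
      rw [mul_comm]; exact (Nat.mod_add_div _ _).symm
    rw [e, tilde_add_mul hx, tilde_add_mul hy,
      h b k _ hbk.1 hbk.2 (Nat.mod_lt _ (S.f_pos hbk.1))]
  · rw [(hx b k).1 hbk, (hy b k).1 hbk]

theorem exists_tin_eq_arr (i b : ι) (k : ℕ) (y : M) :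
    ∃ x ∈ S.tilde K M i, S.tin K i x = S.arr K i b k • y := by
  classical
  by_cases h : S.C b i < 0 ∧ k < S.g i b
  · refine ⟨S.tildeExt K i fun b' k' l => if b' = b ∧ k' = k ∧ l = S.f b i - 1 then y else 0,
      tildeExt_mem _ _, ?_⟩
    have hf := S.f_pos h.1
    rw [tin_apply, Finset.sum_eq_single b, Finset.sum_eq_single k, Finset.sum_eq_single 0]
    · rw [tildeExt_apply_of_lt _ h.1 h.2 (by omega)]
      simp [arr_e_smul]
    · intro l hl hl0
      have := Finset.mem_range.mp hl
      rw [tildeExt_apply_of_lt _ h.1 h.2 (by omega), if_neg (by omega)]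
      simp
    · intro h0
      simp at h0
      omega
    · intro k' hk' hkk
      refine Finset.sum_eq_zero fun l hl => ?_
      rw [tildeExt_apply_of_lt _ h.1 (Finset.mem_range.mp hk') (by
        have := Finset.mem_range.mp hl; omega), if_neg (by tauto)]
      simp
    · intro h0
      exact absurd (Finset.mem_range.mpr h.2) h0
    · intro b' hb' hbb
      have hb' := (Finset.mem_filter.mp hb').2
      refine Finset.sum_eq_zero fun k' hk' => Finset.sum_eq_zero fun l hl => ?_
      rw [tildeExt_apply_of_lt _ hb' (Finset.mem_range.mp hk') (by
        have := Finset.mem_range.mp hl; omega), if_neg (by tauto)]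
      simp
    · intro h0
      simp [h.1] at h0
  · exact ⟨0, zero_mem _, by
      rw [map_zero, arr_eq_zero _ _ _ _ _ (by rwa [S.neg_comm i b]), zero_smul]⟩

variable (S K M) in
/-- Elements of `tilde` are determined by their initial values. -/
noncomputable def tildeEquiv (i : ι) : S.tilde K M i ≃ₗ[K]
    ((b : {b // S.C b i < 0}) → Fin (S.g i b) → Fin (S.f b i) → S.vertexSpace K M b) where
  toFun x b k l := ⟨x.1 b k l, (S.mem_vertexSpace K).mpr ((x.2 b k).2 l).1⟩
  map_add' _ _ := rfl
  map_smul' _ _ := rfl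
  invFun y := ⟨S.tildeExt K i fun b k l =>
    if h : S.C b i < 0 ∧ k < S.g i b ∧ l < S.f b i then y ⟨b, h.1⟩ ⟨k, h.2.1⟩ ⟨l, h.2.2⟩ else 0,
    tildeExt_mem _ _⟩
  left_inv x := by
    refine Subtype.ext (tilde_ext (Subtype.coe_prop _) x.2 fun b k l hb hk hl => ?_)
    dsimp only
    rw [tildeExt_apply_of_lt _ hb hk hl, dif_pos ⟨hb, hk, hl⟩]
    exact ((x.2 b k).2 l).1
  right_inv y := by
    ext b k l
    dsimp only
    rw [tildeExt_apply_of_lt _ b.2 k.2 l.2, dif_pos ⟨b.2, k.2, l.2⟩]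
    exact (S.mem_vertexSpace K).mp (y b k l).2

instance tilde_finite [Module.Finite K M] (i : ι) : Module.Finite K (S.tilde K M i) :=
  Module.Finite.equiv (S.tildeEquiv K M i).symm

theorem finrank_tilde [Module.Finite K M] (i : ι) : Module.finrank K (S.tilde K M i) =
    ∑ b with S.C b i < 0, (S.C b i).natAbs * S.vdim K M b := by
  classical
  rw [(S.tildeEquiv K M i).finrank_eq, Module.finrank_pi_fintype, Finset.sum_subtype
    (p := fun b => S.C b i < 0) (F := inferInstance) _ (by simp)]
  refine Finset.sum_congr rfl fun b _ => ?_
  rw [Module.finrank_pi_fintype]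
  simp only [Module.finrank_pi_fintype]
  simp only [Finset.sum_const, Finset.card_univ, Fintype.card_fin, smul_eq_mul, vdim]
  rw [← g_mul_f, S.g_comm b i, mul_assoc]

variable (S K M) in
/-- The shift as an endomorphism of `tilde`. -/
noncomputable def tildeShift (i : ι) : Module.End K (S.tilde K M i) :=
  (shift K).restrict fun _ hx => shift_mem hx

theorem tildeShift_pow_coe (i : ι) (n : ℕ) (x : S.tilde K M i) :
    (((S.tildeShift K M i) ^ n) x : ι → ℕ → ℕ → M) = (shift K ^ n) x.1 := by
  induction n with
  | zero => rfl
  | succ n ih => rw [pow_succ', pow_succ', Module.End.mul_apply, Module.End.mul_apply, ← ih]; rfl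

/-- Since `c_i = m f_bi` and `c_b = m f_ib`, shifting by `c_i` multiplies the component at `b` by
`ε_b ^ c_b = 0`. -/
theorem shift_pow_c {i : ι} {x : ι → ℕ → ℕ → M} (hx : x ∈ S.tilde K M i) :
    (shift K ^ S.c i) x = 0 := by
  ext b k l
  rw [shift_pow_apply]
  by_cases h : S.C b i < 0 ∧ k < S.g i b
  · obtain ⟨m, h1, h2⟩ := S.exists_c_eq ((S.neg_comm b i).mp h.1)
    rw [h1, tilde_add_mul hx, ← h2, eps_pow, zero_smul]
    rfl
  · rw [(hx b k).1 h]
    rfl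

/-- A sequence killed by the shift is concentrated in position 0, with a value killed by `ε_b ^
f_ib`. Freeness at `b` writes this value as `ε_b ^ (c_b - f_ib)` applied to some `y`. -/
theorem nilFree_tildeShift (i : ι) (hM : ∀ b, S.C b i < 0 → S.LocFree K M b) :
    NilFree (S.tildeShift K M i) (S.c i) := by
  classical
  refine ⟨?_, fun x hx => ?_⟩
  · ext1 x
    apply Subtype.ext
    rw [tildeShift_pow_coe, shift_pow_c x.2]
    rfl
  · have hx1 : ∀ b k l, x.1 b k (l + 1) = 0 := fun b k l =>
      congrFun (congrFun (congrFun (congrArg Subtype.val hx) b) k) l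
    have hy : ∀ b k, S.C b i < 0 →
        ∃ y, S.e K b • y = y ∧ S.eps K b ^ (S.c b - S.f i b) • y = x.1 b k 0 := by
      intro b k hb
      have hf := S.f_pos hb
      have h0 : S.eps K b ^ S.f i b • x.1 b k 0 = 0 := by
        rw [← ((x.2 b k).2 0).2, zero_add]
        have := hx1 b k (S.f b i - 1)
        rwa [Nat.sub_add_cancel hf] at this
      obtain ⟨m, h1, h2⟩ := S.exists_c_eq ((S.neg_comm b i).mp hb)
      have hm : 1 ≤ m := by
        have := S.c_pos i
        rcases Nat.eq_zero_or_pos m with rfl | h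
        · omega
        · exact h
      have hle : S.f i b ≤ S.c b := by rw [h2]; exact Nat.le_mul_of_pos_left _ hm
      obtain ⟨y, hy⟩ := ((S.nilFree_epsEnd_iff K M b).mpr (hM b hb)).exists_of_pow (S.f i b) hle
        ⟨x.1 b k 0, (S.mem_vertexSpace K).mpr ((x.2 b k).2 0).1⟩
        (Subtype.ext (by rw [epsEnd_pow_apply, h0]; rfl))
      refine ⟨y, (S.mem_vertexSpace K).mp y.2, ?_⟩
      rw [← epsEnd_pow_apply, hy]
    choose! y hy1 hy2 using hy
    -- The position `f_bi - 1` is chosen because `c_i - 1` is congruent to it modulo `f_bi`: after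
    -- `c_i - 1` shifts the value `y` arrives at position 0 with exactly the required power of
    -- `ε_b`.
    refine ⟨⟨S.tildeExt K i fun b k l => if l = S.f b i - 1 then y b k else 0, tildeExt_mem _ _⟩,
      Subtype.ext (tilde_ext ?_ x.2 fun b k l hb hk hl => ?_)⟩
    · exact Subtype.coe_prop _
    · rw [tildeShift_pow_coe, shift_pow_apply]
      dsimp only
      have hf := S.f_pos hb
      obtain ⟨m, h1, h2⟩ := S.exists_c_eq ((S.neg_comm b i).mp hb)
      obtain ⟨m, rfl⟩ : ∃ m', m = m' + 1 := by
        refine ⟨m - 1, ?_⟩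
        have := S.c_pos i
        rcases Nat.eq_zero_or_pos m with rfl | h
        · omega
        · omega
      cases l with
      | zero =>
        have e : 0 + (S.c i - 1) = (S.f b i - 1) + m * S.f b i := by
          rw [h1, add_mul]; omega
        rw [e, tilde_add_mul (tildeExt_mem _ _), tildeExt_apply_of_lt _ hb hk (by omega),
          if_pos rfl, hy1 b k hb, ← hy2 b k hb, h2, add_mul]
        congr 2
        omega
      | succ l =>
        have e : l + 1 + (S.c i - 1) = l + (m + 1) * S.f b i := by
          have := S.c_pos i
          rw [← h1]; omega
        rw [e, tilde_add_mul (tildeExt_mem _ _), ← h2, eps_pow, zero_smul, hx1]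

variable {M' : Type*} [AddCommGroup M'] [Module K M'] [Module (S.Preproj K) M']
  [IsScalarTower K (S.Preproj K) M']

/-- Functoriality of `tilde`. -/
noncomputable def tildeMap (j : M →ₗ[S.Preproj K] M') : (ι → ℕ → ℕ → M) →ₗ[K] (ι → ℕ → ℕ → M') where
  toFun x b k l := j (x b k l)
  map_add' x y := by ext b k l; exact map_add j _ _
  map_smul' t x := by ext b k l; exact (j.restrictScalars K).map_smul t _

theorem tildeMap_apply (j : M →ₗ[S.Preproj K] M') (x : ι → ℕ → ℕ → M) (b : ι) (k l : ℕ) :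
    tildeMap j x b k l = j (x b k l) := rfl

theorem tildeMap_injective {j : M →ₗ[S.Preproj K] M'} (hj : Function.Injective j) :
    Function.Injective (tildeMap j) := by
  intro x y h
  ext b k l
  exact hj (congrFun (congrFun (congrFun h b) k) l)

theorem tin_tildeMap (j : M →ₗ[S.Preproj K] M') (i : ι) (x : ι → ℕ → ℕ → M) :
    S.tin K i (tildeMap j x) = j (S.tin K i x) := by
  simp only [tin_apply, map_sum, map_smul, tildeMap_apply]

theorem tout_map (j : M →ₗ[S.Preproj K] M') (i : ι) (x : M) :
    S.tout K i (j x) = tildeMap j (S.tout K i x) := by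
  ext b k l
  rw [tildeMap_apply, tout_apply, tout_apply, ← map_smul j, ← map_smul j]
  exact ((j.restrictScalars K).map_smul _ _).symm

theorem tildeMap_mem (j : M →ₗ[S.Preproj K] M') {i : ι} {x : ι → ℕ → ℕ → M}
    (hx : x ∈ S.tilde K M i) : tildeMap j x ∈ S.tilde K M' i := by
  refine fun b k => ⟨fun h l => ?_, fun l => ⟨?_, ?_⟩⟩
  · rw [tildeMap_apply, (hx b k).1 h, map_zero]
  · rw [tildeMap_apply, ← map_smul, ((hx b k).2 l).1]
  · rw [tildeMap_apply, tildeMap_apply, ((hx b k).2 l).2, map_smul]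

/-- There is no arrow from `i` to itself, so `tilde` at `i` involves only the spaces at the other
vertices. -/
theorem exists_tildeMap_eq {j : M →ₗ[S.Preproj K] M'} (hj : Function.Injective j) {i : ι}
    (hr : ∀ b, b ≠ i → ∀ x : M', S.e K b • x = x → x ∈ LinearMap.range j) {x : ι → ℕ → ℕ → M'}
    (hx : x ∈ S.tilde K M' i) : ∃ y ∈ S.tilde K M i, tildeMap j y = x := by
  have h : ∀ b k l, ∃ y, j y = x b k l := by
    intro b k l
    by_cases hb : S.C b i < 0 ∧ k < S.g i b
    · exact hr b (S.ne_of_neg hb.1) _ ((hx b k).2 l).1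
    · exact ⟨0, by rw [(hx b k).1 hb, map_zero]⟩
  choose y hy using h
  refine ⟨y, fun b k => ⟨fun h l => hj ?_, fun l => ⟨hj ?_, hj ?_⟩⟩, ?_⟩
  · rw [hy, (hx b k).1 h, map_zero]
  · rw [map_smul, hy, ((hx b k).2 l).1]
  · rw [map_smul, hy, hy, ((hx b k).2 l).2]
  · ext b k l
    exact hy b k l

end Tilde

end CartanDatum

namespace CartanDatum

/-! ### Operators on invariant subspaces, and embeddings that are onto at some vertices -/

section RepOn

variable {ι : Type w} [Fintype ι] (S : CartanDatum ι) (K : Type u) [Field K]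
  {X : Type v} [AddCommGroup X] [Module K X]

/-- The operators `ρ` preserve the subspace `Z` and satisfy on it the relations of `Π`. -/
structure IsRepOn (ρ : Gen ι → Module.End K X) (Z : Submodule K X) : Prop where
  mem : ∀ a, ∀ x ∈ Z, ρ a x ∈ Z
  idem : ∀ i, ∀ x ∈ Z, ρ (.e i) (ρ (.e i) x) = ρ (.e i) x
  orth : ∀ i j, ∀ x ∈ Z, i ≠ j → ρ (.e i) (ρ (.e j) x) = 0
  one : ∀ x ∈ Z, ∑ i, ρ (.e i) x = x
  eps_vertex : ∀ i, ∀ x ∈ Z, ρ (.e i) (ρ (.eps i) (ρ (.e i) x)) = ρ (.eps i) x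
  arr_vertex : ∀ i j k, ∀ x ∈ Z, ρ (.e i) (ρ (.arr i j k) (ρ (.e j) x)) = ρ (.arr i j k) x
  arr_zero : ∀ i j k, ¬ (S.C i j < 0 ∧ k < S.g i j) → ∀ x ∈ Z, ρ (.arr i j k) x = 0
  nilp : ∀ i, ∀ x ∈ Z, (ρ (.eps i) ^ S.c i) x = 0
  comm : ∀ i j k, S.C i j < 0 → k < S.g i j → ∀ x ∈ Z,
    (ρ (.eps i) ^ S.f j i) (ρ (.arr i j k) x) = ρ (.arr i j k) ((ρ (.eps j) ^ S.f i j) x)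
  mesh : ∀ i, ∀ x ∈ Z, ∑ j with S.C j i < 0, ∑ k ∈ Finset.range (S.g i j),
    ∑ l ∈ Finset.range (S.f j i), S.sgn K i j • (ρ (.eps i) ^ l) (ρ (.arr i j k)
      (ρ (.arr j i k) ((ρ (.eps i) ^ (S.f j i - 1 - l)) x))) = 0

variable {S K} {ρ : Gen ι → Module.End K X} {Z : Submodule K X}

/-- The restriction of the operators to an invariant subspace. -/
noncomputable def IsRepOn.restrict (h : S.IsRepOn K ρ Z) (a : Gen ι) : Module.End K Z :=
  (ρ a).restrict (h.mem a)

theorem IsRepOn.restrict_coe (h : S.IsRepOn K ρ Z) (a : Gen ι) (x : Z) :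
    (h.restrict a x : X) = ρ a x := rfl

theorem IsRepOn.restrict_pow_coe (h : S.IsRepOn K ρ Z) (a : Gen ι) (n : ℕ) (x : Z) :
    ((h.restrict a ^ n) x : X) = (ρ a ^ n) x := by
  induction n with
  | zero => rfl
  | succ n ih =>
    rw [pow_succ', pow_succ', Module.End.mul_apply, Module.End.mul_apply, restrict_coe, ih]

theorem IsRepOn.isRep (h : S.IsRepOn K ρ Z) : S.IsRep K h.restrict where
  idem i x := Subtype.ext (h.idem i x x.2)
  orth i j x hij := Subtype.ext (h.orth i j x x.2 hij)
  one x := Subtype.ext (by rw [AddSubmonoidClass.coe_finsetSum]; exact h.one x x.2)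
  eps_vertex i x := Subtype.ext (h.eps_vertex i x x.2)
  arr_vertex i j k x := Subtype.ext (h.arr_vertex i j k x x.2)
  arr_zero i j k hk x := Subtype.ext (h.arr_zero i j k hk x x.2)
  nilp i x := Subtype.ext (by rw [restrict_pow_coe]; exact h.nilp i x x.2)
  comm i j k hC hk x := Subtype.ext (by
    simp only [restrict_pow_coe, restrict_coe]; exact h.comm i j k hC hk x x.2)
  mesh i x := Subtype.ext (by
    simp only [AddSubmonoidClass.coe_finsetSum, Submodule.coe_smul, restrict_pow_coe, restrict_coe]
    exact h.mesh i x x.2)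

end RepOn

section Embedding

variable {ι : Type w} [Fintype ι] {S : CartanDatum ι} {K : Type u} [Field K]
  {M : Type v} [AddCommGroup M] [Module K M] [Module (S.Preproj K) M]
  [IsScalarTower K (S.Preproj K) M]
  {T : Type*} [AddCommGroup T] [Module K T] [Module (S.Preproj K) T]
  [IsScalarTower K (S.Preproj K) T]

/-- The space `e_b T` is contained in the image of `j`. -/
def Covers (j : M →ₗ[S.Preproj K] T) (b : ι) : Prop :=
  ∀ x : T, S.e K b • x = x → x ∈ LinearMap.range j

theorem Covers.exists_eq {j : M →ₗ[S.Preproj K] T} {b : ι} (h : Covers j b) {x : T}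
    (hx : S.e K b • x = x) : ∃ y, S.e K b • y = y ∧ j y = x := by
  obtain ⟨y, rfl⟩ := h x hx
  exact ⟨S.e K b • y, S.e_e_smul K b y, by rw [map_smul, hx]⟩

theorem Covers.vdim_eq {j : M →ₗ[S.Preproj K] T} (hj : Function.Injective j) {b : ι}
    (h : Covers j b) : S.vdim K M b = S.vdim K T b := by
  refine LinearEquiv.finrank_eq (LinearEquiv.ofBijective (S.vmap K j b)
    ⟨S.vmap_injective K hj b, fun y => ?_⟩)
  obtain ⟨x, hx, hxy⟩ := h.exists_eq ((S.mem_vertexSpace K).mp y.2)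
  exact ⟨⟨x, (S.mem_vertexSpace K).mpr hx⟩, Subtype.ext hxy⟩

theorem Covers.locFree {j : M →ₗ[S.Preproj K] T} (hj : Function.Injective j) {b : ι}
    (h : Covers j b) (hM : S.LocFree K M b) : S.LocFree K T b := by
  intro x hx hx0
  obtain ⟨x, hx', rfl⟩ := h.exists_eq hx
  obtain ⟨y, hy, rfl⟩ := hM x hx' (hj (by rw [map_smul, hx0, map_zero]))
  exact ⟨j y, by rw [← map_smul, hy], by rw [← map_smul]⟩

theorem Covers.locFree' {j : M →ₗ[S.Preproj K] T} (hj : Function.Injective j) {b : ι}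
    (h : Covers j b) (hT : S.LocFree K T b) : S.LocFree K M b := by
  intro x hx hx0
  obtain ⟨y, hy, hyx⟩ := hT (j x) (by rw [← map_smul, hx]) (by rw [← map_smul, hx0, map_zero])
  obtain ⟨y, hy', rfl⟩ := h.exists_eq hy
  exact ⟨y, hy', hj (by rw [map_smul, hyx])⟩

/-- The cokernel of an injective map of modules which are locally free at `i` is locally free at
`i`. -/
theorem exists_coker_lift {j : M →ₗ[S.Preproj K] T} (hj : Function.Injective j) {i : ι}
    (hM : S.LocFree K M i) (hT : S.LocFree K T i) {x : T} (hx : S.e K i • x = x)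
    (hx' : S.eps K i • x ∈ LinearMap.range j) :
    ∃ y, S.e K i • y = y ∧ x - S.eps K i ^ (S.c i - 1) • y ∈ LinearMap.range j := by
  obtain ⟨z, hz⟩ := hx'
  obtain ⟨y, w, h⟩ := NilFree.coker (S.c_pos i) ((S.nilFree_epsEnd_iff K M i).mpr hM)
    ((S.nilFree_epsEnd_iff K T i).mpr hT) (S.vmap K j i)
    (fun x => Subtype.ext (map_smul j (S.eps K i) x.1)) (S.vmap_injective K hj i)
    ⟨x, (S.mem_vertexSpace K).mpr hx⟩ ⟨S.e K i • z, z, rfl⟩ (Subtype.ext (by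
      change S.eps K i • x = j (S.e K i • z)
      rw [map_smul, hz, e_eps_smul]))
  refine ⟨y, (S.mem_vertexSpace K).mp y.2, w, ?_⟩
  have := congrArg Subtype.val h
  rw [Submodule.coe_add, epsEnd_pow_apply] at this
  change x = _ + j w at this
  rw [this]
  abel

/-- The map `M_out` is injective at `i`. -/
def OutInj (S : CartanDatum ι) (K : Type u) [Field K] (M : Type v) [AddCommGroup M] [Module K M]
    [Module (S.Preproj K) M] [IsScalarTower K (S.Preproj K) M] (i : ι) : Prop :=
  ∀ x : M, S.e K i • x = x → S.tout K i x = 0 → x = 0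

theorem OutInj.of_injective {j : M →ₗ[S.Preproj K] T} (hj : Function.Injective j) {i : ι}
    (h : OutInj S K T i) : OutInj S K M i := by
  intro x hx hx0
  apply hj
  rw [map_zero]
  exact h _ (by rw [← map_smul, hx]) (by rw [tout_map, hx0, map_zero])

theorem Covers.outInj {j : M →ₗ[S.Preproj K] T} (hj : Function.Injective j) {i : ι}
    (hc : Covers j i) (h : OutInj S K M i) : OutInj S K T i := by
  intro x hx hx0
  obtain ⟨x, hx', rfl⟩ := hc.exists_eq hx
  rw [tout_map] at hx0
  rw [h x hx' (tildeMap_injective hj (by rw [hx0, map_zero])), map_zero]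

/-- The complex `M_i → tilde → M_i` is exact in the middle. -/
def MidExact (S : CartanDatum ι) (K : Type u) [Field K] (M : Type v) [AddCommGroup M] [Module K M]
    [Module (S.Preproj K) M] [IsScalarTower K (S.Preproj K) M] (i : ι) : Prop :=
  ∀ x ∈ S.tilde K M i, S.tin K i x = 0 → ∃ y, S.e K i • y = y ∧ S.tout K i y = x

end Embedding

/-! ### The submodule with the image of M_in at one vertex -/

section InImage

variable {ι : Type w} [Fintype ι] (S : CartanDatum ι) (K : Type u) [Field K]
  (M : Type v) [AddCommGroup M] [Module K M] [Module (S.Preproj K) M]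
  [IsScalarTower K (S.Preproj K) M]

instance finite_submodule [Module.Finite K M] (N : Submodule (S.Preproj K) M) :
    Module.Finite K N :=
  Module.Finite.of_injective (N.subtype.restrictScalars K) Subtype.val_injective

/-- The submodule generated by the spaces at the vertices other than `i`. -/
noncomputable def genSub (i : ι) : Submodule (S.Preproj K) M :=
  S.submoduleOfGens K
    (((S.tilde K M i).map (S.tin K i)).comap (Algebra.lsmul K K M (S.e K i)))
    (by
      rintro j x ⟨t, ht, htx⟩
      by_cases h : i = j
      · subst h
        exact ⟨t, ht, by rw [htx]; exact (S.e_e_smul K i x).symm⟩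
      · exact ⟨0, zero_mem _, by rw [map_zero]; exact (S.e_e_smul_ne K h x).symm⟩)
    (by
      rintro j x ⟨t, ht, htx⟩
      by_cases h : i = j
      · subst h
        refine ⟨shift K t, shift_mem ht, ?_⟩
        rw [tin_shift ht, htx]
        change S.eps K i • S.e K i • x = S.e K i • S.eps K i • x
        rw [eps_e_smul, e_eps_smul]
      · exact ⟨0, zero_mem _, by rw [map_zero]; exact (S.e_eps_smul_ne K h x).symm⟩)
    (by
      rintro a b k x -
      by_cases h : i = a
      · subst h
        obtain ⟨t, ht, htx⟩ := exists_tin_eq_arr (S := S) (K := K) i b k x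
        exact ⟨t, ht, htx.trans (S.e_arr_smul K i b k x).symm⟩
      · exact ⟨0, zero_mem _, by rw [map_zero]; exact (S.e_arr_smul_ne K h b k x).symm⟩)

variable {S K M}

theorem mem_genSub {i : ι} {x : M} :
    x ∈ S.genSub K M i ↔ ∃ t ∈ S.tilde K M i, S.tin K i t = S.e K i • x := Iff.rfl

theorem genSub_covers {i b : ι} (h : b ≠ i) : Covers (S.genSub K M i).subtype b := by
  intro x hx
  refine ⟨⟨x, mem_genSub.mpr ⟨0, zero_mem _, ?_⟩⟩, rfl⟩
  rw [map_zero, ← hx, e_e_smul_ne S K h.symm]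

variable (S K M)

/-- The map `M_in` on `tilde`. -/
noncomputable def tinT (i : ι) : S.tilde K M i →ₗ[K] M := (S.tin K i).domRestrict _

/-- The map `M_out` from `e_i M` to `tilde`. -/
noncomputable def toutV (i : ι) : S.vertexSpace K M i →ₗ[K] S.tilde K M i :=
  ((S.tout K i).domRestrict _).codRestrict _ fun x => tout_mem i x.1

variable {S K M}

theorem vdim_genSub (i : ι) :
    S.vdim K (S.genSub K M i) i = Module.finrank K (LinearMap.range (S.tinT K M i)) := by
  let φ : S.vertexSpace K (S.genSub K M i) i →ₗ[K] M :=
    (S.genSub K M i).subtype.restrictScalars K ∘ₗ Submodule.subtype _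
  have hφ : Function.Injective φ := fun x y h => Subtype.ext (Subtype.ext h)
  have hr : LinearMap.range φ = LinearMap.range (S.tinT K M i) := by
    ext x
    constructor
    · rintro ⟨y, rfl⟩
      obtain ⟨t, ht, hty⟩ := mem_genSub.mp y.1.2
      refine ⟨⟨t, ht⟩, hty.trans ?_⟩
      exact congrArg Subtype.val ((S.mem_vertexSpace K).mp y.2)
    · rintro ⟨t, rfl⟩
      have he := e_tin (S := S) (K := K) i t.1
      refine ⟨⟨⟨S.tin K i t.1, mem_genSub.mpr ⟨t.1, t.2, he.symm⟩⟩, ?_⟩, rfl⟩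
      exact (S.mem_vertexSpace K).mpr (Subtype.ext he)
  rw [← hr, LinearMap.finrank_range_of_inj hφ]
  rfl

variable [Module.Finite K M]

theorem range_toutV_le (i : ι) :
    LinearMap.range (S.toutV K M i) ≤ LinearMap.ker (S.tinT K M i) := by
  rintro _ ⟨x, rfl⟩
  exact tin_tout i x.1

theorem finrank_range_toutV {i : ι} (h : OutInj S K M i) :
    Module.finrank K (LinearMap.range (S.toutV K M i)) = S.vdim K M i := by
  rw [LinearMap.finrank_range_of_inj]
  · rfl
  · rw [injective_iff_map_eq_zero]
    intro x hx
    exact Subtype.ext (h x.1 ((S.mem_vertexSpace K).mp x.2) (congrArg Subtype.val hx))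

/-- Rank-nullity for M_in: its kernel contains the image of M_out, which has the dimension of `e_i
M` by injectivity. -/
theorem vdim_genSub_add_le {i : ι} (h : OutInj S K M i) :
    S.vdim K (S.genSub K M i) i + S.vdim K M i ≤ Module.finrank K (S.tilde K M i) := by
  rw [vdim_genSub, ← LinearMap.finrank_range_add_finrank_ker (S.tinT K M i),
    ← finrank_range_toutV h]
  exact Nat.add_le_add_left (Submodule.finrank_mono (range_toutV_le i)) _

/-- In the preceding inequality, equality forces the image of M_out to be the whole kernel of M_in.
-/
theorem midExact_of_eq {i : ι} (h : OutInj S K M i) (he : S.vdim K (S.genSub K M i) i +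
    S.vdim K M i = Module.finrank K (S.tilde K M i)) : MidExact S K M i := by
  intro x hx hx0
  rw [vdim_genSub, ← LinearMap.finrank_range_add_finrank_ker (S.tinT K M i),
    ← finrank_range_toutV h] at he
  have e := Submodule.eq_of_le_of_finrank_eq (range_toutV_le (S := S) (K := K) (M := M) i) (by omega)
  have hm : (⟨x, hx⟩ : S.tilde K M i) ∈ LinearMap.ker (S.tinT K M i) := hx0
  rw [← e] at hm
  obtain ⟨y, hy⟩ := hm
  exact ⟨y, (S.mem_vertexSpace K).mp y.2, congrArg Subtype.val hy⟩

theorem vdim_genSub_le (i : ι) : S.vdim K (S.genSub K M i) i ≤ S.vdim K M i :=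
  LinearMap.finrank_le_finrank_of_injective
    (S.vmap_injective K (Submodule.injective_subtype (S.genSub K M i)) i)

theorem tin_surj_of_eq {i : ι} (he : S.vdim K (S.genSub K M i) i = S.vdim K M i) (x : M)
    (hx : S.e K i • x = x) : ∃ t ∈ S.tilde K M i, S.tin K i t = x := by
  have hi := S.vmap_injective K (Submodule.injective_subtype (S.genSub K M i)) i
  have hs := (LinearMap.injective_iff_surjective_of_finrank_eq_finrank
    (f := S.vmap K (S.genSub K M i).subtype i) he).mp hi
  obtain ⟨y, hy⟩ := hs ⟨x, (S.mem_vertexSpace K).mpr hx⟩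
  obtain ⟨t, ht, h⟩ := mem_genSub.mp y.1.2
  refine ⟨t, ht, h.trans ?_⟩
  have e1 : (y.1 : M) = x := congrArg Subtype.val hy
  rw [e1, hx]

end InImage

/-! ### Reflection at a vertex: the operators and their relations -/

section Reflection

variable {ι : Type w} [Fintype ι] [DecidableEq ι] (S : CartanDatum ι) (K : Type u) [Field K]
  (M : Type v) [AddCommGroup M] [Module K M] [Module (S.Preproj K) M]
  [IsScalarTower K (S.Preproj K) M]

/-- The operators of the reflected module: the space at the vertex `i` is replaced by the kernel of
`M_in`. -/
noncomputable def reflOp (i : ι) : Gen ι → Module.End K (M × (ι → ℕ → ℕ → M))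
  | .e j => if j = i then LinearMap.prodMap 0 LinearMap.id
      else LinearMap.prodMap (Algebra.lsmul K K M (S.e K j)) 0
  | .eps j => if j = i then LinearMap.prodMap 0 (shift K)
      else LinearMap.prodMap (Algebra.lsmul K K M (S.eps K j)) 0
  | .arr a b k => if b = i then
        { toFun z := (S.sgn K i a • z.2 a k 0, 0)
          map_add' y z := by simp
          map_smul' t z := by simp [smul_comm t] }
      else if a = i then
        LinearMap.inr K M _ ∘ₗ S.tout K i ∘ₗ Algebra.lsmul K K M (S.arr K i b k) ∘ₗ
          LinearMap.fst K M _
      else LinearMap.prodMap (Algebra.lsmul K K M (S.arr K a b k)) 0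

/-- The space of the reflected module. -/
noncomputable def reflSub (i : ι) : Submodule K (M × (ι → ℕ → ℕ → M)) :=
  (LinearMap.ker (Algebra.lsmul K K M (S.e K i))).prod
    (S.tilde K M i ⊓ LinearMap.ker (S.tin K i))

variable {S K M}

theorem mem_reflSub {i : ι} {z : M × (ι → ℕ → ℕ → M)} : z ∈ S.reflSub K M i ↔
    S.e K i • z.1 = 0 ∧ z.2 ∈ S.tilde K M i ∧ S.tin K i z.2 = 0 := Iff.rfl

theorem reflOp_e_self (i : ι) (z : M × (ι → ℕ → ℕ → M)) :
    S.reflOp K M i (.e i) z = (0, z.2) := by simp [reflOp]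

theorem reflOp_e_ne {i j : ι} (h : j ≠ i) (z : M × (ι → ℕ → ℕ → M)) :
    S.reflOp K M i (.e j) z = (S.e K j • z.1, 0) := by simp [reflOp, h]

theorem reflOp_eps_self (i : ι) (z : M × (ι → ℕ → ℕ → M)) :
    S.reflOp K M i (.eps i) z = (0, shift K z.2) := by simp [reflOp]

theorem reflOp_eps_ne {i j : ι} (h : j ≠ i) (z : M × (ι → ℕ → ℕ → M)) :
    S.reflOp K M i (.eps j) z = (S.eps K j • z.1, 0) := by simp [reflOp, h]

theorem reflOp_arr_right (i a : ι) (k : ℕ) (z : M × (ι → ℕ → ℕ → M)) :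
    S.reflOp K M i (.arr a i k) z = (S.sgn K i a • z.2 a k 0, 0) := by simp [reflOp]

theorem reflOp_arr_left {i b : ι} (h : b ≠ i) (k : ℕ) (z : M × (ι → ℕ → ℕ → M)) :
    S.reflOp K M i (.arr i b k) z = (0, S.tout K i (S.arr K i b k • z.1)) := by simp [reflOp, h]

theorem reflOp_arr_ne {i a b : ι} (ha : a ≠ i) (hb : b ≠ i) (k : ℕ) (z : M × (ι → ℕ → ℕ → M)) :
    S.reflOp K M i (.arr a b k) z = (S.arr K a b k • z.1, 0) := by simp [reflOp, ha, hb]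

theorem reflOp_eps_pow_self (i : ι) (n : ℕ) (z : M × (ι → ℕ → ℕ → M)) :
    ((S.reflOp K M i (.eps i) ^ n) z).2 = (shift K ^ n) z.2 := by
  induction n with
  | zero => rfl
  | succ n ih => rw [pow_succ', pow_succ', Module.End.mul_apply, reflOp_eps_self,
      Module.End.mul_apply, ih]

theorem reflOp_eps_pow_self' (i : ι) (n : ℕ) (q : ι → ℕ → ℕ → M) :
    (S.reflOp K M i (.eps i) ^ n) (0, q) = (0, (shift K ^ n) q) := by
  induction n with
  | zero => rfl
  | succ n ih => rw [pow_succ', pow_succ', Module.End.mul_apply, ih, reflOp_eps_self,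
      Module.End.mul_apply]

theorem reflOp_eps_pow_ne {i j : ι} (h : j ≠ i) (n : ℕ) (z : M × (ι → ℕ → ℕ → M)) :
    ((S.reflOp K M i (.eps j) ^ n) z).1 = S.eps K j ^ n • z.1 := by
  induction n with
  | zero => simp
  | succ n ih => rw [pow_succ', pow_succ', Module.End.mul_apply, reflOp_eps_ne h, mul_smul, ih]

theorem reflOp_eps_pow_ne' {i j : ι} (h : j ≠ i) (n : ℕ) (p : M) :
    (S.reflOp K M i (.eps j) ^ n) (p, 0) = (S.eps K j ^ n • p, 0) := by
  induction n with
  | zero => simp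
  | succ n ih => rw [pow_succ', pow_succ', Module.End.mul_apply, ih, reflOp_eps_ne h, mul_smul]

theorem tout_eps_pow (i : ι) (n : ℕ) (x : M) :
    S.tout K i (S.eps K i ^ n • x) = (shift K ^ n) (S.tout K i x) := by
  induction n with
  | zero => simp
  | succ n ih => rw [pow_succ', mul_smul, tout_eps, ih, pow_succ', Module.End.mul_apply]

/-- The two signs at the arrows around `i` cancel, so a path from `j` to a neighbour and back acts
as before. Hence the mesh relations at the vertices other than `i` survive the reflection. -/
theorem reflOp_arr_arr {i j b : ι} (hj : j ≠ i) (k : ℕ) (z : M × (ι → ℕ → ℕ → M)) :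
    S.reflOp K M i (.arr j b k) (S.reflOp K M i (.arr b j k) z) =
      (S.arr K j b k • S.arr K b j k • z.1, 0) := by
  by_cases hb : b = i
  · subst hb
    rw [reflOp_arr_left hj, reflOp_arr_right]
    simp only [tout_apply, pow_zero, one_smul]
    rw [smul_smul, sgn_mul_self, one_smul]
  · rw [reflOp_arr_ne hj hb, reflOp_arr_ne hb hj]

/-- The commutation relations of arrows out of `i` are the recursion in `tilde`, those of arrows
into `i` are the compatibility of M_out with the shift, and the mesh relation at `i` holds since the
new space lies in the kernel of M_in. -/
theorem reflOp_isRepOn (i : ι) : S.IsRepOn K (S.reflOp K M i) (S.reflSub K M i) where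
  mem a z hz := by
    obtain ⟨h1, h2, h3⟩ := mem_reflSub.mp hz
    rw [mem_reflSub]
    cases a with
    | e j =>
      by_cases hj : j = i
      · subst hj
        rw [reflOp_e_self]
        exact ⟨smul_zero _, h2, h3⟩
      · rw [reflOp_e_ne hj]
        exact ⟨S.e_e_smul_ne K (Ne.symm hj) _, zero_mem _, map_zero _⟩
    | eps j =>
      by_cases hj : j = i
      · subst hj
        rw [reflOp_eps_self]
        exact ⟨smul_zero _, shift_mem h2, by rw [tin_shift h2, h3, smul_zero]⟩
      · rw [reflOp_eps_ne hj]
        exact ⟨S.e_eps_smul_ne K (Ne.symm hj) _, zero_mem _, map_zero _⟩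
    | arr a b k =>
      by_cases hb : b = i
      · subst hb
        rw [reflOp_arr_right]
        refine ⟨?_, zero_mem _, map_zero _⟩
        by_cases ha : a = b
        · subst ha
          rw [(h2 a k).1 (by rw [S.diag]; omega)]
          simp
        · rw [← ((h2 a k).2 0).1, smul_comm_K, e_e_smul_ne S K (Ne.symm ha), smul_zero]
      · by_cases ha : a = i
        · subst ha
          rw [reflOp_arr_left hb]
          exact ⟨smul_zero _, tout_mem _ _, tin_tout _ _⟩
        · rw [reflOp_arr_ne ha hb]
          exact ⟨S.e_arr_smul_ne K (Ne.symm ha) _ _ _, zero_mem _, map_zero _⟩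
  idem j z _ := by
    by_cases hj : j = i
    · subst hj
      simp only [reflOp_e_self]
    · simp only [reflOp_e_ne hj, e_e_smul]
  orth j l z _ hjl := by
    by_cases hj : j = i
    · subst hj
      rw [reflOp_e_ne (Ne.symm hjl), reflOp_e_self]
      rfl
    · by_cases hl : l = i
      · subst hl
        rw [reflOp_e_self, reflOp_e_ne hj]
        simp
      · rw [reflOp_e_ne hl, reflOp_e_ne hj, e_e_smul_ne S K hjl]
        rfl
  one z hz := by
    have h1 := (mem_reflSub.mp hz).1
    have h : ∀ j ∈ Finset.univ.erase i, S.reflOp K M i (.e j) z =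
        LinearMap.inl K M (ι → ℕ → ℕ → M) (S.e K j • z.1) :=
      fun j hj => reflOp_e_ne (Finset.ne_of_mem_erase hj) z
    rw [← Finset.add_sum_erase _ _ (Finset.mem_univ i), Finset.sum_congr rfl h, ← map_sum,
      reflOp_e_self]
    have h2 := S.sum_e_smul K z.1
    rw [← Finset.add_sum_erase _ _ (Finset.mem_univ i), h1, zero_add] at h2
    rw [h2]
    simp
  eps_vertex j z _ := by
    by_cases hj : j = i
    · subst hj
      simp only [reflOp_e_self, reflOp_eps_self]
    · simp only [reflOp_e_ne hj, reflOp_eps_ne hj, eps_e_smul, e_eps_smul]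
  arr_vertex a b k z hz := by
    by_cases hb : b = i
    · subst hb
      rw [reflOp_e_self, reflOp_arr_right, reflOp_arr_right]
      have h2 := (mem_reflSub.mp hz).2.1
      by_cases ha : a = b
      · subst ha
        rw [(h2 a k).1 (by rw [S.diag]; omega)]
        simp [reflOp_e_self]
      · rw [reflOp_e_ne ha, smul_comm_K, ((h2 a k).2 0).1]
    · rw [reflOp_e_ne hb]
      by_cases ha : a = i
      · subst ha
        simp only [reflOp_arr_left hb, reflOp_e_self, arr_e_smul]
      · simp only [reflOp_arr_ne ha hb, reflOp_e_ne ha, arr_e_smul, e_arr_smul]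
  arr_zero a b k h z hz := by
    by_cases hb : b = i
    · subst hb
      rw [reflOp_arr_right, ((mem_reflSub.mp hz).2.1 a k).1 (by rwa [S.g_comm b a]), smul_zero]
      rfl
    · by_cases ha : a = i
      · subst ha
        rw [reflOp_arr_left hb, arr_eq_zero _ _ _ _ _ h, zero_smul, map_zero]
        rfl
      · rw [reflOp_arr_ne ha hb, arr_eq_zero _ _ _ _ _ h, zero_smul]
        rfl
  nilp j z hz := by
    obtain ⟨n, hn⟩ : ∃ n, S.c j = n + 1 := ⟨S.c j - 1, by have := S.c_pos j; omega⟩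
    by_cases hj : j = i
    · subst hj
      have h2 := shift_pow_c (mem_reflSub.mp hz).2.1
      rw [hn] at h2 ⊢
      rw [pow_succ, Module.End.mul_apply, reflOp_eps_self, reflOp_eps_pow_self',
        ← Module.End.mul_apply, ← pow_succ, h2]
      rfl
    · rw [hn, pow_succ, Module.End.mul_apply, reflOp_eps_ne hj, reflOp_eps_pow_ne' hj, ← mul_smul,
        ← pow_succ, ← hn, eps_pow, zero_smul]
      rfl
  comm a b k hC hk z hz := by
    have hab := S.ne_of_neg hC
    by_cases hb : b = i
    · subst hb
      rw [reflOp_arr_right, reflOp_arr_right, reflOp_eps_pow_ne' hab, reflOp_eps_pow_self,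
        shift_pow_apply, ((mem_reflSub.mp hz).2.1 a k |>.2 0).2, smul_comm_K]
    · by_cases ha : a = i
      · subst ha
        rw [reflOp_arr_left hb, reflOp_arr_left hb, reflOp_eps_pow_self', reflOp_eps_pow_ne hb,
          ← tout_eps_pow, eps_arr_smul]
      · rw [reflOp_arr_ne ha hb, reflOp_arr_ne ha hb, reflOp_eps_pow_ne' ha, reflOp_eps_pow_ne hb,
          eps_arr_smul]
  mesh j z hz := by
    by_cases hj : j = i
    · subst hj
      have h3 := (mem_reflSub.mp hz).2.2
      -- Each summand of the mesh expression at the reflected vertex is M_out applied to the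
      -- corresponding summand of M_in. The sum is therefore the image of zero.
      have key : ∀ b ∈ Finset.univ.filter (fun b => S.C b j < 0), ∀ k, ∀ l,
          S.sgn K j b • (S.reflOp K M j (.eps j) ^ l) (S.reflOp K M j (.arr j b k)
            (S.reflOp K M j (.arr b j k)
              ((S.reflOp K M j (.eps j) ^ (S.f b j - 1 - l)) z))) =
          (LinearMap.inr K M (ι → ℕ → ℕ → M) ∘ₗ S.tout K j)
            (S.eps K j ^ l • S.arr K j b k • z.2 b k (S.f b j - 1 - l)) := by
        intro b hb k l
        have hbj := S.ne_of_neg (Finset.mem_filter.mp hb).2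
        rw [reflOp_arr_right, reflOp_arr_left hbj, reflOp_eps_pow_self', reflOp_eps_pow_self,
          shift_pow_apply, ← tout_eps_pow, zero_add, smul_comm_K, smul_comm_K, map_smul]
        rw [Prod.smul_mk, smul_smul, sgn_mul_self, one_smul, smul_zero]
        rfl
      rw [Finset.sum_congr rfl fun b hb => Finset.sum_congr rfl fun k _ =>
        Finset.sum_congr rfl fun l _ => key b hb k l]
      simp only [← map_sum]
      rw [← tin_apply, h3, map_zero]
    · have key : ∀ b k l,
          S.sgn K j b • (S.reflOp K M i (.eps j) ^ l) (S.reflOp K M i (.arr j b k)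
            (S.reflOp K M i (.arr b j k)
              ((S.reflOp K M i (.eps j) ^ (S.f b j - 1 - l)) z))) =
          LinearMap.inl K M (ι → ℕ → ℕ → M) ((S.sgn K j b • (S.eps K j ^ l * S.arr K j b k *
            S.arr K b j k * S.eps K j ^ (S.f b j - 1 - l))) • z.1) := by
        intro b k l
        rw [reflOp_arr_arr hj, reflOp_eps_pow_ne hj, reflOp_eps_pow_ne' hj, Prod.smul_mk, smul_zero,
          smul_assoc, mul_smul, mul_smul, mul_smul]
        rfl
      simp only [key, ← map_sum, ← Finset.sum_smul]
      rw [mesh, zero_smul, map_zero]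

end Reflection

end CartanDatum

/-- The last nonzero product of `p` with a power of `X` lies in the socle, which is the line spanned
by `X^(c-1)`. -/
theorem truncated_exists_socle {K : Type u} [Field K] {c : ℕ} (hc : 1 ≤ c) {p : Truncated K c}
    (hp : p ≠ 0) : ∃ (n : ℕ) (a : K), a ≠ 0 ∧
      Ideal.Quotient.mk _ Polynomial.X ^ n * p =
        a • (Ideal.Quotient.mk _ Polynomial.X : Truncated K c) ^ (c - 1) := by
  classical
  have hex : ∃ n, (Ideal.Quotient.mk _ Polynomial.X : Truncated K c) ^ n * p = 0 :=
    ⟨c, by rw [truncated_X_pow, zero_mul]⟩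
  obtain ⟨n, hn⟩ : ∃ n, Nat.find hex = n + 1 := by
    refine ⟨Nat.find hex - 1, ?_⟩
    have : Nat.find hex ≠ 0 := fun h0 => hp (by
      have := Nat.find_spec hex
      rwa [h0, pow_zero, one_mul] at this)
    omega
  have h1 := Nat.find_spec hex
  have h2 := Nat.find_min hex (m := n) (by omega)
  rw [hn, pow_succ', mul_assoc] at h1
  obtain ⟨q, hq⟩ := truncated_ker hc _ h1
  obtain ⟨a, r, rfl⟩ := truncated_decomp c q
  have e : (Ideal.Quotient.mk _ Polynomial.X : Truncated K c) ^ n * p =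
      a • (Ideal.Quotient.mk _ Polynomial.X : Truncated K c) ^ (c - 1) := by
    rw [hq, mul_add, ← mul_assoc, ← pow_succ, Nat.sub_add_cancel hc, truncated_X_pow, zero_mul,
      add_zero, mul_comm, ← Algebra.smul_def]
  refine ⟨n, a, ?_, e⟩
  rintro rfl
  exact h2 (by rw [e, zero_smul])

namespace CartanDatum

/-! ### Filtrations with generalized simple factors -/

section Filtered

variable {ι : Type w} [Fintype ι] [DecidableEq ι] (S : CartanDatum ι) (K : Type u) [Field K]
  (M : Type v) [AddCommGroup M] [Module K M] [Module (S.Preproj K) M]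
  [IsScalarTower K (S.Preproj K) M]

/-- Submodules which have a finite filtration with generalized simple factors. -/
inductive EChain : Submodule (S.Preproj K) M → Prop
  | bot : EChain ⊥
  | step (A B : Submodule (S.Preproj K) M) (i : ι) (hA : EChain A) (hAB : A ≤ B)
      (h : S.IsGenSimple K (B ⧸ A.submoduleOf B) i) : EChain B

/-- The submodule `B` contains `A`, and the quotient is a generalized simple module. -/
def GenStep (A B : Submodule (S.Preproj K) M) : Prop :=
  A ≤ B ∧ ∃ j, S.IsGenSimple K (B ⧸ A.submoduleOf B) j

variable {S K M}

theorem EChain.exists_filtration {A : Submodule (S.Preproj K) M} (h : S.EChain K M A) :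
    ∃ (n : ℕ) (F : ℕ → Submodule (S.Preproj K) M), F 0 = ⊥ ∧ F n = A ∧
      ∀ k < n, S.GenStep K M (F k) (F (k + 1)) := by
  induction h with
  | bot => exact ⟨0, fun _ => ⊥, rfl, rfl, fun k hk => absurd hk (Nat.not_lt_zero k)⟩
  | step A B i _ hAB h ih =>
    obtain ⟨n, F, h0, hn, hF⟩ := ih
    refine ⟨n + 1, fun k => if k ≤ n then F k else B, by simp [h0], by simp, fun k hk => ?_⟩
    dsimp only
    rcases Nat.lt_succ_iff_lt_or_eq.mp hk with hk | rfl
    · rw [if_pos hk.le, if_pos (Nat.succ_le_of_lt hk)]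
      exact hF k hk
    · rw [if_pos le_rfl, if_neg (by omega), hn]
      exact ⟨hAB, i, h⟩

theorem isEFiltered_iff : S.IsEFiltered K M ↔ S.EChain K M ⊤ := by
  constructor
  · rintro ⟨n, F, h0, hn, hF⟩
    have : ∀ k ≤ n, S.EChain K M (F k) := by
      intro k
      induction k with
      | zero => intro _; rw [h0]; exact .bot
      | succ k ih =>
        intro hk
        obtain ⟨h1, j, h2⟩ := hF k hk
        exact .step _ _ j (ih (by omega)) h1 h2
    rw [← hn]
    exact this n le_rfl
  · intro h
    exact h.exists_filtration

theorem EChain.map {T : Type*} [AddCommGroup T] [Module K T] [Module (S.Preproj K) T]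
    [IsScalarTower K (S.Preproj K) T] {j : M →ₗ[S.Preproj K] T} (hj : Function.Injective j)
    {A : Submodule (S.Preproj K) M} (h : S.EChain K M A) : S.EChain K T (A.map j) := by
  induction h with
  | bot => rw [Submodule.map_bot]; exact .bot
  | step A B i _ hAB h ih =>
    refine .step _ _ i ih (Submodule.map_mono hAB) (HasRankVec.of_equiv S K ?_ h)
    refine Submodule.Quotient.equiv _ _ (Submodule.equivMapOfInjective j hj B) ?_
    ext x
    constructor
    · rintro ⟨y, hy, rfl⟩
      exact ⟨y.1, hy, rfl⟩
    · rintro ⟨y, hy, hyx⟩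
      exact ⟨⟨y, hAB hy⟩, hy, Subtype.ext hyx⟩

/-- A module on which `e_i` acts as the identity and which is isomorphic to `H_i` is the generalized
simple module `E_i`. -/
theorem isGenSimple_of_equiv (i : ι) (θ : Truncated K (S.c i) ≃ₗ[K] M)
    (hθ : ∀ p, θ (Ideal.Quotient.mk _ Polynomial.X * p) = S.eps K i • θ p)
    (he : ∀ x : M, S.e K i • x = x) : S.IsGenSimple K M i := by
  have := truncated_finite (K := K) (S.c i)
  have : Module.Finite K M := Module.Finite.equiv θ
  have hpow : ∀ n p, θ (Ideal.Quotient.mk _ Polynomial.X ^ n * p) = S.eps K i ^ n • θ p := by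
    intro n
    induction n with
    | zero => simp
    | succ n ih => intro p; rw [pow_succ', mul_assoc, hθ, ih, pow_succ', mul_smul]
  unfold IsGenSimple
  rw [hasRankVec_iff']
  intro j
  by_cases hj : j = i
  · subst hj
    constructor
    · intro x _ hx
      obtain ⟨p, rfl⟩ := θ.surjective x
      rw [← hθ] at hx
      obtain ⟨q, rfl⟩ := truncated_ker (S.c_pos j) p (θ.injective (by rw [hx, map_zero]))
      exact ⟨θ q, he _, by rw [hpow]⟩
    · have e : S.vertexSpace K M j = ⊤ := by
        ext x
        simp [mem_vertexSpace, he]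
      rw [vdim, e, finrank_top, ← θ.finrank_eq, truncated_finrank]
      simp
  · have h0 : ∀ x : M, S.e K j • x = 0 := fun x => by
      rw [← he x, e_e_smul_ne S K hj]
    constructor
    · intro x hx _
      exact ⟨0, by simp, by rw [smul_zero, ← hx, h0]⟩
    · have e : S.vertexSpace K M j = ⊥ := by
        ext x
        rw [mem_vertexSpace, h0, Submodule.mem_bot, eq_comm]
      rw [vdim, e]
      simp [hj]

variable (S K) in
/-- The map `H_i → M` defined by an element of `e_i M`. -/
noncomputable def cyclicMap (i : ι) (y : S.vertexSpace K M i) : Truncated K (S.c i) →ₗ[K] M :=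
  (S.vertexSpace K M i).subtype ∘ₗ (S.HAction K M i).toLinearMap.flip y

theorem cyclicMap_X_mul (i : ι) (y : S.vertexSpace K M i) (p : Truncated K (S.c i)) :
    S.cyclicMap K i y (Ideal.Quotient.mk _ Polynomial.X * p) = S.eps K i • S.cyclicMap K i y p := by
  change (S.HAction K M i (Ideal.Quotient.mk _ Polynomial.X * p) y : M) =
    S.eps K i • (S.HAction K M i p y : M)
  rw [map_mul, Module.End.mul_apply]
  exact congrArg Subtype.val (S.vertexModule_X_smul K i (S.HAction K M i p y))

theorem cyclicMap_X_pow_mul (i : ι) (y : S.vertexSpace K M i) (n : ℕ) (p : Truncated K (S.c i)) :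
    S.cyclicMap K i y (Ideal.Quotient.mk _ Polynomial.X ^ n * p) =
      S.eps K i ^ n • S.cyclicMap K i y p := by
  induction n with
  | zero => simp
  | succ n ih => rw [pow_succ', mul_assoc, cyclicMap_X_mul, ih, pow_succ', mul_smul]

theorem cyclicMap_one (i : ι) (y : S.vertexSpace K M i) : S.cyclicMap K i y 1 = y := by
  change (S.HAction K M i 1 y : M) = y
  rw [map_one]
  rfl

theorem e_cyclicMap (i : ι) (y : S.vertexSpace K M i) (p : Truncated K (S.c i)) :
    S.e K i • S.cyclicMap K i y p = S.cyclicMap K i y p :=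
  (S.mem_vertexSpace K).mp (S.HAction K M i p y).2

theorem cyclicMap_mem (i : ι) (y : S.vertexSpace K M i) (N : Submodule (S.Preproj K) M)
    (hy : (y : M) ∈ N) (p : Truncated K (S.c i)) : S.cyclicMap K i y p ∈ N := by
  obtain ⟨p, rfl⟩ := Ideal.Quotient.mk_surjective p
  induction p using Polynomial.induction_on' with
  | add p q hp hq => rw [map_add, map_add]; exact N.add_mem hp hq
  | monomial n a =>
    rw [← Polynomial.smul_X_eq_monomial]
    have e : (Ideal.Quotient.mk _ (a • Polynomial.X ^ n) : Truncated K (S.c i)) =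
        a • (Ideal.Quotient.mk _ Polynomial.X ^ n * 1) := by
      rw [mul_one, ← map_pow]; rfl
    rw [e, map_smul, cyclicMap_X_pow_mul, cyclicMap_one, ← algebraMap_smul (S.Preproj K) a]
    exact N.smul_mem _ (N.smul_mem _ hy)

/-- One step in the construction of a filtration with generalized simple factors. -/
theorem exists_genSimple_step {A B : Submodule (S.Preproj K) M} {i : ι} (hAB : A ≤ B)
    (h : ∀ x ∈ B, x - S.e K i • x ∈ A)
    (hc : ∀ x ∈ B, S.e K i • x = x → S.eps K i • x ∈ A →
      ∃ y ∈ B, S.e K i • y = y ∧ x - S.eps K i ^ (S.c i - 1) • y ∈ A) (hne : A ≠ B) :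
    ∃ A' : Submodule (S.Preproj K) M, A < A' ∧ A' ≤ B ∧
      S.IsGenSimple K (A' ⧸ A.submoduleOf A') i ∧
      ∀ x ∈ B, S.e K i • x = x → S.eps K i • x ∈ A' →
        ∃ y ∈ B, S.e K i • y = y ∧ x - S.eps K i ^ (S.c i - 1) • y ∈ A' := by
  classical
  have hci := S.c_pos i
  obtain ⟨x0, hx0B, hx0A⟩ := SetLike.exists_of_lt (lt_of_le_of_ne hAB hne)
  have hx1A : S.e K i • x0 ∉ A := fun h1 => hx0A (by simpa using A.add_mem (h x0 hx0B) h1)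
  -- The last power of `ε_i` that keeps this element outside `A` gives a socle element of `B / A`,
  -- which the hypothesis `hc` then lifts along `ε_i ^ (c_i - 1)` to `y`.
  have hex : ∃ n, S.eps K i ^ n • S.e K i • x0 ∈ A :=
    ⟨S.c i, by rw [eps_pow, zero_smul]; exact A.zero_mem⟩
  obtain ⟨n, hn⟩ : ∃ n, Nat.find hex = n + 1 := by
    refine ⟨Nat.find hex - 1, ?_⟩
    have : Nat.find hex ≠ 0 := fun h0 => hx1A (by
      have := Nat.find_spec hex
      rwa [h0, pow_zero, one_smul] at this)
    omega
  have h1 := Nat.find_spec hex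
  have h2 := Nat.find_min hex (m := n) (by omega)
  rw [hn, pow_succ', mul_smul] at h1
  obtain ⟨y, hyB, hy, hyA⟩ := hc _ (B.smul_mem _ (B.smul_mem _ hx0B))
    (S.e_eps_pow_smul K i n _ (S.e_e_smul K i x0)) h1
  have hyA' : S.eps K i ^ (S.c i - 1) • y ∉ A := fun h3 => h2 (by simpa using A.add_mem hyA h3)
  set φ := S.cyclicMap K i ⟨y, (S.mem_vertexSpace K).mpr hy⟩ with hφ
  have hφB : ∀ p, φ p ∈ B := fun p => cyclicMap_mem i _ B hyB p
  have hφX : ∀ n p, φ (Ideal.Quotient.mk _ Polynomial.X ^ n * p) = S.eps K i ^ n • φ p :=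
    fun n p => cyclicMap_X_pow_mul i _ n p
  have hφ1 : φ 1 = y := cyclicMap_one i _
  have hφX1 : ∀ p, φ (Ideal.Quotient.mk _ Polynomial.X * p) = S.eps K i • φ p := fun p =>
    cyclicMap_X_mul i _ p
  have heφ : ∀ p, S.e K i • φ p = φ p := fun p => e_cyclicMap i _ p
  -- A nonzero kernel of the map from `H_i` to `B / A` would contain the socle of `H_i`, but the
  -- socle goes to the nonzero class of `ε_i ^ (c_i - 1) y`.
  have hinj : ∀ p, φ p ∈ A → p = 0 := by
    intro p hp
    by_contra hp0
    obtain ⟨n, a, ha, e⟩ := truncated_exists_socle hci hp0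
    apply hyA'
    have h3 : a • S.eps K i ^ (S.c i - 1) • y ∈ A := by
      have e1 := congrArg φ e
      rw [hφX, map_smul, ← mul_one (Ideal.Quotient.mk _ Polynomial.X ^ (S.c i - 1)), hφX,
        hφ1] at e1
      rw [← e1]
      exact A.smul_mem _ hp
    have h4 := A.smul_mem (algebraMap K (S.Preproj K) a⁻¹) h3
    rwa [algebraMap_smul, inv_smul_smul₀ ha] at h4
  -- The quotient `B / A` is concentrated at `i`, where there is no arrow from `i` to itself, so all
  -- arrows map `B` into `A`.
  have harr : ∀ a b k, ∀ z ∈ B, S.arr K a b k • z ∈ A := by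
    intro a b k z hz
    by_cases ha : a = i
    · subst ha
      by_cases hb : b = a
      · subst hb
        rw [arr_eq_zero _ _ _ _ _ (by rw [S.diag]; omega), zero_smul]
        exact A.zero_mem
      · rw [← arr_e_smul]
        have := h _ (B.smul_mem (S.e K b) hz)
        rw [e_e_smul_ne S K (Ne.symm hb), sub_zero] at this
        exact A.smul_mem _ this
    · have := h _ (B.smul_mem (S.arr K a b k) hz)
      rwa [e_arr_smul_ne S K (Ne.symm ha), sub_zero] at this
  let A' := S.submoduleOfGens K (A.restrictScalars K ⊔ LinearMap.range φ)
    (by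
      intro j x hx
      obtain ⟨a, ha, _, ⟨p, rfl⟩, rfl⟩ := Submodule.mem_sup.mp hx
      rw [smul_add]
      refine Submodule.add_mem_sup (A.smul_mem _ ha) ?_
      by_cases hj : j = i
      · subst hj; rw [heφ]; exact ⟨p, rfl⟩
      · rw [← heφ, e_e_smul_ne S K hj]; exact zero_mem _)
    (by
      intro j x hx
      obtain ⟨a, ha, _, ⟨p, rfl⟩, rfl⟩ := Submodule.mem_sup.mp hx
      rw [smul_add]
      refine Submodule.add_mem_sup (A.smul_mem _ ha) ?_
      by_cases hj : j = i
      · subst hj; rw [← hφX1]; exact ⟨_, rfl⟩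
      · rw [← heφ, eps_e_smul_ne S K hj]; exact zero_mem _)
    (by
      intro a b k x hx
      obtain ⟨z, hz, _, ⟨p, rfl⟩, rfl⟩ := Submodule.mem_sup.mp hx
      exact Submodule.mem_sup_left (harr a b k _ (B.add_mem (hAB hz) (hφB p))))
  have hmem : ∀ x, x ∈ A' ↔ ∃ a ∈ A, ∃ p, a + φ p = x := by
    intro x
    change x ∈ A.restrictScalars K ⊔ LinearMap.range φ ↔ _
    rw [Submodule.mem_sup]
    constructor
    · rintro ⟨a, ha, _, ⟨p, rfl⟩, rfl⟩
      exact ⟨a, ha, p, rfl⟩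
    · rintro ⟨a, ha, p, rfl⟩
      exact ⟨a, ha, _, ⟨p, rfl⟩, rfl⟩
  have hφA' : ∀ p, φ p ∈ A' := fun p => (hmem _).mpr ⟨0, A.zero_mem, p, zero_add _⟩
  have hAA' : A ≤ A' := fun x hx => (hmem x).mpr ⟨x, hx, 0, by simp⟩
  refine ⟨A', lt_of_le_of_ne hAA' ?_, ?_, ?_, ?_⟩
  · intro e
    apply hyA'
    apply A.smul_mem
    rw [e, ← hφ1]
    exact hφA' 1
  · intro x hx
    obtain ⟨a, ha, p, rfl⟩ := (hmem x).mp hx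
    exact B.add_mem (hAB ha) (hφB p)
  · let θ : Truncated K (S.c i) →ₗ[K] A' ⧸ A.submoduleOf A' :=
      ((A.submoduleOf A').mkQ.restrictScalars K) ∘ₗ
        (φ.codRestrict (A'.restrictScalars K) hφA')
    have hθi : Function.Injective θ := by
      rw [injective_iff_map_eq_zero]
      intro p hp
      exact hinj p ((Submodule.Quotient.mk_eq_zero (A.submoduleOf A')).mp hp)
    have hθs : Function.Surjective θ := by
      intro x
      obtain ⟨⟨x, hx⟩, rfl⟩ := Submodule.Quotient.mk_surjective _ x
      obtain ⟨a, ha, p, rfl⟩ := (hmem x).mp hx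
      refine ⟨p, (Submodule.Quotient.eq _).mpr ?_⟩
      change φ p - (a + φ p) ∈ A
      rw [sub_add_cancel_right]
      exact A.neg_mem ha
    refine isGenSimple_of_equiv i (LinearEquiv.ofBijective θ ⟨hθi, hθs⟩) (fun p => ?_) fun x => ?_
    · exact congrArg (Submodule.Quotient.mk (p := A.submoduleOf A')) (Subtype.ext (hφX1 p))
    · obtain ⟨p, rfl⟩ := hθs x
      exact congrArg (Submodule.Quotient.mk (p := A.submoduleOf A')) (Subtype.ext (heφ p))
  · intro x hx hex hxA'
    obtain ⟨a, ha, p, hap⟩ := (hmem _).mp hxA'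
    obtain ⟨t, q, rfl⟩ := truncated_decomp _ p
    -- A nonzero constant term would survive multiplication by `X^(c_i - 1)`, whereas `ε_i ^ c_i =
    -- 0` puts the image of that product in `A`.
    have ht : t = 0 := by
      by_contra ht
      have h3 : φ (Ideal.Quotient.mk _ Polynomial.X ^ (S.c i - 1) *
          (algebraMap K _ t + Ideal.Quotient.mk _ Polynomial.X * q)) ∈ A := by
        rw [hφX]
        have e : φ (algebraMap K _ t + Ideal.Quotient.mk _ Polynomial.X * q) =
            S.eps K i • x - a := by rw [← hap]; abel
        rw [e, smul_sub, ← mul_smul, ← pow_succ, Nat.sub_add_cancel hci, eps_pow, zero_smul,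
          zero_sub]
        exact A.neg_mem (A.smul_mem _ ha)
      have h4 := hinj _ h3
      rw [mul_add, ← mul_assoc, ← pow_succ, Nat.sub_add_cancel hci, truncated_X_pow, zero_mul,
        add_zero, mul_comm, ← Algebra.smul_def] at h4
      exact truncated_X_pow_ne hci ((smul_eq_zero_iff_right ht).mp h4)
    subst ht
    rw [map_zero, zero_add, hφX1] at hap
    -- Subtracting `φ q` moves `ε_i x` from `A'` back into `A`, so the lifting property modulo `A`
    -- passes to `A'`.
    obtain ⟨y', hy'B, hy', hy'A⟩ := hc (x - φ q) (B.sub_mem hx (hφB q))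
      (by rw [smul_sub, hex, heφ]) (by
        rw [smul_sub, ← hap, add_sub_cancel_right]; exact ha)
    refine ⟨y', hy'B, hy', (hmem _).mpr ⟨_, hy'A, q, by abel⟩⟩

/-- Generalized simple factors are split off one at a time from the bottom of `B / A`; the
codimension of `A` in `M` decreases strictly. -/
theorem EChain.extend [Module.Finite K M] {A B : Submodule (S.Preproj K) M} {i : ι}
    (hA : S.EChain K M A) (hAB : A ≤ B) (h : ∀ x ∈ B, x - S.e K i • x ∈ A)
    (hc : ∀ x ∈ B, S.e K i • x = x → S.eps K i • x ∈ A →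
      ∃ y ∈ B, S.e K i • y = y ∧ x - S.eps K i ^ (S.c i - 1) • y ∈ A) : S.EChain K M B := by
  induction hn : Module.finrank K M - Module.finrank K (A.restrictScalars K)
    using Nat.strong_induction_on generalizing A with
  | _ n IH =>
  by_cases hne : A = B
  · exact hne ▸ hA
  · obtain ⟨A', h1, h2, h3, h4⟩ := exists_genSimple_step hAB h hc hne
    refine IH _ ?_ (.step A A' i hA h1.le h3) h2 (fun x hx => h1.le (h x hx)) h4 rfl
    have hlt : A.restrictScalars K < A'.restrictScalars K := h1
    have := Submodule.finrank_lt_finrank_of_lt hlt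
    have := Submodule.finrank_le (A'.restrictScalars K)
    omega

theorem sub_e_smul_mem {T : Type*} [AddCommGroup T] [Module K T] [Module (S.Preproj K) T]
    [IsScalarTower K (S.Preproj K) T] {j : M →ₗ[S.Preproj K] T} {i : ι}
    (hcov : ∀ b, b ≠ i → Covers j b) (x : T) : x - S.e K i • x ∈ LinearMap.range j := by
  have h := S.sum_e_smul K x
  rw [← Finset.add_sum_erase _ _ (Finset.mem_univ i)] at h
  rw [sub_eq_of_eq_add' h.symm]
  exact Submodule.sum_mem _ fun b hb => hcov b (Finset.ne_of_mem_erase hb) _ (S.e_e_smul K b x)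

/-- An extension of an `𝔼`-filtered module by a module which is free at one vertex. -/
theorem IsEFiltered.extend {T : Type*} [AddCommGroup T] [Module K T] [Module (S.Preproj K) T]
    [IsScalarTower K (S.Preproj K) T] [Module.Finite K T] {j : M →ₗ[S.Preproj K] T}
    (hj : Function.Injective j) {i : ι} (hcov : ∀ b, b ≠ i → Covers j b)
    (hMi : S.LocFree K M i) (hTi : S.LocFree K T i) (hM : S.IsEFiltered K M) :
    S.IsEFiltered K T := by
  rw [isEFiltered_iff] at hM ⊢
  have h1 := hM.map hj
  rw [Submodule.map_top] at h1
  refine h1.extend le_top (fun x _ => sub_e_smul_mem hcov x) fun x _ hx hx' => ?_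
  obtain ⟨y, hy, hyx⟩ := exists_coker_lift hj hMi hTi hx hx'
  exact ⟨y, trivial, hy, hyx⟩

end Filtered

end CartanDatum

namespace CartanDatum

/-! ### The reflected module and its canonical embedding -/

section Refl

variable {ι : Type w} [Fintype ι] [DecidableEq ι] (S : CartanDatum ι) (K : Type u) [Field K]
  (M : Type v) [AddCommGroup M] [Module K M] [Module (S.Preproj K) M]
  [IsScalarTower K (S.Preproj K) M] (i : ι)

/-- The reflection of the module `M` at the vertex `i`. -/
abbrev Refl : Type max w v := RepMod (reflOp_isRepOn (S := S) (K := K) (M := M) i).isRep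

namespace Refl

/-- The underlying pair of an element of the reflected module. -/
noncomputable def val : S.Refl K M i →ₗ[K] M × (ι → ℕ → ℕ → M) :=
  (S.reflSub K M i).subtype ∘ₗ (RepMod.of _).symm.toLinearMap

variable {S K M i}

theorem val_injective : Function.Injective (val S K M i) := fun _ _ h =>
  (RepMod.of (reflOp_isRepOn (S := S) (K := K) (M := M) i).isRep).symm.injective (Subtype.ext h)

theorem val_mem (z : S.Refl K M i) : val S K M i z ∈ S.reflSub K M i :=
  ((RepMod.of (reflOp_isRepOn (S := S) (K := K) (M := M) i).isRep).symm z).2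

theorem exists_val_eq {x : M × (ι → ℕ → ℕ → M)} (hx : x ∈ S.reflSub K M i) :
    ∃ z, val S K M i z = x := ⟨RepMod.of _ ⟨x, hx⟩, rfl⟩

theorem val_e (j : ι) (z : S.Refl K M i) :
    val S K M i (S.e K j • z) = S.reflOp K M i (.e j) (val S K M i z) := by
  have := RepMod.e_smul (reflOp_isRepOn (S := S) (K := K) (M := M) i).isRep j
    ((RepMod.of (reflOp_isRepOn (S := S) (K := K) (M := M) i).isRep).symm z)
  rw [LinearEquiv.apply_symm_apply] at this
  rw [this]
  rfl

theorem val_eps (j : ι) (z : S.Refl K M i) :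
    val S K M i (S.eps K j • z) = S.reflOp K M i (.eps j) (val S K M i z) := by
  have := RepMod.eps_smul (reflOp_isRepOn (S := S) (K := K) (M := M) i).isRep j
    ((RepMod.of (reflOp_isRepOn (S := S) (K := K) (M := M) i).isRep).symm z)
  rw [LinearEquiv.apply_symm_apply] at this
  rw [this]
  rfl

theorem val_arr (a b : ι) (k : ℕ) (z : S.Refl K M i) :
    val S K M i (S.arr K a b k • z) = S.reflOp K M i (.arr a b k) (val S K M i z) := by
  have := RepMod.arr_smul (reflOp_isRepOn (S := S) (K := K) (M := M) i).isRep a b k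
    ((RepMod.of (reflOp_isRepOn (S := S) (K := K) (M := M) i).isRep).symm z)
  rw [LinearEquiv.apply_symm_apply] at this
  rw [this]
  rfl

theorem val_eps_pow_snd (n : ℕ) (z : S.Refl K M i) :
    (val S K M i (S.eps K i ^ n • z)).2 = (shift K ^ n) (val S K M i z).2 := by
  induction n with
  | zero => simp
  | succ n ih =>
    rw [pow_succ', mul_smul, val_eps, reflOp_eps_self, ih, pow_succ', Module.End.mul_apply]

theorem e_self_iff (z : S.Refl K M i) : S.e K i • z = z ↔ (val S K M i z).1 = 0 := by
  rw [← val_injective.eq_iff, val_e, reflOp_e_self]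
  constructor
  · intro h
    rw [← h]
  · intro h
    exact Prod.ext h.symm rfl

instance [Module.Finite K M] : Module.Finite K (S.Refl K M i) := by
  let φ : S.Refl K M i →ₗ[K] M × S.tilde K M i :=
    { toFun z := ((val S K M i z).1, ⟨(val S K M i z).2, (val_mem z).2.1⟩)
      map_add' y z := by
        refine Prod.ext ?_ (Subtype.ext ?_)
        · change (val S K M i (y + z)).1 = _
          rw [map_add]; rfl
        · change (val S K M i (y + z)).2 = _
          rw [map_add]; rfl
      map_smul' t z := by
        refine Prod.ext ?_ (Subtype.ext ?_)
        · change (val S K M i (t • z)).1 = _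
          rw [map_smul]; rfl
        · change (val S K M i (t • z)).2 = _
          rw [map_smul]; rfl }
  refine Module.Finite.of_injective φ fun y z h => val_injective (Prod.ext ?_ ?_)
  · have h1 := congrArg Prod.fst h
    exact h1
  · have h2 := congrArg Subtype.val (congrArg Prod.snd h)
    exact h2

theorem emb_mem (x : M) :
    (x - S.e K i • x, S.tout K i (S.e K i • x)) ∈ S.reflSub K M i :=
  mem_reflSub.mpr ⟨by rw [smul_sub, e_e_smul, sub_self], tout_mem _ _, tin_tout _ _⟩

variable (S K M i) in
/-- The underlying linear map of the canonical map from a module to its reflection. -/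
noncomputable def embLin : M →ₗ[K] S.Refl K M i where
  toFun x := RepMod.of _ ⟨_, emb_mem x⟩
  map_add' x y := val_injective <| by
    rw [map_add]
    refine Prod.ext ?_ ?_
    · change x + y - S.e K i • (x + y) = (x - S.e K i • x) + (y - S.e K i • y)
      rw [smul_add]; abel
    · change S.tout K i (S.e K i • (x + y)) =
        S.tout K i (S.e K i • x) + S.tout K i (S.e K i • y)
      rw [smul_add, map_add]
  map_smul' t x := val_injective <| by
    rw [map_smul (val S K M i)]
    refine Prod.ext ?_ ?_
    · change t • x - S.e K i • t • x = t • (x - S.e K i • x)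
      rw [smul_comm_K, smul_sub]
    · change S.tout K i (S.e K i • t • x) = t • S.tout K i (S.e K i • x)
      rw [smul_comm_K, map_smul]

theorem val_embLin (x : M) : val S K M i (embLin S K M i x) =
    (x - S.e K i • x, S.tout K i (S.e K i • x)) := rfl

variable (S K M i) in
/-- The canonical map from a module to its reflection. -/
noncomputable def emb : M →ₗ[S.Preproj K] S.Refl K M i :=
  S.homOfGens K (embLin S K M i)
    (fun j x => val_injective <| by
      rw [val_e, val_embLin, val_embLin]
      by_cases hj : j = i
      · subst hj
        rw [reflOp_e_self, e_e_smul, sub_self]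
      · rw [reflOp_e_ne hj, e_e_smul_ne S K (Ne.symm hj), smul_sub, e_e_smul_ne S K hj, map_zero])
    (fun j x => val_injective <| by
      rw [val_eps, val_embLin, val_embLin]
      by_cases hj : j = i
      · subst hj
        rw [reflOp_eps_self, e_eps_smul, sub_self, ← tout_eps, eps_e_smul]
      · rw [reflOp_eps_ne hj, e_eps_smul_ne S K (Ne.symm hj), smul_sub, eps_e_smul_ne S K hj,
          map_zero])
    (fun a b k x => val_injective <| by
      rw [val_arr, val_embLin, val_embLin]
      by_cases hb : b = i
      · subst hb
        rw [reflOp_arr_right]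
        dsimp only
        rw [tout_apply, smul_smul (S.sgn K b a), sgn_mul_self, one_smul, pow_zero, one_smul,
          arr_e_smul]
        by_cases ha : a = b
        · subst ha
          rw [arr_eq_zero _ _ _ _ _ (by rw [S.diag]; omega)]
          simp
        · rw [e_arr_smul_ne S K (Ne.symm ha), sub_zero, map_zero]
      · by_cases ha : a = i
        · subst ha
          rw [reflOp_arr_left hb, e_arr_smul, sub_self, smul_sub, arr_e_smul_ne S K hb, sub_zero]
        · rw [reflOp_arr_ne ha hb, e_arr_smul_ne S K (Ne.symm ha), smul_sub, arr_e_smul_ne S K hb,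
            map_zero])

theorem val_emb (x : M) : val S K M i (emb S K M i x) =
    (x - S.e K i • x, S.tout K i (S.e K i • x)) := rfl

theorem emb_injective (h : OutInj S K M i) : Function.Injective (emb S K M i) := by
  rw [injective_iff_map_eq_zero]
  intro x hx
  have h0 := congrArg (val S K M i) hx
  rw [val_emb, map_zero] at h0
  have h1 : S.e K i • x = 0 := h _ (S.e_e_smul K i x) (congrArg Prod.snd h0)
  have h2 : x - S.e K i • x = 0 := congrArg Prod.fst h0
  rwa [h1, sub_zero] at h2

theorem emb_covers {b : ι} (hb : b ≠ i) : Covers (emb S K M i) b := by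
  intro z hz
  refine ⟨(val S K M i z).1, val_injective ?_⟩
  have hz' := val_mem z
  rw [val_emb, (mem_reflSub.mp hz').1, sub_zero, map_zero]
  rw [← hz, val_e, reflOp_e_ne hb]

/-- In the reflected module, arrows out of `i` read off entries of the sequences and `ε_i` shifts
them, so M_out recovers the whole family. -/
theorem outInj : OutInj S K (S.Refl K M i) i := by
  intro z hz hz0
  refine val_injective ?_
  rw [map_zero]
  refine Prod.ext ((e_self_iff z).mp hz) ?_
  ext b k l
  have h := congrArg (fun t => (val S K M i t).1) (congrFun (congrFun (congrFun hz0 b) k) l)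
  simp only [tout_apply, map_smul, val_arr, reflOp_arr_right, Prod.smul_fst, Pi.zero_apply,
    map_zero] at h
  rw [smul_smul, sgn_mul_self, one_smul, val_eps_pow_snd, shift_pow_apply, zero_add] at h
  exact h

theorem outInj_ne (h : OutInj S K M i) {j : ι} (hj : j ≠ i) (h' : OutInj S K M j) :
    OutInj S K (S.Refl K M i) j :=
  (emb_covers hj).outInj (emb_injective h) h'

variable (S K M i) in
/-- The map `M_in` to the space at the vertex `i`. -/
noncomputable def tinV : S.tilde K M i →ₗ[K] S.vertexSpace K M i :=
  (S.tinT K M i).codRestrict _ fun x => (S.mem_vertexSpace K).mpr (e_tin i x.1)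

theorem tinV_shift (x : S.tilde K M i) :
    tinV S K M i (S.tildeShift K M i x) = S.epsEnd K M i (tinV S K M i x) :=
  Subtype.ext (tin_shift x.2)

theorem tinV_surjective (hs : ∀ x : M, S.e K i • x = x → ∃ t ∈ S.tilde K M i, S.tin K i t = x) :
    Function.Surjective (tinV S K M i) := by
  intro x
  obtain ⟨t, ht, h⟩ := hs x ((S.mem_vertexSpace K).mp x.2)
  exact ⟨⟨t, ht⟩, Subtype.ext h⟩

/-- The new space at `i` is the kernel of a surjection from the free module `tilde` onto the free
module `e_i M`. -/
theorem locFree (hs : ∀ x : M, S.e K i • x = x → ∃ t ∈ S.tilde K M i, S.tin K i t = x)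
    (hM : ∀ b, S.LocFree K M b) : S.LocFree K (S.Refl K M i) i := by
  intro z hz hz0
  have hzm := val_mem z
  have h1 := (e_self_iff z).mp hz
  rw [← val_injective.eq_iff, val_eps, reflOp_eps_self, map_zero] at hz0
  obtain ⟨y, hy1, hy2⟩ := NilFree.ker_map (S.c_pos i)
    (nilFree_tildeShift (S := S) (K := K) (M := M) i fun b _ => hM b)
    ((S.nilFree_epsEnd_iff K M i).mpr (hM i)) (tinV S K M i) tinV_shift (tinV_surjective hs)
    ⟨_, hzm.2.1⟩ (Subtype.ext (congrArg Prod.snd hz0)) (Subtype.ext hzm.2.2)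
  obtain ⟨y', hy'⟩ := exists_val_eq (S := S) (K := K) (M := M) (i := i) (x := (0, y.1))
    (mem_reflSub.mpr ⟨smul_zero _, y.2, congrArg Subtype.val hy1⟩)
  have he : S.e K i • y' = y' := (e_self_iff y').mpr (by rw [hy'])
  refine ⟨y', he, val_injective (Prod.ext ?_ ?_)⟩
  · rw [h1, ← e_self_iff, e_eps_pow_smul _ _ _ _ _ he]
  · rw [val_eps_pow_snd, hy', ← tildeShift_pow_coe, hy2]

/-- Rank-nullity for the surjection M_in, whose kernel is the new space at `i`. -/
theorem vdim_add [Module.Finite K M]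
    (hs : ∀ x : M, S.e K i • x = x → ∃ t ∈ S.tilde K M i, S.tin K i t = x) :
    S.vdim K (S.Refl K M i) i + S.vdim K M i = Module.finrank K (S.tilde K M i) := by
  rw [← LinearMap.finrank_range_add_finrank_ker (tinV S K M i),
    LinearMap.range_eq_top.mpr (tinV_surjective hs), finrank_top, add_comm]
  congr 1
  let φ : S.vertexSpace K (S.Refl K M i) i →ₗ[K] S.tilde K M i :=
    (LinearMap.snd K M _ ∘ₗ val S K M i ∘ₗ Submodule.subtype _).codRestrict _
      fun z => (val_mem z.1).2.1
  have hφ : Function.Injective φ := fun y z h => Subtype.ext (val_injective (Prod.ext (by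
    rw [(e_self_iff y.1).mp ((S.mem_vertexSpace K).mp y.2),
      (e_self_iff z.1).mp ((S.mem_vertexSpace K).mp z.2)]) (congrArg Subtype.val h)))
  rw [vdim, ← LinearMap.finrank_range_of_inj hφ]
  suffices h : LinearMap.range φ = LinearMap.ker (tinV S K M i) by rw [h]
  ext x
  constructor
  · rintro ⟨z, rfl⟩
    exact Subtype.ext (val_mem z.1).2.2
  · intro hx
    obtain ⟨z, hz⟩ := exists_val_eq (S := S) (K := K) (M := M) (i := i) (x := (0, x.1))
      (mem_reflSub.mpr ⟨smul_zero _, x.2, congrArg Subtype.val hx⟩)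
    refine ⟨⟨z, (S.mem_vertexSpace K).mpr ((e_self_iff z).mpr (by rw [hz]))⟩, Subtype.ext ?_⟩
    exact congrArg Prod.snd hz

end Refl

variable {S K M i}
variable {T : Type*} [AddCommGroup T] [Module K T] [Module (S.Preproj K) T]
  [IsScalarTower K (S.Preproj K) T]

/-- A module with `M_out` injective and exact middle is the reflection of every submodule which
contains the spaces at the other vertices. -/
theorem nonempty_equiv_refl {j : M →ₗ[S.Preproj K] T} (hj : Function.Injective j)
    (hcov : ∀ b, b ≠ i → Covers j b) (ho : OutInj S K T i) (he : MidExact S K T i) :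
    Nonempty (S.Refl K M i ≃ₗ[S.Preproj K] T) := by
  -- Both modules are embedded in the same space, by splitting off the component at `i` and, for
  -- `T`, sending that component to `tilde` by M_out. The comparison of their images then avoids
  -- constructing an inverse map.
  let J : S.Refl K M i →ₗ[K] T × (ι → ℕ → ℕ → T) :=
    LinearMap.prodMap (j.restrictScalars K) (tildeMap j) ∘ₗ Refl.val S K M i
  let J' : T →ₗ[K] T × (ι → ℕ → ℕ → T) :=
    LinearMap.prod (LinearMap.id - Algebra.lsmul K K T (S.e K i))
      (S.tout K i ∘ₗ Algebra.lsmul K K T (S.e K i))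
  have hJ : ∀ z, J z = (j (Refl.val S K M i z).1, tildeMap j (Refl.val S K M i z).2) :=
    fun _ => rfl
  have hJ' : ∀ y, J' y = (y - S.e K i • y, S.tout K i (S.e K i • y)) := fun _ => rfl
  refine S.nonempty_equiv_of_range_eq K J J' ?_ ?_ ?_ ?_ ?_ ?_
  · intro x y h
    exact Refl.val_injective (Prod.ext (hj (congrArg Prod.fst h))
      (tildeMap_injective hj (congrArg Prod.snd h)))
  · rw [injective_iff_map_eq_zero]
    intro y hy
    have h1 : S.e K i • y = 0 := ho _ (S.e_e_smul K i y) (congrArg Prod.snd hy)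
    have h2 : y - S.e K i • y = 0 := congrArg Prod.fst hy
    rwa [h1, sub_zero] at h2
  · ext p
    constructor
    · rintro ⟨z, rfl⟩
      obtain ⟨h1, h2, h3⟩ := Refl.val_mem z
      -- Exactness in the middle turns the element of the kernel of M_in into an element of `e_i T`.
      obtain ⟨y, hy, hyz⟩ := he (tildeMap j (Refl.val S K M i z).2) (tildeMap_mem j h2)
        (by rw [tin_tildeMap, h3, map_zero])
      have h4 : S.e K i • j (Refl.val S K M i z).1 = 0 := by
        rw [← map_smul]
        exact (congrArg j h1).trans (map_zero j)
      refine ⟨j (Refl.val S K M i z).1 + y, ?_⟩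
      rw [hJ, hJ', smul_add, h4, hy, zero_add, add_sub_cancel_right, hyz]
    · rintro ⟨y, rfl⟩
      obtain ⟨t, ht, hty⟩ := exists_tildeMap_eq hj (fun b hb => hcov b hb)
        (tout_mem (S := S) (K := K) i (S.e K i • y))
      obtain ⟨x, hx⟩ := sub_e_smul_mem (j := j) hcov y
      have hmem : (x - S.e K i • x, t) ∈ S.reflSub K M i := by
        refine mem_reflSub.mpr ⟨by rw [smul_sub, e_e_smul, sub_self], ht, hj ?_⟩
        rw [← tin_tildeMap, hty, tin_tout, map_zero]
      obtain ⟨z, hz⟩ := Refl.exists_val_eq hmem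
      refine ⟨z, ?_⟩
      rw [hJ, hJ', hz, hty, map_sub, map_smul, hx, smul_sub, e_e_smul, sub_self, sub_zero]
  · intro l z y h
    rw [hJ, hJ', Prod.mk.injEq] at h
    rw [hJ, hJ', Refl.val_e]
    by_cases hl : l = i
    · subst hl
      rw [reflOp_e_self, h.2, map_zero, e_e_smul, sub_self]
    · rw [reflOp_e_ne hl, map_smul, h.1, smul_sub, e_e_smul_ne S K hl, e_e_smul_ne S K (Ne.symm hl),
        map_zero, map_zero]
  · intro l z y h
    rw [hJ, hJ', Prod.mk.injEq] at h
    rw [hJ, hJ', Refl.val_eps]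
    by_cases hl : l = i
    · subst hl
      have : tildeMap j (shift K (Refl.val S K M l z).2) =
        shift K (tildeMap j (Refl.val S K M l z).2) := rfl
      rw [reflOp_eps_self, map_zero, e_eps_smul, sub_self, this, h.2, ← tout_eps, eps_e_smul]
    · rw [reflOp_eps_ne hl, map_smul, h.1, smul_sub, eps_e_smul_ne S K hl,
        e_eps_smul_ne S K (Ne.symm hl), map_zero, map_zero]
  · intro a b k z y h
    rw [hJ, hJ', Prod.mk.injEq] at h
    rw [hJ, hJ', Refl.val_arr]
    by_cases hb : b = i
    · subst hb
      have h2 : j ((Refl.val S K M b z).2 a k 0) = S.tout K b (S.e K b • y) a k 0 := by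
        rw [← h.2]; rfl
      have h3 : j (S.sgn K b a • (Refl.val S K M b z).2 a k 0) = S.arr K a b k • y := by
        refine ((j.restrictScalars K).map_smul _ _).trans ?_
        change S.sgn K b a • j _ = _
        rw [h2, tout_apply, smul_smul, sgn_mul_self, one_smul, pow_zero, one_smul, arr_e_smul]
      rw [reflOp_arr_right, map_zero, h3]
      by_cases ha : a = b
      · subst ha
        rw [arr_eq_zero _ _ _ _ _ (by rw [S.diag]; omega)]
        simp
      · rw [e_arr_smul_ne S K (Ne.symm ha), sub_zero, map_zero]
    · by_cases ha : a = i
      · subst ha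
        rw [reflOp_arr_left hb, map_zero, e_arr_smul, sub_self, ← tout_map, map_smul, h.1, smul_sub,
          arr_e_smul_ne S K hb, sub_zero]
      · rw [reflOp_arr_ne ha hb, e_arr_smul_ne S K (Ne.symm ha), map_smul, h.1, smul_sub,
          arr_e_smul_ne S K hb, map_zero, map_zero]

end Refl

/-! ### Passing to bundled modules -/

section Shrink

variable {K : Type u} [Field K] {A : Type*} [Ring A] [Algebra K A]

/-- Every finite-dimensional module is isomorphic to a bundled one. -/
theorem exists_finDimMod_equiv (M : Type*) [AddCommGroup M] [Module K M] [Module A M]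
    [IsScalarTower K A M] [Module.Finite K M] :
    ∃ N : FinDimMod K A, Nonempty (M ≃ₗ[A] N) := by
  -- Transporting the action to `K^n` brings the carrier into the universe of `K`. This is needed
  -- since the reflected module lives in a larger one.
  let e : M ≃ₗ[K] (Fin (Module.finrank K M) → K) := (Module.finBasis K M).equivFun
  let _ : Module A (Fin (Module.finrank K M) → K) := Module.compHom _
    ((e.conjAlgEquiv K).toAlgHom.comp (Algebra.lsmul K K M)).toRingHom
  have hs : ∀ (a : A) x, a • x = e (a • e.symm x) := fun _ _ => rfl
  have : IsScalarTower K A (Fin (Module.finrank K M) → K) := ⟨fun t a x => by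
    rw [hs, hs, smul_assoc, map_smul]⟩
  refine ⟨⟨Fin (Module.finrank K M) → K⟩, ⟨{ e with map_smul' := fun a x => ?_ }⟩⟩
  change e (a • x) = e (a • e.symm (e x))
  rw [e.symm_apply_apply]

end Shrink

/-! ### Modules without arrows -/

section Base

variable {ι : Type w} [Fintype ι] [DecidableEq ι] (S : CartanDatum ι) (K : Type u) [Field K]

/-- The operators of the direct sum of generalized simple modules with rank vector `r`. -/
noncomputable def baseOp (r : ι → ℕ) :
    Gen ι → Module.End K ((i : ι) → Fin (r i) → Truncated K (S.c i))
  | .e i => LinearMap.single K _ i ∘ₗ LinearMap.proj i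
  | .eps i => LinearMap.single K _ i ∘ₗ
      LinearMap.compLeft (LinearMap.mulLeft K (Ideal.Quotient.mk _ Polynomial.X)) _ ∘ₗ
        LinearMap.proj i
  | .arr _ _ _ => 0

variable {S K}

theorem baseOp_e (r : ι → ℕ) (i : ι) (x) :
    S.baseOp K r (.e i) x = Pi.single i (x i) := rfl

theorem baseOp_eps (r : ι → ℕ) (i : ι) (x) : S.baseOp K r (.eps i) x =
    Pi.single i (fun s => Ideal.Quotient.mk _ Polynomial.X * x i s) := rfl

theorem baseOp_eps_pow (r : ι → ℕ) (i : ι) (n : ℕ) (x) (s) :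
    (S.baseOp K r (.eps i) ^ n) x i s = Ideal.Quotient.mk _ Polynomial.X ^ n * x i s := by
  induction n with
  | zero => simp
  | succ n ih =>
    rw [pow_succ', Module.End.mul_apply, baseOp_eps, Pi.single_eq_same, ih, pow_succ', mul_assoc]

theorem baseOp_isRep (r : ι → ℕ) : S.IsRep K (S.baseOp K r) where
  idem i x := by simp [baseOp_e]
  orth i j x hij := by simp [baseOp_e, hij]
  one x := by simp only [baseOp_e]; exact Finset.univ_sum_single x
  eps_vertex i x := by simp [baseOp_e, baseOp_eps]
  arr_vertex i j k x := by simp [baseOp]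
  arr_zero i j k _ x := rfl
  nilp i x := by
    obtain ⟨n, hn⟩ : ∃ n, S.c i = n + 1 := ⟨S.c i - 1, by have := S.c_pos i; omega⟩
    ext j s
    by_cases hj : j = i
    · subst hj
      rw [baseOp_eps_pow, truncated_X_pow, zero_mul]
      rfl
    · rw [hn, pow_succ', Module.End.mul_apply, baseOp_eps, Pi.single_eq_of_ne hj]
      rfl
  comm i j k _ _ x := by simp [baseOp]
  mesh i x := by simp [baseOp]

variable (S K) in
/-- The direct sum of generalized simple modules with rank vector `r`. -/
abbrev Base (r : ι → ℕ) : Type max u w := RepMod (baseOp_isRep (S := S) (K := K) r)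

instance (r : ι → ℕ) : Module.Finite K (S.Base K r) := by
  have := fun i => truncated_finite (K := K) (S.c i)
  exact inferInstanceAs (Module.Finite K ((i : ι) → Fin (r i) → Truncated K (S.c i)))

theorem base_arr (r : ι → ℕ) (i j : ι) (k : ℕ) (x : S.Base K r) : S.arr K i j k • x = 0 :=
  RepMod.arr_smul (baseOp_isRep (S := S) (K := K) r) i j k x

theorem base_hasRankVec (r : ι → ℕ) : S.HasRankVec K (S.Base K r) (fun i => r i) := by
  rw [hasRankVec_iff']
  have h := baseOp_isRep (S := S) (K := K) r
  have he : ∀ i (x : (i : ι) → Fin (r i) → Truncated K (S.c i)),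
      S.e K i • RepMod.of h x = RepMod.of h (Pi.single i (x i)) :=
    fun i x => RepMod.e_smul h i x
  intro i
  constructor
  · intro x hx hx0
    obtain ⟨x, rfl⟩ := (RepMod.of h).surjective x
    rw [he] at hx
    have hx := (RepMod.of h).injective hx
    rw [RepMod.eps_smul, baseOp_eps] at hx0
    have hx0 := (RepMod.of h).injective (hx0.trans (map_zero _).symm)
    have h1 : ∀ s, ∃ q, x i s = Ideal.Quotient.mk _ Polynomial.X ^ (S.c i - 1) * q := fun s =>
      truncated_ker (S.c_pos i) _ (by
        have := congrFun (congrFun hx0 i) s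
        rwa [Pi.single_eq_same] at this)
    choose q hq using h1
    refine ⟨RepMod.of h (Pi.single i q), by rw [he, Pi.single_eq_same], ?_⟩
    have hei : S.e K i • RepMod.of h (Pi.single i q) = RepMod.of h (Pi.single i q) := by
      rw [he, Pi.single_eq_same]
    rw [← S.e_eps_pow_smul K i _ _ hei, RepMod.eps_pow_smul, he]
    congr 1
    rw [← hx]
    congr 1
    ext s
    rw [baseOp_eps_pow, Pi.single_eq_same, hq]
  · have := fun i => truncated_finite (K := K) (S.c i)
    let φ : (Fin (r i) → Truncated K (S.c i)) →ₗ[K] S.vertexSpace K (S.Base K r) i :=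
      ((RepMod.of h).toLinearMap ∘ₗ LinearMap.single K _ i).codRestrict _ fun x => by
        rw [mem_vertexSpace]
        change S.e K i • RepMod.of h (Pi.single i x) = RepMod.of h (Pi.single i x)
        rw [he, Pi.single_eq_same]
    have hφ : Function.Bijective φ := by
      constructor
      · intro x y hxy
        exact Pi.single_injective i ((RepMod.of h).injective (congrArg Subtype.val hxy))
      · intro y
        obtain ⟨y0, hy0⟩ := (RepMod.of h).surjective y.1
        refine ⟨y0 i, Subtype.ext ?_⟩
        change RepMod.of h (Pi.single i (y0 i)) = _
        rw [← he, hy0]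
        exact (S.mem_vertexSpace K).mp y.2
    rw [vdim, ← (LinearEquiv.ofBijective φ hφ).finrank_eq, Module.finrank_pi_fintype]
    simp only [truncated_finrank, Finset.sum_const, Finset.card_univ, Fintype.card_fin, smul_eq_mul]
    push_cast
    ring

/-- Locally free modules on which all arrows act by zero are determined by their rank vectors. -/
theorem nonempty_equiv_of_arr_eq_zero {M : Type*} [AddCommGroup M] [Module K M]
    [Module (S.Preproj K) M] [IsScalarTower K (S.Preproj K) M] {M' : Type*} [AddCommGroup M']
    [Module K M'] [Module (S.Preproj K) M'] [IsScalarTower K (S.Preproj K) M'] {r : ι → ℤ}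
    (h : S.HasRankVec K M r) (h' : S.HasRankVec K M' r)
    (ha : ∀ i j k, ∀ x : M, S.arr K i j k • x = 0)
    (ha' : ∀ i j k, ∀ x : M', S.arr K i j k • x = 0) : Nonempty (M ≃ₗ[S.Preproj K] M') := by
  have hst := fun i => S.vertexModule_isScalarTower K (M := M) i
  have hst' := fun i => S.vertexModule_isScalarTower K (M := M') i
  have hnt : ∀ i, Nontrivial (S.H K i) := fun i => ⟨_, 0, truncated_X_pow_ne (S.c_pos i)⟩
  have hψ : ∀ i, Nonempty (S.vertexSpace K M i ≃ₗ[S.H K i] S.vertexSpace K M' i) := fun i => by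
    obtain ⟨h1, h2, h3⟩ := h i
    obtain ⟨h1', h2', h3'⟩ := h' i
    exact FiniteDimensional.nonempty_linearEquiv_of_finrank_eq
      (by exact_mod_cast h3.trans h3'.symm)
  let ψ : ∀ i, S.vertexSpace K M i ≃ₗ[S.H K i] S.vertexSpace K M' i := fun i => (hψ i).some
  have hψX : ∀ i x, (ψ i (S.epsEnd K M i x) : M') = S.eps K i • (ψ i x : M') := fun i x => by
    rw [← vertexModule_X_smul, map_smul, vertexModule_X_smul]
    rfl
  let J : M →ₗ[K] (∀ i, S.vertexSpace K M' i) := LinearMap.pi fun i =>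
    ((ψ i).restrictScalars K).toLinearMap ∘ₗ (Algebra.lsmul K K M (S.e K i)).rangeRestrict
  let J' : M' →ₗ[K] (∀ i, S.vertexSpace K M' i) := LinearMap.pi fun i =>
    (Algebra.lsmul K K M' (S.e K i)).rangeRestrict
  have hJ : ∀ x i, J x i = ψ i ⟨S.e K i • x, x, rfl⟩ := fun _ _ => rfl
  have hJ' : ∀ x i, J' x i = ⟨S.e K i • x, x, rfl⟩ := fun _ _ => rfl
  refine S.nonempty_equiv_of_range_eq K J J' ?_ ?_ ?_ ?_ ?_ ?_
  · rw [injective_iff_map_eq_zero]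
    intro x hx
    rw [← S.sum_e_smul K x]
    refine Finset.sum_eq_zero fun i _ => ?_
    have := congrFun hx i
    rw [hJ] at this
    exact congrArg Subtype.val ((LinearEquiv.map_eq_zero_iff _).mp this)
  · rw [injective_iff_map_eq_zero]
    intro x hx
    rw [← S.sum_e_smul K x]
    exact Finset.sum_eq_zero fun i _ => congrArg Subtype.val (congrFun hx i)
  · have h1 : LinearMap.range J = ⊤ := by
      rw [LinearMap.range_eq_top]
      intro y
      refine ⟨∑ i, ((ψ i).symm (y i) : M), ?_⟩
      ext1 i
      rw [hJ]
      have : (⟨S.e K i • ∑ j, ((ψ j).symm (y j) : M), _, rfl⟩ : S.vertexSpace K M i) =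
          (ψ i).symm (y i) := by
        refine Subtype.ext ?_
        change S.e K i • ∑ j, ((ψ j).symm (y j) : M) = _
        rw [Finset.smul_sum, Finset.sum_eq_single i]
        · exact (S.mem_vertexSpace K).mp ((ψ i).symm (y i)).2
        · intro j _ hj
          rw [← (S.mem_vertexSpace K).mp ((ψ j).symm (y j)).2, e_e_smul_ne S K (Ne.symm hj)]
        · simp
      rw [this, LinearEquiv.apply_symm_apply]
    have h2 : LinearMap.range J' = ⊤ := by
      rw [LinearMap.range_eq_top]
      intro y
      refine ⟨∑ i, (y i : M'), ?_⟩
      ext1 i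
      rw [hJ']
      refine Subtype.ext ?_
      change S.e K i • ∑ j, (y j : M') = _
      rw [Finset.smul_sum, Finset.sum_eq_single i]
      · exact (S.mem_vertexSpace K).mp (y i).2
      · intro j _ hj
        rw [← (S.mem_vertexSpace K).mp (y j).2, e_e_smul_ne S K (Ne.symm hj)]
      · simp
    rw [h1, h2]
  · intro i x y hxy
    ext1 j
    have := congrFun hxy j
    rw [hJ, hJ'] at this ⊢
    by_cases hj : j = i
    · subst hj
      simp only [e_e_smul]
      exact this
    · simp only [e_e_smul_ne S K hj]
      exact map_zero (ψ j)
  · intro i x y hxy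
    ext1 j
    have := congrFun hxy j
    rw [hJ, hJ'] at this ⊢
    by_cases hj : j = i
    · subst hj
      refine Subtype.ext ?_
      have e : (⟨S.e K j • S.eps K j • x, _, rfl⟩ : S.vertexSpace K M j) =
          S.epsEnd K M j ⟨S.e K j • x, x, rfl⟩ := Subtype.ext (by
        change S.e K j • S.eps K j • x = S.eps K j • S.e K j • x
        rw [e_eps_smul, eps_e_smul])
      rw [e, hψX, this]
      change S.eps K j • S.e K j • y = S.e K j • S.eps K j • y
      rw [e_eps_smul, eps_e_smul]
    · simp only [e_eps_smul_ne S K hj]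
      exact map_zero (ψ j)
  · intro i j k x y _
    rw [ha, ha', map_zero, map_zero]

end Base

end CartanDatum

namespace CartanDatum

/-! ### Dimensions of `tilde` and freeness of the image of M_in -/

section Dimension

variable {ι : Type w} [Fintype ι] [DecidableEq ι] (S : CartanDatum ι) (K : Type u) [Field K]
  (M : Type v) [AddCommGroup M] [Module K M] [Module (S.Preproj K) M]
  [IsScalarTower K (S.Preproj K) M]

/-- The diagonal entry 2 completes the sum of the absolute values `|c_bi|` over the neighbours to a
sum over a whole column of the Cartan matrix. -/
theorem finrank_tilde_eq [Module.Finite K M] (i : ι) :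
    (Module.finrank K (S.tilde K M i) : ℤ) =
      2 * S.vdim K M i - ∑ b, S.C b i * S.vdim K M b := by
  rw [finrank_tilde, ← Finset.add_sum_erase _ _ (Finset.mem_univ i), S.diag]
  push_cast
  have h1 : ∑ b with S.C b i < 0, |S.C b i| * (S.vdim K M b : ℤ) =
      ∑ b ∈ Finset.univ.erase i, -(S.C b i * (S.vdim K M b : ℤ)) := by
    rw [Finset.sum_filter, ← Finset.add_sum_erase _ _ (Finset.mem_univ i), S.diag]
    simp only [Nat.ofNat_pos, not_lt_of_gt, ↓reduceIte, zero_add]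
    refine Finset.sum_congr rfl fun b hb => ?_
    have hle := S.nonpos b i (Finset.ne_of_mem_erase hb)
    split_ifs with h
    · rw [abs_of_neg h]; ring
    · have : S.C b i = 0 := by omega
      simp [this]
  rw [h1, Finset.sum_neg_distrib]
  ring

variable {S K M}

/-- At `i`, exactness identifies the image of M_in with the cokernel of the injective map M_out
between modules free over `H_i`, and such a cokernel is free. -/
theorem genSub_locFree [Module.Finite K M] {i : ι} (ho : OutInj S K M i) (he : MidExact S K M i)
    (hM : ∀ b, S.LocFree K M b) (b : ι) : S.LocFree K (S.genSub K M i) b := by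
  by_cases hb : b = i
  · subst hb
    intro x hx hx0
    obtain ⟨t, ht, htx⟩ := mem_genSub.mp x.2
    have hx' : S.e K b • (x : M) = x := congrArg Subtype.val hx
    have hx0' : S.eps K b • (x : M) = 0 := congrArg Subtype.val hx0
    rw [hx'] at htx
    obtain ⟨y, hy, hyt⟩ := he (shift K t) (shift_mem ht) (by rw [tin_shift ht, htx, hx0'])
    obtain ⟨t', w, h⟩ := NilFree.coker (S.c_pos b) ((S.nilFree_epsEnd_iff K M b).mpr (hM b))
      (nilFree_tildeShift (S := S) (K := K) (M := M) b fun b _ => hM b) (S.toutV K M b)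
      (fun x => Subtype.ext (tout_eps b x.1))
      (by
        rw [injective_iff_map_eq_zero]
        intro x hx
        exact Subtype.ext (ho x.1 ((S.mem_vertexSpace K).mp x.2) (congrArg Subtype.val hx)))
      ⟨t, ht⟩ ⟨y, (S.mem_vertexSpace K).mpr hy⟩ (Subtype.ext hyt.symm)
    have htin : ∀ n, S.tin K b ((shift K ^ n) t'.1) = S.eps K b ^ n • S.tin K b t'.1 := by
      intro n
      induction n with
      | zero => simp
      | succ n ih =>
        rw [pow_succ', Module.End.mul_apply, tin_shift, ih, pow_succ', mul_smul]
        rw [← tildeShift_pow_coe]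
        exact Subtype.coe_prop _
    have h2 : t = (shift K ^ (S.c b - 1)) t'.1 + S.tout K b w.1 := by
      have := congrArg Subtype.val h
      rw [Submodule.coe_add, tildeShift_pow_coe] at this
      exact this
    have he := e_tin (S := S) (K := K) b t'.1
    refine ⟨⟨S.tin K b t'.1, mem_genSub.mpr ⟨t'.1, t'.2, he.symm⟩⟩, Subtype.ext he,
      Subtype.ext ?_⟩
    change S.eps K b ^ (S.c b - 1) • S.tin K b t'.1 = x
    rw [← htx, h2, map_add, tin_tout, add_zero, htin]
  · exact (genSub_covers hb).locFree' (Submodule.injective_subtype _) (hM b)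

theorem covers_of_vdim_eq {T : Type*} [AddCommGroup T] [Module K T] [Module (S.Preproj K) T]
    [IsScalarTower K (S.Preproj K) T] [Module.Finite K M] [Module.Finite K T]
    {j : M →ₗ[S.Preproj K] T} (hj : Function.Injective j) {b : ι}
    (h : S.vdim K M b = S.vdim K T b) : Covers j b := by
  intro x hx
  have hs := (LinearMap.injective_iff_surjective_of_finrank_eq_finrank
    (f := S.vmap K j b) h).mp (S.vmap_injective K hj b)
  obtain ⟨y, hy⟩ := hs ⟨x, (S.mem_vertexSpace K).mpr hx⟩
  exact ⟨y, congrArg Subtype.val hy⟩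

theorem eq_zero_of_vdim_eq_zero [Module.Finite K M] {b : ι} (h : S.vdim K M b = 0) {x : M}
    (hx : S.e K b • x = x) : x = 0 := by
  have h1 := Submodule.finrank_eq_zero.mp h
  have h2 := (S.mem_vertexSpace K).mpr hx
  rw [h1] at h2
  exact (Submodule.mem_bot K).mp h2

end Dimension

/-! ### Extremal weights: uniqueness and existence of stable modules -/

section FramedModules

variable {ι : Type w} [Fintype ι] [DecidableEq ι] (S : CartanDatum ι) (K : Type u) [Field K]

theorem framed_C_inl_inl (i j : ι) : S.framed.C (.inl i) (.inl j) = S.C i j := rfl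

theorem framed_C_inr_inl (i j : ι) :
    S.framed.C (.inr i) (.inl j) = if i = j then -1 else 0 := by
  change (-1 : Matrix ι ι ℤ) i j = _
  rw [Matrix.neg_apply, Matrix.one_apply]
  split_ifs <;> rfl

theorem framed_C_inl_inr (i j : ι) :
    S.framed.C (.inl i) (.inr j) = if i = j then -1 else 0 := by
  change (-1 : Matrix ι ι ℤ) i j = _
  rw [Matrix.neg_apply, Matrix.one_apply]
  split_ifs <;> rfl

theorem framed_C_inr_inr (i j : ι) :
    S.framed.C (.inr i) (.inr j) = if i = j then 2 else 0 := by
  change (Matrix.diagonal fun _ => (2 : ℤ) : Matrix ι ι ℤ) i j = _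
  rw [Matrix.diagonal_apply]

theorem framed_c_inl (i : ι) : S.framed.c (.inl i) = S.c i := rfl

theorem framed_c_inr (i : ι) : S.framed.c (.inr i) = S.c i := rfl

/-- The product of the entries of the symmetrizer. -/
def cprod : ℕ := ∏ i, S.c i

theorem cprod_pos : 0 < S.cprod := Finset.prod_pos fun i _ => S.c_pos i

/-- The cofactors of the entries of the symmetrizer. -/
def cofac (i : ι) : ℕ := S.cprod / S.c i

theorem cofac_mul_c (i : ι) : S.cofac i * S.c i = S.cprod :=
  Nat.div_mul_cancel (Finset.dvd_prod_of_mem _ (Finset.mem_univ i))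

theorem cofac_pos (i : ι) : 0 < S.cofac i := by
  have h := S.cofac_mul_c i
  have := S.cprod_pos
  rcases Nat.eq_zero_or_pos (S.cofac i) with h0 | h0
  · rw [h0, zero_mul] at h; omega
  · exact h0

/-- The cofactors are proportional to `1 / c_i`, so they turn columns of `C` into rows. Weights are
scaled by them because submodules such as `genSub` need not be locally free, and their dimensions
need not be divisible by `c_i`. -/
theorem C_mul_cofac (i j : ι) : S.C i j * S.cofac j = S.cofac i * S.C j i := by
  have h1 : (S.cofac i : ℤ) * S.c i = S.cprod := by exact_mod_cast S.cofac_mul_c i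
  have h2 : (S.cofac j : ℤ) * S.c j = S.cprod := by exact_mod_cast S.cofac_mul_c j
  have h3 := S.symm i j
  have hc : (S.c i : ℤ) ≠ 0 := by have := S.c_pos i; omega
  apply mul_left_cancel₀ hc
  linear_combination (S.cofac j : ℤ) * h3 + S.C j i * h2 - S.C j i * h1

variable (T : Type v) [AddCommGroup T] [Module K T] [Module (S.FPreproj K) T]
  [IsScalarTower K (S.FPreproj K) T]

/-- The maps `M_out` at all original vertices are injective. -/
def Prestable : Prop := ∀ i : ι, OutInj S.framed K T (.inl i)

/-- The weight of a framed module, determined by its dimensions, and scaled to be integral. -/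
noncomputable def dimWeight : ExtLattice ι :=
  (fun i => S.cofac i * S.framed.vdim K T (.inl i), fun i => -(S.cofac i * S.framed.vdim K T (.inr i)))

variable {S K T}

/-- The framing contributes `-1` for each `i'` adjacent to `i`, so the coroot value compares `e_i T`
with `tilde`, which is what a reflection changes. -/
theorem coroot_dimWeight [Module.Finite K T] (i : ι) : S.coroot i (S.dimWeight K T) =
    S.cofac i * (2 * S.framed.vdim K T (.inl i) -
      Module.finrank K (S.framed.tilde K T (.inl i))) := by
  rw [finrank_tilde_eq, coroot_apply, Fintype.sum_sum_type]
  simp only [framed_C_inl_inl, framed_C_inr_inl, dimWeight, Matrix.mulVec, dotProduct]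
  have h1 : ∑ j, S.C i j * ((S.cofac j : ℤ) * S.framed.vdim K T (.inl j)) =
      S.cofac i * ∑ j, S.C j i * (S.framed.vdim K T (.inl j) : ℤ) := by
    rw [Finset.mul_sum]
    refine Finset.sum_congr rfl fun j _ => ?_
    rw [← mul_assoc, C_mul_cofac, mul_assoc]
  rw [h1]
  simp only [ite_mul, zero_mul, Finset.sum_ite_eq', Finset.mem_univ, if_true]
  ring

/-- A change of the dimension at one original vertex. -/
theorem dimWeight_eq_of_eq {T' : Type*} [AddCommGroup T'] [Module K T'] [Module (S.FPreproj K) T']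
    [IsScalarTower K (S.FPreproj K) T'] {i : ι}
    (h : ∀ b, b ≠ Sum.inl i → S.framed.vdim K T' b = S.framed.vdim K T b) :
    S.dimWeight K T' = S.dimWeight K T + (S.cofac i * ((S.framed.vdim K T' (.inl i) : ℤ) -
      S.framed.vdim K T (.inl i))) • root i := by
  refine Prod.ext (funext fun j => ?_) (funext fun j => ?_)
  · by_cases hj : j = i
    · subst hj
      simp [dimWeight, root]
      ring
    · have := h (.inl j) (by simpa using hj)
      simp [dimWeight, root, hj, this]
  · have := h (.inr j) (by simp)
    simp [dimWeight, root, this]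

theorem genSub_vdim_ne {i : ι} {b : ι ⊕ ι} (hb : b ≠ .inl i) :
    S.framed.vdim K (S.framed.genSub K T (.inl i)) b = S.framed.vdim K T b :=
  (genSub_covers hb).vdim_eq (Submodule.injective_subtype _)

theorem Prestable.genSub (h : S.Prestable K T) (i : ι) :
    S.Prestable K (S.framed.genSub K T (.inl i)) := fun j =>
  (h j).of_injective (Submodule.injective_subtype _)

/-- The coefficient of `α_i` is a positive multiple of `dim tilde - dim T_i - dim im M_in`, which is
nonnegative if M_out is injective at `i` and then measures the failure of exactness in the middle.
-/
theorem s_dimWeight [Module.Finite K T] (i : ι) : S.s i (S.dimWeight K T) =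
    S.dimWeight K (S.framed.genSub K T (.inl i)) +
      (S.cofac i * ((Module.finrank K (S.framed.tilde K T (.inl i)) : ℤ) -
        S.framed.vdim K T (.inl i) -
        S.framed.vdim K (S.framed.genSub K T (.inl i)) (.inl i))) • root i := by
  rw [s_apply, coroot_dimWeight,
    dimWeight_eq_of_eq (T := T) (T' := S.framed.genSub K T (.inl i)) fun b hb => genSub_vdim_ne hb]
  module

/-- The weights of prestable modules lie in the convex hull of the orbits of the lowest weights. -/
theorem Red.dimWeight_nonneg {x : ExtLattice ι ≃ₗ[ℤ] ExtLattice ι} (hx : S.Red x) :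
    ∀ (T : Type v) [AddCommGroup T] [Module K T] [Module (S.FPreproj K) T]
      [IsScalarTower K (S.FPreproj K) T] [Module.Finite K T], S.Prestable K T →
      ∀ j, 0 ≤ (x⁻¹ (S.dimWeight K T)).1 j := by
  induction hx with
  | one =>
    intro T _ _ _ _ _ _ j
    change (0 : ℤ) ≤ S.cofac j * S.framed.vdim K T (.inl j)
    positivity
  | step u i hu h ih =>
    intro T _ _ _ _ _ hT j
    have e : ∀ y, (S.s i * u)⁻¹ y = u⁻¹ (S.s i y) := fun y => by
      rw [mul_inv_rev, s_inv]; rfl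
    -- The root part is that of `u⁻¹` applied to the weight of `genSub`, nonnegative by induction,
    -- plus a nonnegative multiple of the positive root `u⁻¹ α_i`.
    rw [e, s_dimWeight, map_add, map_smul]
    have h1 := ih _ (hT.genSub i) j
    have h2 := vdim_genSub_add_le (hT i)
    have h3 := h j
    simp only [Prod.fst_add, Prod.smul_fst, Pi.add_apply, Pi.smul_apply, smul_eq_mul]
    have h4 : (0 : ℤ) ≤ (Module.finrank K (S.framed.tilde K T (.inl i)) : ℤ) -
        S.framed.vdim K T (.inl i) -
        S.framed.vdim K (S.framed.genSub K T (.inl i)) (.inl i) := by omega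
    positivity

/-- The root part of `x⁻¹` applied to the weight of `T` is nonnegative, but here it equals `-a x⁻¹
α_i`. If `a` were positive, `x⁻¹ α_i` would vanish, which is impossible. -/
theorem Red.eq_zero_of_dimWeight {x : ExtLattice ι ≃ₗ[ℤ] ExtLattice ι} (hx : S.Red x) {i : ι}
    (h : ∀ t, 0 ≤ (x⁻¹ (root i)).1 t) [Module.Finite K T] (hT : S.Prestable K T)
    {y : ExtLattice ι} (hy : y.1 = 0) {a : ℤ} (ha : 0 ≤ a)
    (he : S.dimWeight K T + a • root i = x y) : a = 0 := by
  by_contra hne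
  have hpos : 0 < a := lt_of_le_of_ne ha (Ne.symm hne)
  have h1 := hx.dimWeight_nonneg T hT
  have e : x⁻¹ (S.dimWeight K T) = y - a • x⁻¹ (root i) := by
    rw [eq_sub_of_add_eq he, map_sub, map_smul]
    congr 1
    exact LinearEquiv.symm_apply_apply x y
  have h2 : x⁻¹ (root i) = 0 := by
    refine Prod.ext (funext fun t => ?_) ?_
    · have h3 := h1 t
      rw [e, Prod.fst_sub, hy] at h3
      simp only [Prod.smul_fst, Pi.sub_apply, Pi.zero_apply, Pi.smul_apply, smul_eq_mul] at h3
      have h4 := h t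
      change (x⁻¹ (root i)).1 t = 0
      nlinarith
    · rw [hx.inv_snd]; rfl
  have h3 : root i = (0 : ExtLattice ι) := (LinearEquiv.map_eq_zero_iff x⁻¹).mp h2
  have h4 := congrFun (congrArg Prod.fst h3) i
  simp [root] at h4

theorem Red.disp_eq {x : ExtLattice ι ≃ₗ[ℤ] ExtLattice ι} (l : ι → ℤ) :
    disp x l = (x (0, l)).1 := by
  simp [disp]

theorem dimWeight_of_hasRankVec [Module.Finite K T] {x : ExtLattice ι ≃ₗ[ℤ] ExtLattice ι}
    (hx : S.Red x) {l : ι → ℤ} (h : S.framed.HasRankVec K T (Sum.elim (disp x l) (-l))) :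
    S.dimWeight K T = x ((S.cprod : ℤ) • (0, l)) := by
  rw [hasRankVec_iff'] at h
  rw [map_smul]
  refine Prod.ext (funext fun j => ?_) (funext fun j => ?_)
  · have h1 := (h (.inl j)).2
    have h2 : (S.cofac j : ℤ) * S.c j = S.cprod := by exact_mod_cast S.cofac_mul_c j
    change (S.cofac j : ℤ) * S.framed.vdim K T (.inl j) = S.cprod * (x (0, l)).1 j
    rw [h1, framed_c_inl, ← mul_assoc, h2, ← Red.disp_eq]
    rfl
  · have h1 := (h (.inr j)).2
    have h2 : (S.cofac j : ℤ) * S.c j = S.cprod := by exact_mod_cast S.cofac_mul_c j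
    change -((S.cofac j : ℤ) * S.framed.vdim K T (.inr j)) = S.cprod * (x (0, l)).2 j
    rw [h1, framed_c_inr, ← mul_assoc, h2, hx.snd]
    simp

theorem hasRankVec_of_dimWeight [Module.Finite K T] {x : ExtLattice ι ≃ₗ[ℤ] ExtLattice ι}
    (hx : S.Red x) {l : ι → ℤ} (h : S.dimWeight K T = x ((S.cprod : ℤ) • (0, l)))
    (hT : ∀ b, S.framed.LocFree K T b) :
    S.framed.HasRankVec K T (Sum.elim (disp x l) (-l)) := by
  rw [hasRankVec_iff']
  refine fun b => ⟨hT b, ?_⟩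
  rw [map_smul] at h
  have hc : ∀ j, (S.cofac j : ℤ) ≠ 0 := fun j => by have := S.cofac_pos j; omega
  rcases b with j | j
  · have h1 := congrFun (congrArg Prod.fst h) j
    have h2 : (S.cofac j : ℤ) * S.c j = S.cprod := by exact_mod_cast S.cofac_mul_c j
    change (S.cofac j : ℤ) * S.framed.vdim K T (.inl j) = S.cprod * (x (0, l)).1 j at h1
    apply mul_left_cancel₀ (hc j)
    rw [h1, framed_c_inl, ← mul_assoc, h2, ← Red.disp_eq]
    rfl
  · have h1 := congrFun (congrArg Prod.snd h) j
    have h2 : (S.cofac j : ℤ) * S.c j = S.cprod := by exact_mod_cast S.cofac_mul_c j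
    change -((S.cofac j : ℤ) * S.framed.vdim K T (.inr j)) = S.cprod * (x (0, l)).2 j at h1
    rw [hx.snd] at h1
    apply mul_left_cancel₀ (hc j)
    rw [framed_c_inr, ← mul_assoc, h2]
    simp only [Sum.elim_inr, Pi.neg_apply]
    linarith

theorem arr_eq_zero_of_inl [Module.Finite K T] (h : ∀ j, S.framed.vdim K T (.inl j) = 0)
    (a b : ι ⊕ ι) (k : ℕ) (x : T) : S.framed.arr K a b k • x = 0 := by
  have h0 : ∀ j (y : T), S.framed.e K (.inl j) • y = 0 := fun j y =>
    eq_zero_of_vdim_eq_zero (h j) (S.framed.e_e_smul K _ y)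
  rcases a with a | a
  · rw [← e_arr_smul, h0]
  · rcases b with b | b
    · rw [← arr_e_smul, h0, smul_zero]
    · rw [arr_eq_zero, zero_smul]
      rw [framed_C_inr_inr]
      split_ifs <;> simp

/-- Prestable locally free modules of extremal weight are exact in the middle. -/
theorem Red.midExact {x : ExtLattice ι ≃ₗ[ℤ] ExtLattice ι} (hx : S.Red x) {i : ι}
    (h : ∀ t, 0 ≤ (x⁻¹ (root i)).1 t) [Module.Finite K T] (hT : S.Prestable K T) {l : ι → ℤ}
    (hr : S.framed.HasRankVec K T (Sum.elim (disp (S.s i * x) l) (-l))) :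
    MidExact S.framed K T (.inl i) ∧
      S.framed.HasRankVec K (S.framed.genSub K T (.inl i)) (Sum.elim (disp x l) (-l)) := by
  have h1 := dimWeight_of_hasRankVec (Red.step x i hx h) hr
  have h2 := s_dimWeight (S := S) (K := K) (T := T) i
  rw [h1, LinearEquiv.mul_apply, s_s] at h2
  have h3 := vdim_genSub_add_le (hT i)
  have h4 : (0 : ℤ) ≤ (Module.finrank K (S.framed.tilde K T (.inl i)) : ℤ) -
      S.framed.vdim K T (.inl i) -
      S.framed.vdim K (S.framed.genSub K T (.inl i)) (.inl i) := by omega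
  -- The weight of `genSub` plus the defect times `α_i` is extremal for `x`, so the defect vanishes.
  have h5 := hx.eq_zero_of_dimWeight h (hT.genSub i) (by simp) (by positivity) h2.symm
  have h6 : (S.cofac i : ℤ) ≠ 0 := by have := S.cofac_pos i; omega
  have h7 := (mul_eq_zero.mp h5).resolve_left h6
  have hm := midExact_of_eq (hT i) (by omega)
  refine ⟨hm, hasRankVec_of_dimWeight hx ?_ ?_⟩
  · rw [h2, h7]
    simp
  · rw [hasRankVec_iff'] at hr
    exact genSub_locFree (hT i) hm fun b => (hr b).1

/-- Prestable locally free modules of extremal weight are determined by their rank vectors. -/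
theorem Red.nonempty_equiv {x : ExtLattice ι ≃ₗ[ℤ] ExtLattice ι} (hx : S.Red x) {l : ι → ℤ} :
    ∀ (T : Type v) [AddCommGroup T] [Module K T] [Module (S.FPreproj K) T]
      [IsScalarTower K (S.FPreproj K) T] (T' : Type*) [AddCommGroup T'] [Module K T']
      [Module (S.FPreproj K) T'] [IsScalarTower K (S.FPreproj K) T'],
      S.Prestable K T → S.Prestable K T' →
      S.framed.HasRankVec K T (Sum.elim (disp x l) (-l)) →
      S.framed.HasRankVec K T' (Sum.elim (disp x l) (-l)) →
      Nonempty (T ≃ₗ[S.FPreproj K] T') := by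
  induction hx with
  | one =>
    intro T _ _ _ _ T' _ _ _ _ _ _ hr hr'
    have := hr.finite
    have := hr'.finite
    refine nonempty_equiv_of_arr_eq_zero hr hr' (arr_eq_zero_of_inl ?_) (arr_eq_zero_of_inl ?_)
    · intro j
      have := (((hasRankVec_iff' _ _ _ _).mp hr) (.inl j)).2
      simpa [disp_one] using this
    · intro j
      have := (((hasRankVec_iff' _ _ _ _).mp hr') (.inl j)).2
      simpa [disp_one] using this
  | step u i hu h ih =>
    intro T _ _ _ _ T' _ _ _ _ hT hT' hr hr'
    have := hr.finite
    have := hr'.finite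
    obtain ⟨h1, h2⟩ := hu.midExact h hT hr
    obtain ⟨h1', h2'⟩ := hu.midExact h hT' hr'
    obtain ⟨φ⟩ := ih _ _ (hT.genSub i) (hT'.genSub i) h2 h2'
    obtain ⟨e1⟩ := nonempty_equiv_refl (j := (S.framed.genSub K T (.inl i)).subtype)
      (Submodule.injective_subtype _) (fun b hb => genSub_covers hb) (hT i) h1
    -- Both modules are reflections of the same smaller module: the two submodules `genSub` are
    -- isomorphic by induction, and the second is embedded through that isomorphism.
    obtain ⟨e2⟩ := nonempty_equiv_refl
      (j := (S.framed.genSub K T' (.inl i)).subtype ∘ₗ φ.toLinearMap)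
      ((Submodule.injective_subtype _).comp φ.injective) (i := .inl i) (fun b hb x hx => by
        obtain ⟨y, rfl⟩ := genSub_covers hb x hx
        exact ⟨φ.symm y, by simp⟩) (hT' i) h1'
    exact ⟨e1.symm.trans e2⟩

variable (S K) in
/-- The stable modules of extremal weight. -/
structure IsModel (x : ExtLattice ι ≃ₗ[ℤ] ExtLattice ι) (l : ι → ℤ) (T : Type v) [AddCommGroup T]
    [Module K T] [Module (S.FPreproj K) T] [IsScalarTower K (S.FPreproj K) T] : Prop where
  prestable : S.Prestable K T
  rank : S.framed.HasRankVec K T (Sum.elim (disp x l) (-l))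
  filtered : S.framed.IsEFiltered K T

/-- The reflection of a module of extremal weight. -/
theorem Red.exists_model {x : ExtLattice ι ≃ₗ[ℤ] ExtLattice ι} (hx : S.Red x) {i : ι}
    (h : ∀ t, 0 ≤ (x⁻¹ (root i)).1 t) {l : ι → ℤ} (M : FinDimMod K (S.FPreproj K))
    (hM : S.IsModel K x l M) : ∃ (T : FinDimMod K (S.FPreproj K)) (j : M →ₗ[S.FPreproj K] T),
      S.IsModel K (S.s i * x) l T ∧ Function.Injective j ∧ ∀ b, b ≠ .inl i → Covers j b := by
  have h1 := dimWeight_of_hasRankVec hx hM.rank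
  have hlf : ∀ b, S.framed.LocFree K M b := fun b => ((hasRankVec_iff' _ _ _ _).mp hM.rank b).1
  have h2 := vdim_genSub_le (S := S.framed) (K := K) (M := M) (.inl i)
  have h3 := dimWeight_eq_of_eq (T := M) (T' := S.framed.genSub K M (.inl i))
    fun b hb => genSub_vdim_ne hb
  have h4 : S.dimWeight K (S.framed.genSub K M (.inl i)) + (S.cofac i *
      ((S.framed.vdim K M (.inl i) : ℤ) -
        S.framed.vdim K (S.framed.genSub K M (.inl i)) (.inl i))) • root i =
      x ((S.cprod : ℤ) • (0, l)) := by
    rw [← h1, h3]; module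
  have h5 : (0 : ℤ) ≤ (S.framed.vdim K M (.inl i) : ℤ) -
      S.framed.vdim K (S.framed.genSub K M (.inl i)) (.inl i) := by omega
  -- Here the coefficient of `α_i` is a multiple of `dim M_i - dim im M_in`. Extremality makes it
  -- zero, so M_in is onto.
  have h6 := hx.eq_zero_of_dimWeight h (hM.prestable.genSub i) (by simp) (by positivity) h4
  have h7 : (S.cofac i : ℤ) ≠ 0 := by have := S.cofac_pos i; omega
  have h8 := (mul_eq_zero.mp h6).resolve_left h7
  have hs := tin_surj_of_eq (S := S.framed) (K := K) (M := M) (i := .inl i) (by omega)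
  have hinj := Refl.emb_injective (hM.prestable i)
  have hcov : ∀ b, b ≠ .inl i → Covers (Refl.emb S.framed K M (.inl i)) b :=
    fun b hb => Refl.emb_covers hb
  have hpre : S.Prestable K (S.framed.Refl K M (.inl i)) := by
    intro j
    by_cases hj : j = i
    · subst hj; exact Refl.outInj
    · exact Refl.outInj_ne (hM.prestable i) (by simpa using hj) (hM.prestable j)
  have hlf' : ∀ b, S.framed.LocFree K (S.framed.Refl K M (.inl i)) b := by
    intro b
    by_cases hb : b = .inl i
    · subst hb; exact Refl.locFree hs hlf
    · exact (hcov b hb).locFree hinj (hlf b)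
  -- As M_in is onto, the new dimension at `i` is `dim tilde - dim M_i`, which is the effect of
  -- `s_i` on the weight.
  have hdw : S.dimWeight K (S.framed.Refl K M (.inl i)) =
      (S.s i * x) ((S.cprod : ℤ) • (0, l)) := by
    have h9 := Refl.vdim_add (S := S.framed) (K := K) (M := M) (i := .inl i) hs
    rw [dimWeight_eq_of_eq (T := M) (T' := S.framed.Refl K M (.inl i))
      fun b hb => ((hcov b hb).vdim_eq hinj).symm, LinearEquiv.mul_apply, ← h1, s_apply,
      coroot_dimWeight, ← h9]
    push_cast
    module
  have hrank := hasRankVec_of_dimWeight (Red.step x i hx h) hdw hlf'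
  have hfil : S.framed.IsEFiltered K (S.framed.Refl K M (.inl i)) :=
    hM.filtered.extend hinj hcov (hlf _) (hlf' _)
  obtain ⟨T, ⟨e⟩⟩ := exists_finDimMod_equiv (K := K) (A := S.FPreproj K)
    (S.framed.Refl K M (.inl i))
  refine ⟨T, e.toLinearMap ∘ₗ Refl.emb S.framed K M (.inl i), ⟨?_, ?_, ?_⟩, ?_, ?_⟩
  · exact fun j => (hpre j).of_injective (j := e.symm.toLinearMap) e.symm.injective
  · exact hrank.of_equiv _ _ e
  · rw [isEFiltered_iff] at hfil ⊢
    have := hfil.map (j := e.toLinearMap) e.injective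
    rwa [Submodule.map_top, LinearEquiv.range] at this
  · exact e.injective.comp hinj
  · intro b hb y hy
    obtain ⟨z, hz⟩ := hcov b hb (e.symm y) (by rw [← map_smul, hy])
    exact ⟨z, by simp [hz]⟩

end FramedModules

end CartanDatum

namespace CartanDatum

/-! ### Description of `sub_i` by the arrows -/

section Socle

variable {ι : Type w} [Fintype ι] (S : CartanDatum ι) (K : Type u) [Field K]
  (M : Type v) [AddCommGroup M] [Module K M] [Module (S.Preproj K) M]
  [IsScalarTower K (S.Preproj K) M]

/-- The submodule of the elements of `e_i M` which are killed by all arrows, even after the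
application of powers of `ε_i`. -/
noncomputable def outKer (i : ι) : Submodule (S.Preproj K) M :=
  S.submoduleOfGens K
    { carrier := {x | S.e K i • x = x ∧ ∀ b k m, S.arr K b i k • S.eps K i ^ m • x = 0}
      zero_mem' := by simp
      add_mem' := fun {x y} hx hy =>
        ⟨by rw [smul_add, hx.1, hy.1], fun b k m => by rw [smul_add, smul_add, hx.2, hy.2, add_zero]⟩
      smul_mem' := fun t x hx =>
        ⟨by rw [smul_comm_K, hx.1], fun b k m => by
          rw [smul_comm_K, smul_comm_K, hx.2, smul_zero]⟩ }
    (by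
      rintro j x hx
      by_cases h : j = i
      · subst h; rwa [hx.1]
      · rw [← hx.1, e_e_smul_ne S K h]; exact zero_mem _)
    (by
      rintro j x hx
      by_cases h : j = i
      · subst h
        refine ⟨S.e_eps_smul K j x, fun b k m => ?_⟩
        rw [← mul_smul (S.eps K j ^ m), ← pow_succ, hx.2]
      · rw [← hx.1, eps_e_smul_ne S K h]; exact zero_mem _)
    (by
      rintro a b k x hx
      by_cases h : b = i
      · subst h
        have := hx.2 a k 0
        rw [pow_zero, one_smul] at this
        rw [this]; exact zero_mem _
      · rw [← hx.1, arr_e_smul_ne S K h]; exact zero_mem _)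

variable {S K M}

theorem mem_outKer {i : ι} {x : M} : x ∈ S.outKer K M i ↔
    S.e K i • x = x ∧ ∀ b k m, S.arr K b i k • S.eps K i ^ m • x = 0 := Iff.rfl

theorem outInj_iff (i : ι) : OutInj S K M i ↔ S.outKer K M i = ⊥ := by
  have h : ∀ x : M, S.tout K i x = 0 ↔ ∀ b k m, S.arr K b i k • S.eps K i ^ m • x = 0 := by
    intro x
    simp only [funext_iff, tout_apply, Pi.zero_apply]
    refine forall_congr' fun b => forall_congr' fun k => forall_congr' fun m => ?_
    refine smul_eq_zero_iff_right fun h0 => ?_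
    have := S.sgn_mul_self K i b
    rw [h0, zero_mul] at this
    exact zero_ne_one this
  rw [Submodule.eq_bot_iff]
  simp only [OutInj, h, mem_outKer, and_imp]

theorem mem_of_eps_smul_mem {A B : Submodule (S.Preproj K) M} {i : ι}
    (h : ∀ x ∈ B, S.eps K i • x ∈ A → x ∈ A) : B ≤ A := by
  have h1 : ∀ n, ∀ x ∈ B, S.eps K i ^ n • x ∈ A → x ∈ A := by
    intro n
    induction n with
    | zero => intro x _ hx; rwa [pow_zero, one_smul] at hx
    | succ n ih =>
      intro x hxB hx
      rw [pow_succ, mul_smul] at hx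
      exact h x hxB (ih _ (B.smul_mem _ hxB) hx)
  exact fun x hx => h1 (S.c i) x hx (by rw [eps_pow, zero_smul]; exact A.zero_mem)

/-- On submodules of `outKer` all arrows vanish and only `ε_i` acts. Simplicity and nilpotency force
`ε_i` to vanish on the factor, and then every line in it is a submodule. -/
theorem isVertexSimple_of_le_outKer {i : ι} {A B : Submodule (S.Preproj K) M} (hAB : A ⋖ B)
    (hB : B ≤ S.outKer K M i) : S.IsVertexSimple K (B ⧸ A.submoduleOf B) i := by
  have he : ∀ x ∈ B, S.e K i • x = x := fun x hx => (mem_outKer.mp (hB hx)).1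
  have he' : ∀ j, j ≠ i → ∀ x ∈ B, S.e K j • x = 0 := fun j hj x hx => by
    rw [← he x hx, e_e_smul_ne S K hj]
  have harr : ∀ a b k, ∀ x ∈ B, S.arr K a b k • x = 0 := fun a b k x hx => by
    by_cases hb : b = i
    · subst hb
      have := (mem_outKer.mp (hB hx)).2 a k 0
      rwa [pow_zero, one_smul] at this
    · rw [← he x hx, arr_e_smul_ne S K hb]
  have heps' : ∀ j, j ≠ i → ∀ x ∈ B, S.eps K j • x = 0 := fun j hj x hx => by
    rw [← he x hx, eps_e_smul_ne S K hj]
  have heps : ∀ j, ∀ x ∈ B, S.eps K j • x ∈ A := by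
    intro j x hx
    by_cases hj : j = i
    swap
    · rw [heps' j hj x hx]; exact A.zero_mem
    subst hj
    -- The elements of `B` which `ε_j` maps into `A` form a submodule between `A` and `B`. It is not
    -- `A`, since `ε_j` is nilpotent.
    let A' := S.submoduleOfGens K
      (B.restrictScalars K ⊓ (A.restrictScalars K).comap (Algebra.lsmul K K M (S.eps K j)))
      (by
        rintro l y ⟨hy, hy'⟩
        by_cases hl : l = j
        · subst hl; rw [he y hy]; exact ⟨hy, hy'⟩
        · rw [he' l hl y hy]; exact zero_mem _)
      (by
        rintro l y ⟨hy, hy'⟩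
        by_cases hl : l = j
        · subst hl; exact ⟨B.smul_mem _ hy, A.smul_mem _ hy'⟩
        · rw [heps' l hl y hy]; exact zero_mem _)
      (by
        rintro a b k y ⟨hy, hy'⟩
        rw [harr a b k y hy]; exact zero_mem _)
    have h1 : A ≤ A' := fun y hy => ⟨hAB.le hy, A.smul_mem _ hy⟩
    have h2 : A' ≤ B := fun y hy => hy.1
    rcases hAB.eq_or_eq h1 h2 with h3 | h3
    · exact absurd (mem_of_eps_smul_mem (i := j) fun y hy hy' => h3 ▸ (⟨hy, hy'⟩ : y ∈ A'))
        hAB.lt.not_ge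
    · exact (h3 ▸ hx : x ∈ A').2
  obtain ⟨x0, hx0, hx0A⟩ := SetLike.exists_of_lt hAB.lt
  let A' := S.submoduleOfGens K (A.restrictScalars K ⊔ K ∙ x0)
    (by
      intro l y hy
      have hyB : y ∈ B.restrictScalars K :=
        (sup_le hAB.le ((Submodule.span_singleton_le_iff_mem _ _).mpr hx0) :
          A.restrictScalars K ⊔ K ∙ x0 ≤ B.restrictScalars K) hy
      by_cases hl : l = i
      · subst hl; rwa [he y hyB]
      · rw [he' l hl y hyB]; exact zero_mem _)
    (by
      intro l y hy
      have hyB : y ∈ B.restrictScalars K :=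
        (sup_le hAB.le ((Submodule.span_singleton_le_iff_mem _ _).mpr hx0) :
          A.restrictScalars K ⊔ K ∙ x0 ≤ B.restrictScalars K) hy
      exact Submodule.mem_sup_left (heps l y hyB))
    (by
      intro a b k y hy
      have hyB : y ∈ B.restrictScalars K :=
        (sup_le hAB.le ((Submodule.span_singleton_le_iff_mem _ _).mpr hx0) :
          A.restrictScalars K ⊔ K ∙ x0 ≤ B.restrictScalars K) hy
      rw [harr a b k y hyB]; exact zero_mem _)
  have h1 : A ≤ A' := fun y hy => Submodule.mem_sup_left (S := A.restrictScalars K) hy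
  have h2 : A' ≤ B := (sup_le hAB.le ((Submodule.span_singleton_le_iff_mem _ _).mpr hx0) :
          A.restrictScalars K ⊔ K ∙ x0 ≤ B.restrictScalars K)
  have h3 : A' = B := (hAB.eq_or_eq h1 h2).resolve_left fun h3 => hx0A (by
    rw [← h3]
    exact Submodule.mem_sup_right (S := A.restrictScalars K) (Submodule.mem_span_singleton_self x0))
  refine ⟨?_, ?_, ?_, ?_⟩
  · refine finrank_eq_one (Submodule.Quotient.mk ⟨x0, hx0⟩) ?_ ?_
    · exact fun h => hx0A ((Submodule.Quotient.mk_eq_zero (A.submoduleOf B)).mp h)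
    · intro y
      obtain ⟨⟨y, hy⟩, rfl⟩ := Submodule.Quotient.mk_surjective _ y
      obtain ⟨a, ha, z, hz, hazy⟩ := Submodule.mem_sup.mp (h3 ▸ hy : y ∈ A')
      obtain ⟨t, rfl⟩ := Submodule.mem_span_singleton.mp hz
      refine ⟨t, ?_⟩
      refine (Submodule.Quotient.eq (A.submoduleOf B)
        (x := t • (⟨x0, hx0⟩ : B)) (y := ⟨y, hy⟩)).mpr ?_
      change t • x0 - y ∈ A
      rw [← hazy, sub_add_cancel_right]
      exact A.neg_mem ha
  · intro y
    obtain ⟨⟨y, hy⟩, rfl⟩ := Submodule.Quotient.mk_surjective _ y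
    exact congrArg Submodule.Quotient.mk (Subtype.ext (he y hy))
  · intro j y
    obtain ⟨⟨y, hy⟩, rfl⟩ := Submodule.Quotient.mk_surjective _ y
    exact (Submodule.Quotient.mk_eq_zero (A.submoduleOf B)).mpr (heps j y hy)
  · intro a b k y
    obtain ⟨⟨y, hy⟩, rfl⟩ := Submodule.Quotient.mk_surjective _ y
    exact congrArg Submodule.Quotient.mk (Subtype.ext (harr a b k y hy))

/-- A submodule with all composition factors at `i` is concentrated at `i`, so every arrow out of
`i` kills it: its target lies at another vertex, where the submodule is zero. -/
theorem subAt_eq_outKer [Module.Finite K M] (i : ι) : S.subAt K M i = S.outKer K M i := by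
  have : IsNoetherian (S.Preproj K) M := isNoetherian_of_tower K inferInstance
  refine le_antisymm (sSup_le fun N hN => ?_)
    (le_sSup fun A B hAB hB => isVertexSimple_of_le_outKer hAB hB)
  have h0 : ∀ j, j ≠ i → ∀ x ∈ N, S.e K j • x = 0 := by
    intro j hj x hx
    by_contra hne
    -- A maximal submodule of this cyclic module would give a composition factor on which `e_i` is
    -- the identity, while `e_i` kills its generator.
    set G := Submodule.span (S.Preproj K) {S.e K j • x} with hG
    have hG0 : ⊥ < G := by
      rw [bot_lt_iff_ne_bot, Ne, Submodule.span_singleton_eq_bot]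
      exact hne
    obtain ⟨A, -, hA⟩ := exists_le_covBy_of_lt hG0
    have hGN : G ≤ N := (Submodule.span_singleton_le_iff_mem _ _).mpr (N.smul_mem _ hx)
    have h1 := (hN A G hA hGN).2.1
    apply hA.lt.not_ge
    rw [hG, Submodule.span_singleton_le_iff_mem]
    have hmem : S.e K j • x ∈ G := Submodule.mem_span_singleton_self _
    have h2 := h1 (Submodule.Quotient.mk ⟨S.e K j • x, hmem⟩)
    have h3 : (⟨S.e K i • S.e K j • x, G.smul_mem _ hmem⟩ : G) = 0 :=
      Subtype.ext (S.e_e_smul_ne K (Ne.symm hj) x)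
    change Submodule.Quotient.mk (⟨S.e K i • S.e K j • x, G.smul_mem _ hmem⟩ : G) = _ at h2
    rw [h3] at h2
    exact (Submodule.Quotient.mk_eq_zero (A.submoduleOf G)).mp h2.symm
  intro x hx
  have he : ∀ y ∈ N, S.e K i • y = y := by
    intro y hy
    conv_rhs => rw [← S.sum_e_smul K y]
    rw [Finset.sum_eq_single i]
    · exact fun b _ hb => h0 b hb y hy
    · simp
  refine mem_outKer.mpr ⟨he x hx, fun b k m => ?_⟩
  have hm := N.smul_mem (S.arr K b i k) (N.smul_mem (S.eps K i ^ m) hx)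
  by_cases hb : b = i
  · subst hb
    rw [arr_eq_zero _ _ _ _ _ (by rw [S.diag]; omega), zero_smul]
  · rw [← he _ hm, e_arr_smul_ne S K (Ne.symm hb)]

theorem subAt_eq_bot_iff [Module.Finite K M] (i : ι) :
    S.subAt K M i = ⊥ ↔ OutInj S K M i := by
  rw [subAt_eq_outKer, outInj_iff]

/-- Locally free modules on which all arrows act by zero are `𝔼`-filtered. -/
theorem isEFiltered_of_arr_eq_zero [DecidableEq ι] [Module.Finite K M]
    (ha : ∀ a b k, ∀ x : M, S.arr K a b k • x = 0) (hM : ∀ i, S.LocFree K M i) :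
    S.IsEFiltered K M := by
  -- The submodule supported on the vertices in `s`; without arrows it is stable, and vertices are
  -- added one by one.
  let A : Finset ι → Submodule (S.Preproj K) M := fun s => S.submoduleOfGens K
    (⨅ b ∈ (sᶜ : Finset ι), LinearMap.ker (Algebra.lsmul K K M (S.e K b)))
    (by
      intro j x hx
      simp only [Submodule.mem_iInf, LinearMap.mem_ker, Algebra.lsmul_coe] at hx ⊢
      intro b hb
      by_cases h : b = j
      · subst h; rw [e_e_smul]; exact hx b hb
      · rw [e_e_smul_ne S K h])
    (by
      intro j x hx
      simp only [Submodule.mem_iInf, LinearMap.mem_ker, Algebra.lsmul_coe] at hx ⊢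
      intro b hb
      by_cases h : b = j
      · subst h; rw [e_eps_smul, ← eps_e_smul, hx b hb, smul_zero]
      · rw [e_eps_smul_ne S K h])
    (by intro a b k x _; rw [ha]; exact zero_mem _)
  have hA : ∀ s x, x ∈ A s ↔ ∀ b ∉ s, S.e K b • x = 0 := by
    intro s x
    change x ∈ (⨅ b ∈ (sᶜ : Finset ι), LinearMap.ker (Algebra.lsmul K K M (S.e K b))) ↔ _
    simp only [Submodule.mem_iInf, LinearMap.mem_ker, Algebra.lsmul_coe, Finset.mem_compl]
  have key : ∀ s, S.EChain K M (A s) := by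
    intro s
    induction s using Finset.induction_on with
    | empty =>
      have : A ∅ = ⊥ := by
        rw [Submodule.eq_bot_iff]
        intro x hx
        rw [← S.sum_e_smul K x]
        exact Finset.sum_eq_zero fun b _ => (hA _ _).mp hx b (Finset.notMem_empty b)
      rw [this]
      exact .bot
    | insert i s hi ih =>
      refine ih.extend (i := i) (fun x hx => (hA _ _).mpr fun b hb =>
        (hA _ _).mp hx b fun h => hb (Finset.mem_insert_of_mem h)) ?_ ?_
      · intro x hx
        refine (hA _ _).mpr fun b hb => ?_
        rw [smul_sub]
        by_cases hbi : b = i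
        · subst hbi; rw [e_e_smul, sub_self]
        · rw [e_e_smul_ne S K hbi, sub_zero, (hA _ _).mp hx b (by simp [hb, hbi])]
      · intro x hx hex hx'
        have h0 := (hA _ _).mp hx' i hi
        rw [e_eps_smul] at h0
        obtain ⟨y, hy, hyx⟩ := hM i x hex h0
        refine ⟨y, (hA _ _).mpr fun b hb => ?_, hy, by rw [hyx, sub_self]; exact zero_mem _⟩
        rw [← hy, e_e_smul_ne S K]
        rintro rfl
        exact hb (Finset.mem_insert_self _ _)
  rw [isEFiltered_iff]
  convert key Finset.univ
  rw [eq_comm, eq_top_iff]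
  exact fun x _ => (hA _ _).mpr fun b hb => absurd (Finset.mem_univ b) hb

end Socle

section FramedStability

variable {ι : Type w} [Fintype ι] [DecidableEq ι] {S : CartanDatum ι} {K : Type u} [Field K]
  {T : Type v} [AddCommGroup T] [Module K T] [Module (S.FPreproj K) T]
  [IsScalarTower K (S.FPreproj K) T]

theorem isStable_iff [Module.Finite K T] :
    S.IsStable K T ↔ S.framed.IsEFiltered K T ∧ S.Prestable K T := by
  unfold IsStable Prestable
  simp only [subAt_eq_bot_iff]

end FramedStability

end CartanDatum

namespace CartanDatum

/-! ### The quotient of a framed module by its framing part -/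

section Unframe

variable {ι : Type w} [Fintype ι] [DecidableEq ι] (S : CartanDatum ι) (K : Type u) [Field K]

theorem unframe_quot (a : FreeAlgebra K (Gen (ι ⊕ ι))) :
    S.unframe K (S.framed.quot K a) = FreeAlgebra.lift K (S.unframeGen K) a :=
  RingQuot.liftAlgHom_mkAlgHom_apply ..

theorem unframe_gen_e (b : ι ⊕ ι) : S.unframe K (S.framed.e K b) = S.unframeGen K (.e b) := by
  rw [e, unframe_quot, fe, FreeAlgebra.lift_ι_apply]

theorem unframe_gen_eps (b : ι ⊕ ι) :
    S.unframe K (S.framed.eps K b) = S.unframeGen K (.eps b) := by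
  rw [eps, unframe_quot, feps, FreeAlgebra.lift_ι_apply]

theorem unframe_gen_arr (a b : ι ⊕ ι) (k : ℕ) :
    S.unframe K (S.framed.arr K a b k) = S.unframeGen K (.arr a b k) := by
  rw [arr, unframe_quot, farr, FreeAlgebra.lift_ι_apply]

theorem unframe_e (i : ι) : S.unframe K (S.framed.e K (.inl i)) = S.e K i := unframe_gen_e ..

theorem unframe_eps (i : ι) : S.unframe K (S.framed.eps K (.inl i)) = S.eps K i :=
  unframe_gen_eps ..

theorem unframe_arr (i j : ι) (k : ℕ) :
    S.unframe K (S.framed.arr K (.inl i) (.inl j) k) = S.arr K i j k := unframe_gen_arr ..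

variable {S K}
variable {T : Type*} [AddCommGroup T] [Module K T] [Module (S.FPreproj K) T]
  [IsScalarTower K (S.FPreproj K) T]
  {N : Type*} [AddCommGroup N] [Module K N] [Module (S.Preproj K) N]
  [IsScalarTower K (S.Preproj K) N]

/-- The map `π` identifies `N` with the quotient of `T` by the spaces at the framing vertices. -/
structure IsUnframing (π : T →ₗ[K] N) : Prop where
  surj : Function.Surjective π
  ker : ∀ x, π x = 0 ↔ ∀ j, S.framed.e K (.inl j) • x = 0
  smul : ∀ (a : S.FPreproj K) x, π (a • x) = S.unframe K a • π x

namespace IsUnframing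

variable {π : T →ₗ[K] N} (h : IsUnframing (S := S) π)

include h

theorem e_smul (i : ι) (x : T) : π (S.framed.e K (.inl i) • x) = S.e K i • π x := by
  rw [h.smul, unframe_e]

theorem eps_smul (i : ι) (x : T) : π (S.framed.eps K (.inl i) • x) = S.eps K i • π x := by
  rw [h.smul, unframe_eps]

theorem arr_smul (i j : ι) (k : ℕ) (x : T) :
    π (S.framed.arr K (.inl i) (.inl j) k • x) = S.arr K i j k • π x := by
  rw [h.smul, unframe_arr]

theorem eps_pow_smul (i : ι) (n : ℕ) (x : T) :
    π (S.framed.eps K (.inl i) ^ n • x) = S.eps K i ^ n • π x := by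
  rw [h.smul, map_pow, unframe_eps]

theorem exists_eq {i : ι} {y : N} (hy : S.e K i • y = y) :
    ∃ x, S.framed.e K (.inl i) • x = x ∧ π x = y := by
  obtain ⟨x, rfl⟩ := h.surj y
  exact ⟨_, S.framed.e_e_smul K _ x, by rw [h.e_smul, hy]⟩

theorem eq_zero {i : ι} {x : T} (hx : S.framed.e K (.inl i) • x = x) (h0 : π x = 0) : x = 0 := by
  rw [← hx]
  exact (h.ker x).mp h0 i

theorem locFree {i : ι} (hT : S.framed.LocFree K T (.inl i)) : S.LocFree K N i := by
  intro y hy hy0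
  obtain ⟨x, hx, rfl⟩ := h.exists_eq hy
  rw [← h.eps_smul] at hy0
  obtain ⟨z, hz, hzx⟩ := hT x hx (h.eq_zero (S.framed.e_eps_smul K _ x) hy0)
  exact ⟨π z, by rw [← h.e_smul, hz], by rw [← hzx]; exact (h.eps_pow_smul i _ z).symm⟩

theorem vdim_eq (i : ι) : S.framed.vdim K T (.inl i) = S.vdim K N i := by
  let φ : S.framed.vertexSpace K T (.inl i) →ₗ[K] S.vertexSpace K N i :=
    π.restrict fun x hx => by
      rw [mem_vertexSpace] at hx ⊢
      rw [← h.e_smul, hx]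
  refine LinearEquiv.finrank_eq (LinearEquiv.ofBijective φ ⟨?_, fun y => ?_⟩)
  · rw [injective_iff_map_eq_zero]
    intro x hx
    exact Subtype.ext (h.eq_zero ((S.framed.mem_vertexSpace K).mp x.2) (congrArg Subtype.val hx))
  · obtain ⟨x, hx, hxy⟩ := h.exists_eq ((S.mem_vertexSpace K).mp y.2)
    exact ⟨⟨x, (S.framed.mem_vertexSpace K).mpr hx⟩, Subtype.ext hxy⟩

theorem hasRankVec {ν μ : ι → ℤ} (hT : S.framed.HasRankVec K T (Sum.elim ν μ)) :
    S.HasRankVec K N ν := by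
  have := hT.finite
  have : Module.Finite K N := Module.Finite.of_surjective π h.surj
  rw [hasRankVec_iff'] at hT ⊢
  exact fun i => ⟨h.locFree (hT (.inl i)).1, by rw [← h.vdim_eq, (hT (.inl i)).2]; rfl⟩

/-- The map of the quotients induced by a homomorphism. -/
theorem exists_map {T' : Type*} [AddCommGroup T'] [Module K T'] [Module (S.FPreproj K) T']
    [IsScalarTower K (S.FPreproj K) T'] {N' : Type*} [AddCommGroup N'] [Module K N']
    [Module (S.Preproj K) N'] [IsScalarTower K (S.Preproj K) N'] {π' : T' →ₗ[K] N'}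
    (h' : IsUnframing (S := S) π') (f : T →ₗ[S.FPreproj K] T') :
    ∃ φ : N →ₗ[S.Preproj K] N', (∀ x, φ (π x) = π' (f x)) ∧
      (Function.Injective f → Function.Injective φ) ∧
      (Function.Surjective f → Function.Surjective φ) := by
  let φ : N →ₗ[K] N' := (LinearMap.ker π).liftQ (π' ∘ₗ f.restrictScalars K) (fun x hx => by
    rw [LinearMap.mem_ker, h.ker] at hx
    refine (h'.ker _).mpr fun j => ?_
    change _ • f x = 0
    rw [← map_smul, hx, map_zero]) ∘ₗ (π.quotKerEquivOfSurjective h.surj).symm.toLinearMap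
  have hφ : ∀ x, φ (π x) = π' (f x) := by
    intro x
    have : (π.quotKerEquivOfSurjective h.surj).symm (π x) = Submodule.Quotient.mk x := by
      rw [LinearEquiv.symm_apply_eq]; rfl
    simp only [φ, LinearMap.comp_apply, LinearEquiv.coe_coe, this]
    rfl
  refine ⟨S.homOfGens K φ ?_ ?_ ?_, hφ, fun hf => ?_, fun hf => ?_⟩
  · intro i y
    obtain ⟨x, rfl⟩ := h.surj y
    rw [← h.e_smul, hφ, hφ, map_smul, h'.e_smul]
  · intro i y
    obtain ⟨x, rfl⟩ := h.surj y
    rw [← h.eps_smul, hφ, hφ, map_smul, h'.eps_smul]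
  · intro i j k y
    obtain ⟨x, rfl⟩ := h.surj y
    rw [← h.arr_smul, hφ, hφ, map_smul, h'.arr_smul]
  · rw [injective_iff_map_eq_zero]
    intro y hy
    obtain ⟨x, rfl⟩ := h.surj y
    change φ _ = 0 at hy
    rw [hφ, h'.ker] at hy
    refine (h.ker x).mpr fun j => hf ?_
    rw [map_smul, hy, map_zero]
  · intro y
    obtain ⟨x', rfl⟩ := h'.surj y
    obtain ⟨x, rfl⟩ := hf x'
    exact ⟨π x, hφ x⟩

theorem nonempty_equiv {T' : Type*} [AddCommGroup T'] [Module K T'] [Module (S.FPreproj K) T']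
    [IsScalarTower K (S.FPreproj K) T'] {N' : Type*} [AddCommGroup N'] [Module K N']
    [Module (S.Preproj K) N'] [IsScalarTower K (S.Preproj K) N'] {π' : T' →ₗ[K] N'}
    (h' : IsUnframing (S := S) π') (f : T ≃ₗ[S.FPreproj K] T') :
    Nonempty (N ≃ₗ[S.Preproj K] N') := by
  obtain ⟨φ, -, h1, h2⟩ := h.exists_map h' f.toLinearMap
  exact ⟨LinearEquiv.ofBijective φ ⟨h1 f.injective, h2 f.surjective⟩⟩

theorem prod {T' : Type*} [AddCommGroup T'] [Module K T'] [Module (S.FPreproj K) T']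
    [IsScalarTower K (S.FPreproj K) T'] {N' : Type*} [AddCommGroup N'] [Module K N']
    [Module (S.Preproj K) N'] [IsScalarTower K (S.Preproj K) N'] {π' : T' →ₗ[K] N'}
    (h' : IsUnframing (S := S) π') : IsUnframing (S := S) (π.prodMap π') where
  surj := h.surj.prodMap h'.surj
  ker x := by
    change (π x.1, π' x.2) = 0 ↔ _
    rw [Prod.mk_eq_zero, h.ker, h'.ker, ← forall_and]
    exact forall_congr' fun j => (Prod.mk_eq_zero ..).symm
  smul a x := Prod.ext (h.smul a x.1) (h'.smul a x.2)

/-- The cokernel of an embedding whose image is the part of `T` at the framing vertices. -/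
theorem exists_coker_equiv {B : Type*} [AddCommGroup B] [Module K B] [Module (S.FPreproj K) B]
    [IsScalarTower K (S.FPreproj K) B] {j : B →ₗ[S.FPreproj K] T}
    (hB : ∀ i x, S.framed.e K (.inl i) • j x = 0) (hcov : ∀ i, Covers j (.inr i)) :
    ∃ φ : (T ⧸ LinearMap.range j) ≃ₗ[K] N,
      ∀ (a : S.FPreproj K) y, φ (a • y) = S.unframe K a • φ y := by
  have hker : ∀ x, x ∈ LinearMap.ker π ↔ x ∈ LinearMap.range j := by
    intro x
    rw [LinearMap.mem_ker, h.ker]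
    constructor
    · intro hx
      rw [← S.framed.sum_e_smul K x]
      refine Submodule.sum_mem _ fun b _ => ?_
      rcases b with b | b
      · rw [hx]; exact zero_mem _
      · exact hcov b _ (S.framed.e_e_smul K _ x)
    · rintro ⟨x, rfl⟩ i
      exact hB i x
  let θ : (T ⧸ LinearMap.range j) →ₗ[K] N :=
    ((LinearMap.range j).restrictScalars K).liftQ π (fun x hx => (hker x).mpr hx) ∘ₗ
      (Submodule.Quotient.restrictScalarsEquiv K (LinearMap.range j)).symm.toLinearMap
  have hθ : ∀ x, θ (Submodule.Quotient.mk x) = π x := fun x => rfl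
  refine ⟨LinearEquiv.ofBijective θ ⟨?_, ?_⟩, ?_⟩
  · rw [injective_iff_map_eq_zero]
    intro y hy
    obtain ⟨x, rfl⟩ := Submodule.Quotient.mk_surjective _ y
    exact (Submodule.Quotient.mk_eq_zero _).mpr ((hker x).mp hy)
  · intro y
    obtain ⟨x, rfl⟩ := h.surj y
    exact ⟨_, hθ x⟩
  · intro a y
    obtain ⟨x, rfl⟩ := Submodule.Quotient.mk_surjective _ y
    exact h.smul a x

end IsUnframing

theorem e_inr_e_inl (i j : ι) (x : T) : S.framed.e K (.inr j) • S.framed.e K (.inl i) • x = 0 :=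
  S.framed.e_e_smul_ne K (by simp) x

theorem e_inl_e_inr (i j : ι) (x : T) : S.framed.e K (.inl i) • S.framed.e K (.inr j) • x = 0 :=
  S.framed.e_e_smul_ne K (by simp) x

/-- Compatibility with the canonical surjection can be checked on generators. -/
theorem map_smul_of_framed_gens {π : T →ₗ[K] N}
    (h0 : ∀ x, (∀ j, S.framed.e K (.inl j) • x = 0) → π x = 0)
    (he : ∀ i x, π (S.framed.e K (.inl i) • x) = S.e K i • π x)
    (heps : ∀ i x, π (S.framed.eps K (.inl i) • x) = S.eps K i • π x)
    (harr : ∀ i j k x, π (S.framed.arr K (.inl i) (.inl j) k • x) = S.arr K i j k • π x)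
    (hT : ∀ i j k, ∀ x : T, S.framed.arr K (.inl i) (.inr j) k • x = 0) (a : S.FPreproj K)
    (x : T) : π (a • x) = S.unframe K a • π x := by
  induction a using S.framed.preproj_induction K generalizing x with
  | he b =>
    rw [unframe_gen_e]
    rcases b with i | i
    · exact he i x
    · rw [h0 _ fun j => e_inl_e_inr j i x]
      exact (zero_smul _ _).symm
  | heps b =>
    rw [unframe_gen_eps]
    rcases b with i | i
    · exact heps i x
    · rw [h0 _ fun j => S.framed.e_eps_smul_ne K (by simp) x]
      exact (zero_smul _ _).symm
  | harr a b k =>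
    rw [unframe_gen_arr]
    rcases a with a | a
    · rcases b with b | b
      · exact harr a b k x
      · rw [hT, map_zero]
        exact (zero_smul _ _).symm
    · rw [h0 _ fun j => S.framed.e_arr_smul_ne K (by simp) _ k x]
      rcases b with b | b <;> exact (zero_smul _ _).symm
  | halg t => rw [AlgHom.commutes, algebraMap_smul, algebraMap_smul, map_smul]
  | hadd a b ha hb => rw [add_smul, map_add, map_add, add_smul, ha, hb]
  | hmul a b ha hb => rw [mul_smul, map_mul, mul_smul, ha, hb]

section Existence

variable (S K T)

/-- The operators of the generators at the original vertices. -/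
noncomputable def unframeOp : Gen ι → Module.End K T
  | .e i => Algebra.lsmul K K T (S.framed.e K (.inl i))
  | .eps i => Algebra.lsmul K K T (S.framed.eps K (.inl i))
  | .arr i j k => Algebra.lsmul K K T (S.framed.arr K (.inl i) (.inl j) k)

/-- The part of a framed module at the original vertices. -/
noncomputable def unframeSub : Submodule K T :=
  ⨅ j, LinearMap.ker (Algebra.lsmul K K T (S.framed.e K (.inr j)))

variable {S K T}

theorem mem_unframeSub {x : T} : x ∈ S.unframeSub K T ↔ ∀ j, S.framed.e K (.inr j) • x = 0 := by
  simp [unframeSub]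

theorem unframeOp_eps_pow (i : ι) (n : ℕ) (x : T) :
    (S.unframeOp K T (.eps i) ^ n) x = S.framed.eps K (.inl i) ^ n • x := by
  change ((Algebra.lsmul K K T (S.framed.eps K (.inl i))) ^ n) x = _
  rw [← map_pow]
  rfl

/-- Only the mesh relation differs from the framed one: at `i` the framed relation has an additional
path through `i'`, which the hypothesis kills. -/
theorem unframeOp_isRepOn
    (hT : ∀ i j k, ∀ x : T, S.framed.arr K (.inl i) (.inr j) k • x = 0) :
    S.IsRepOn K (S.unframeOp K T) (S.unframeSub K T) where
  mem a x hx := by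
    rw [mem_unframeSub]
    intro j
    cases a with
    | e i => exact e_inr_e_inl i j x
    | eps i => exact S.framed.e_eps_smul_ne K (by simp) x
    | arr a b k => exact S.framed.e_arr_smul_ne K (by simp) _ k x
  idem i x _ := S.framed.e_e_smul K _ x
  orth i j x _ h := S.framed.e_e_smul_ne K (by simpa using h) x
  one x hx := by
    have h := S.framed.sum_e_smul K x
    rw [Fintype.sum_sum_type] at h
    simp only [mem_unframeSub.mp hx, Finset.sum_const_zero, add_zero] at h
    exact h
  eps_vertex i x _ := by
    change S.framed.e K _ • S.framed.eps K _ • S.framed.e K _ • x = S.framed.eps K _ • x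
    rw [eps_e_smul, e_eps_smul]
  arr_vertex i j k x _ := by
    change S.framed.e K _ • S.framed.arr K _ _ k • S.framed.e K _ • x = S.framed.arr K _ _ k • x
    rw [arr_e_smul, e_arr_smul]
  arr_zero i j k h x _ := by
    change S.framed.arr K (.inl i) (.inl j) k • x = 0
    rw [arr_eq_zero S.framed K (.inl i) (.inl j) k h, zero_smul]
  nilp i x _ := by
    rw [unframeOp_eps_pow]
    have := S.framed.eps_pow K (.inl i)
    change S.framed.eps K (.inl i) ^ S.c i = 0 at this
    rw [this, zero_smul]
  comm i j k _ _ x _ := by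
    rw [unframeOp_eps_pow, unframeOp_eps_pow]
    exact S.framed.eps_arr_smul K (.inl i) (.inl j) k x
  mesh i x _ := by
    have h := congrArg (fun a => a • x) (S.framed.mesh K (.inl i))
    simp only [Finset.sum_filter, Fintype.sum_sum_type, add_smul, Finset.sum_smul, ite_smul,
      zero_smul, smul_assoc, mul_smul, hT, smul_zero, Finset.sum_const_zero, ite_self,
      add_zero] at h
    simp only [Finset.sum_filter, unframeOp_eps_pow]
    exact h

/-- A framed module on which the arrows from the framing vertices act by zero has a quotient at the
original vertices. -/
theorem exists_unframing [Module.Finite K T]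
    (hT : ∀ i j k, ∀ x : T, S.framed.arr K (.inl i) (.inr j) k • x = 0) :
    ∃ (N : FinDimMod K (S.Preproj K)) (π : T →ₗ[K] N), IsUnframing (S := S) π := by
  have hr := unframeOp_isRepOn hT
  let P := RepMod hr.isRep
  -- The projection along the framing part; by `hT` no original arrow carries framing elements back
  -- to the original vertices.
  let p : T →ₗ[K] S.unframeSub K T :=
    (∑ i, Algebra.lsmul K K T (S.framed.e K (.inl i))).codRestrict _ fun x => by
      rw [mem_unframeSub]
      intro j
      simp only [LinearMap.sum_apply, Algebra.lsmul_coe, Finset.smul_sum, e_inr_e_inl,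
        Finset.sum_const_zero]
  have hp : ∀ x, (p x : T) = ∑ i, S.framed.e K (.inl i) • x := fun x => by
    simp [p]
  let π : T →ₗ[K] P := (RepMod.of hr.isRep).toLinearMap ∘ₗ p
  have hπ : ∀ x, π x = RepMod.of hr.isRep (p x) := fun _ => rfl
  have hpe : ∀ i x, S.framed.e K (.inl i) • (p x : T) = S.framed.e K (.inl i) • x := fun i x => by
    rw [hp, Finset.smul_sum, Finset.sum_eq_single i, e_e_smul]
    · intro j _ hj
      exact S.framed.e_e_smul_ne K (by simpa using hj.symm) x
    · simp
  have hfix : ∀ x, (∀ j, S.framed.e K (.inr j) • x = 0) → (p x : T) = x := fun x hx => by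
    rw [hp]
    exact hr.one x (mem_unframeSub.mpr hx)
  have hp0 : ∀ x, (∀ j, S.framed.e K (.inl j) • x = 0) → p x = 0 := fun x hx => Subtype.ext (by
    rw [hp]
    exact Finset.sum_eq_zero fun j _ => hx j)
  have h0 : ∀ x, (∀ j, S.framed.e K (.inl j) • x = 0) → π x = 0 := fun x hx => by
    rw [hπ, hp0 x hx, map_zero]
  have hsmul : ∀ (a : S.FPreproj K) x, π (a • x) = S.unframe K a • π x := by
    refine map_smul_of_framed_gens h0 (fun i x => ?_) (fun i x => ?_) (fun i j k x => ?_) hT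
    · rw [hπ, hπ, RepMod.e_smul]
      congr 1
      refine Subtype.ext ?_
      rw [hfix _ fun j => e_inr_e_inl i j x]
      exact (hpe i x).symm
    · rw [hπ, hπ, RepMod.eps_smul]
      congr 1
      refine Subtype.ext ?_
      rw [hfix _ fun j => S.framed.e_eps_smul_ne K (by simp) x]
      change _ = S.framed.eps K (.inl i) • (p x : T)
      rw [← S.framed.eps_e_smul K (.inl i) (p x : T), hpe, eps_e_smul]
    · rw [hπ, hπ, RepMod.arr_smul]
      congr 1
      refine Subtype.ext ?_
      rw [hfix _ fun j => S.framed.e_arr_smul_ne K (by simp) _ k x]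
      change _ = S.framed.arr K (.inl i) (.inl j) k • (p x : T)
      rw [← S.framed.arr_e_smul K (.inl i) (.inl j) k (p x : T), hpe, arr_e_smul]
  have : Module.Finite K P := inferInstanceAs (Module.Finite K (S.unframeSub K T))
  obtain ⟨N, ⟨e⟩⟩ := exists_finDimMod_equiv (K := K) (A := S.Preproj K) P
  refine ⟨N, (e.restrictScalars K).toLinearMap ∘ₗ π, ?_, fun x => ?_, fun a x => ?_⟩
  · intro y
    obtain ⟨y, rfl⟩ := e.surjective y
    obtain ⟨y, rfl⟩ := (RepMod.of hr.isRep).surjective y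
    refine ⟨y, congrArg e ?_⟩
    rw [hπ]
    exact congrArg _ (Subtype.ext (hfix _ (mem_unframeSub.mp y.2)))
  · constructor
    · intro hx i
      have h1 : π x = 0 := e.injective (by rw [map_zero]; exact hx)
      have h2 : p x = 0 := (RepMod.of hr.isRep).injective (by rw [map_zero]; exact h1)
      rw [← hpe, h2]
      simp
    · intro hx
      change e (π x) = 0
      rw [h0 x hx, map_zero]
  · change e (π _) = _ • e (π x)
    rw [hsmul, map_smul]

end Existence

end Unframe

end CartanDatum

namespace CartanDatum

/-! ### The arrows to the framing vertices -/

section FramingArrows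

variable {ι : Type w} [Fintype ι] [DecidableEq ι] {S : CartanDatum ι} {K : Type u} [Field K]

theorem framed_g_inr_inl (i : ι) : S.framed.g (.inr i) (.inl i) = 1 := by
  simp [g, framed_C_inr_inl, framed_C_inl_inr]

theorem framed_f_inr_inl (i : ι) : S.framed.f (.inr i) (.inl i) = 1 := by
  simp [f, framed_g_inr_inl, framed_C_inr_inl]

theorem framed_f_inl_inr (i : ι) : S.framed.f (.inl i) (.inr i) = 1 := by
  simp [f, g_comm S.framed (.inl i), framed_g_inr_inl, framed_C_inl_inr]

theorem arr_inr_inl_eq_zero {i j : ι} {k : ℕ} (h : ¬ (j = i ∧ k = 0)) :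
    S.framed.arr K (.inr j) (.inl i) k = 0 := by
  refine S.framed.arr_eq_zero K _ _ k fun h' => h ?_
  rw [framed_C_inr_inl] at h'
  by_cases hj : j = i
  · subst hj
    rw [framed_g_inr_inl] at h'
    exact ⟨rfl, by omega⟩
  · simp [hj] at h'

variable {T : Type v} [AddCommGroup T] [Module K T] [Module (S.FPreproj K) T]
  [IsScalarTower K (S.FPreproj K) T]

/-- All numbers `f` at a framing edge are 1, so the framing arrow is linear over `H_i`. -/
theorem arr_inr_inl_eps_pow (i : ι) (k m : ℕ) (x : T) :
    S.framed.arr K (.inr i) (.inl i) k • S.framed.eps K (.inl i) ^ m • x =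
      S.framed.eps K (.inr i) ^ m • S.framed.arr K (.inr i) (.inl i) k • x := by
  induction m with
  | zero => simp
  | succ m ih =>
    have h := S.framed.eps_arr_smul K (.inr i) (.inl i) k (S.framed.eps K (.inl i) ^ m • x)
    rw [framed_f_inr_inl, framed_f_inl_inr, pow_one, pow_one] at h
    rw [pow_succ', mul_smul, ← h, ih, pow_succ', mul_smul]

/-- By linearity over `H_i`, the framing arrow has to be tested only on `x` itself and not on its
multiples by powers of `ε_i`. -/
theorem mem_outKer_inl {i : ι} {x : T} : x ∈ S.framed.outKer K T (.inl i) ↔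
    S.framed.e K (.inl i) • x = x ∧
      (∀ b k m, S.framed.arr K (.inl b) (.inl i) k • S.framed.eps K (.inl i) ^ m • x = 0) ∧
      S.framed.arr K (.inr i) (.inl i) 0 • x = 0 := by
  rw [mem_outKer]
  refine and_congr_right fun _ => ⟨fun h => ⟨fun b k m => h (.inl b) k m, ?_⟩, ?_⟩
  · simpa using h (.inr i) 0 0
  · rintro ⟨h1, h2⟩ (b | b) k m
    · exact h1 b k m
    · by_cases hb : b = i ∧ k = 0
      · obtain ⟨rfl, rfl⟩ := hb
        rw [arr_inr_inl_eps_pow, h2, smul_zero]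
      · rw [arr_inr_inl_eq_zero hb, zero_smul]

theorem outInj_inl_iff (i : ι) : OutInj S.framed K T (.inl i) ↔
    ∀ x : T, S.framed.e K (.inl i) • x = x →
      (∀ b k m, S.framed.arr K (.inl b) (.inl i) k • S.framed.eps K (.inl i) ^ m • x = 0) →
      S.framed.arr K (.inr i) (.inl i) 0 • x = 0 → x = 0 := by
  rw [outInj_iff, Submodule.eq_bot_iff]
  simp only [mem_outKer_inl, and_imp]

variable (S K T) in
/-- The elements at the framing vertex `i'` are images of elements at `i` which are killed by the
other arrows. -/
def SocleSurj (i : ι) : Prop :=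
  ∀ z : T, S.framed.e K (.inr i) • z = z → ∃ x : T, S.framed.e K (.inl i) • x = x ∧
    (∀ b k m, S.framed.arr K (.inl b) (.inl i) k • S.framed.eps K (.inl i) ^ m • x = 0) ∧
    S.framed.arr K (.inr i) (.inl i) 0 • x = z

theorem covers_inr_of_hasRankVec {B : Type*} [AddCommGroup B] [Module K B]
    [Module (S.FPreproj K) B] [IsScalarTower K (S.FPreproj K) B] {ν ν' μ : ι → ℤ}
    (hB : S.framed.HasRankVec K B (Sum.elim ν' μ)) (hT : S.framed.HasRankVec K T (Sum.elim ν μ))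
    {j : B →ₗ[S.FPreproj K] T} (hj : Function.Injective j) (b : ι) : Covers j (.inr b) := by
  have := hB.finite
  have := hT.finite
  rw [hasRankVec_iff'] at hB hT
  refine covers_of_vdim_eq hj ?_
  have h1 := (hB (.inr b)).2
  have h2 := (hT (.inr b)).2
  rw [Sum.elim_inr] at h1 h2
  exact_mod_cast h1.trans h2.symm

theorem Covers.arr_smul_eq_zero {B : Type*} [AddCommGroup B] [Module K B]
    [Module (S.FPreproj K) B] [IsScalarTower K (S.FPreproj K) B] {j : B →ₗ[S.FPreproj K] T}
    {b : ι ⊕ ι} (hj : Covers j b) (hB : ∀ a k, ∀ x : B, S.framed.arr K a b k • x = 0)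
    (a : ι ⊕ ι) (k : ℕ) (x : T) : S.framed.arr K a b k • x = 0 := by
  obtain ⟨y, hy⟩ := hj _ (S.framed.e_e_smul K b x)
  rw [← arr_e_smul, ← hy, ← map_smul, hB, map_zero]

theorem SocleSurj.map {M : Type*} [AddCommGroup M] [Module K M]
    [Module (S.FPreproj K) M] [IsScalarTower K (S.FPreproj K) M] {j : M →ₗ[S.FPreproj K] T}
    {i : ι} (hj : Covers j (.inr i)) (h : S.SocleSurj K M i) : S.SocleSurj K T i := by
  intro z hz
  obtain ⟨z, hz', rfl⟩ := hj.exists_eq hz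
  obtain ⟨x, hx, h1, rfl⟩ := h z hz'
  exact ⟨j x, by rw [← map_smul, hx], fun b k m => by rw [← map_smul, ← map_smul, h1, map_zero],
    by rw [← map_smul]⟩

/-- The socle of a module with only one generalized composition factor outside the framing. -/
theorem socleSurj_of_hasRankVec {i : ι} (hT : S.Prestable K T)
    (hr : S.framed.HasRankVec K T (Sum.elim (Pi.single i 1) (Pi.single i 1))) :
    S.SocleSurj K T i := by
  have := hr.finite
  rw [hasRankVec_iff'] at hr
  have h0 : ∀ b, b ≠ i → ∀ x : T, S.framed.e K (.inl b) • x = 0 := fun b hb x =>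
    eq_zero_of_vdim_eq_zero (by have := (hr (.inl b)).2; simpa [hb] using this)
      (S.framed.e_e_smul K _ x)
  have h1 : ∀ b k m, ∀ x : T,
      S.framed.arr K (.inl b) (.inl i) k • S.framed.eps K (.inl i) ^ m • x = 0 := by
    intro b k m x
    by_cases hb : b = i
    · subst hb
      rw [arr_eq_zero _ _ _ _ _ (by rw [S.framed.diag]; omega), zero_smul]
    · rw [← e_arr_smul, h0 b hb]
  -- With no space at the other original vertices, prestability makes the framing arrow injective;
  -- the spaces at `i` and `i'` have equal dimension.
  let A : S.framed.vertexSpace K T (.inl i) →ₗ[K] S.framed.vertexSpace K T (.inr i) :=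
    (Algebra.lsmul K K T (S.framed.arr K (.inr i) (.inl i) 0)).restrict fun x _ => by
      rw [mem_vertexSpace]
      exact S.framed.e_arr_smul K _ _ _ _
  have hA : Function.Injective A := by
    rw [injective_iff_map_eq_zero]
    intro x hx
    exact Subtype.ext ((outInj_inl_iff i).mp (hT i) x.1 ((S.framed.mem_vertexSpace K).mp x.2)
      (fun b k m => h1 b k m _) (congrArg Subtype.val hx))
  have hd : S.framed.vdim K T (.inl i) = S.framed.vdim K T (.inr i) := by
    have e1 := (hr (.inl i)).2
    have e2 := (hr (.inr i)).2
    rw [Sum.elim_inl, framed_c_inl] at e1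
    rw [Sum.elim_inr, framed_c_inr, ← e1] at e2
    exact_mod_cast e2.symm
  have hs := (LinearMap.injective_iff_surjective_of_finrank_eq_finrank (f := A) hd).mp hA
  intro z hz
  obtain ⟨x, hx⟩ := hs ⟨z, (S.framed.mem_vertexSpace K).mpr hz⟩
  exact ⟨x, (S.framed.mem_vertexSpace K).mp x.2, fun b k m => h1 b k m _, congrArg Subtype.val hx⟩

end FramingArrows

/-! ### Stable modules with control of their quotients -/

section Existence

variable {ι : Type w} [Fintype ι] [DecidableEq ι] (S : CartanDatum ι) (K : Type u) [Field K]

/-- The direct sum of the generalized simple modules at the framing vertices. -/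
abbrev FBase (l : ι → ℤ) : Type max u w :=
  S.framed.Base K (Sum.elim 0 fun i => (-l i).toNat)

variable {S K}

theorem fbase_hasRankVec {l : ι → ℤ} (hl : AntiDominant l) :
    S.framed.HasRankVec K (S.FBase K l) (Sum.elim 0 (-l)) := by
  have h := base_hasRankVec (S := S.framed) (K := K) (Sum.elim 0 fun i => (-l i).toNat)
  convert h using 1
  ext (b | b)
  · rfl
  · exact (Int.toNat_of_nonneg (neg_nonneg.mpr (hl b))).symm

/-- The ranks at the framing vertices agree, so the spaces there come from the embedded module
without arrows. Hence the framing part is a submodule. -/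
theorem arr_inl_inr_smul {l ν : ι → ℤ} (hl : AntiDominant l) {T : Type*} [AddCommGroup T]
    [Module K T] [Module (S.FPreproj K) T] [IsScalarTower K (S.FPreproj K) T]
    (hT : S.framed.HasRankVec K T (Sum.elim ν (-l)))
    {j : S.FBase K l →ₗ[S.FPreproj K] T} (hj : Function.Injective j) (a b : ι) (k : ℕ) (x : T) :
    S.framed.arr K (.inl a) (.inr b) k • x = 0 :=
  (covers_inr_of_hasRankVec (fbase_hasRankVec hl) hT hj b).arr_smul_eq_zero
    (fun a k x => base_arr _ a _ k x) _ k x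

theorem subsingleton_of_vdim_eq_zero {M : Type*} [AddCommGroup M] [Module K M]
    [Module (S.Preproj K) M] [IsScalarTower K (S.Preproj K) M] [Module.Finite K M]
    (h : ∀ i, S.vdim K M i = 0) : Subsingleton M := by
  refine subsingleton_of_forall_eq 0 fun x => ?_
  rw [← S.sum_e_smul K x]
  exact Finset.sum_eq_zero fun i _ => eq_zero_of_vdim_eq_zero (h i) (S.e_e_smul K i x)

theorem isEFiltered_of_subsingleton {M : Type*} [AddCommGroup M] [Module K M]
    [Module (S.Preproj K) M] [IsScalarTower K (S.Preproj K) M] [Subsingleton M] :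
    S.IsEFiltered K M := by
  rw [isEFiltered_iff, Subsingleton.elim (⊤ : Submodule (S.Preproj K) M) ⊥]
  exact .bot

variable (S K) in
/-- The stable modules of extremal weight, with the properties of their quotients. -/
structure IsGoodModel (x : ExtLattice ι ≃ₗ[ℤ] ExtLattice ι) (l : ι → ℤ) (T : Type v)
    [AddCommGroup T] [Module K T] [Module (S.FPreproj K) T] [IsScalarTower K (S.FPreproj K) T] :
    Prop extends S.IsModel K x l T where
  exists_embedding : ∃ j : S.FBase K l →ₗ[S.FPreproj K] T, Function.Injective j
  quotient_filtered : ∀ (N : FinDimMod K (S.Preproj K)) (π : T →ₗ[K] N),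
    IsUnframing (S := S) π → S.IsEFiltered K N
  socleSurj : ∀ i, l = -Pi.single i 1 → disp x l ≠ 0 → S.SocleSurj K T i

theorem exists_goodModel_one {l : ι → ℤ} (hl : AntiDominant l) :
    ∃ T : FinDimMod K (S.FPreproj K), S.IsGoodModel K 1 l T := by
  obtain ⟨T, ⟨e⟩⟩ := exists_finDimMod_equiv (K := K) (A := S.FPreproj K) (S.FBase K l)
  have hr : S.framed.HasRankVec K T (Sum.elim (disp 1 l) (-l)) := by
    rw [disp_one]
    exact (fbase_hasRankVec hl).of_equiv _ _ e
  have hr' := (hasRankVec_iff' _ _ _ _).mp hr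
  have h0 : ∀ i, S.framed.vdim K T (.inl i) = 0 := fun i => by
    have := (hr' (.inl i)).2
    simpa [disp_one] using this
  refine ⟨T, ⟨⟨fun i x hx _ => eq_zero_of_vdim_eq_zero (h0 i) hx, hr, ?_⟩,
    ⟨e.toLinearMap, e.injective⟩, fun N π hπ => ?_, fun i _ h => absurd (disp_one l) h⟩⟩
  · refine isEFiltered_of_arr_eq_zero (fun a b k x => ?_) fun i => (hr' i).1
    obtain ⟨y, rfl⟩ := e.surjective x
    rw [← map_smul, base_arr, map_zero]
  · have := subsingleton_of_vdim_eq_zero (S := S) (K := K) (M := N) fun i => by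
      rw [← hπ.vdim_eq, h0]
    exact isEFiltered_of_subsingleton

/-- All properties are carried through the reflection steps along the embedding of each module in
the next. -/
theorem Red.exists_goodModel {x : ExtLattice ι ≃ₗ[ℤ] ExtLattice ι} (hx : S.Red x) {l : ι → ℤ}
    (hl : AntiDominant l) : ∃ T : FinDimMod K (S.FPreproj K), S.IsGoodModel K x l T := by
  induction hx with
  | one => exact exists_goodModel_one hl
  | step u i hu h ih =>
    obtain ⟨M, hM⟩ := ih
    obtain ⟨T, j, hT, hj, hcov⟩ := hu.exists_model h M hM.toIsModel
    obtain ⟨j0, hj0⟩ := hM.exists_embedding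
    refine ⟨T, ⟨hT, ⟨j ∘ₗ j0, hj.comp hj0⟩, fun N π hπ => ?_, fun i0 hi0 hd => ?_⟩⟩
    · obtain ⟨N', π', hπ'⟩ := exists_unframing (arr_inl_inr_smul hl hM.rank hj0)
      -- The quotient of the old module embeds in the new one and is unchanged away from `i`, so its
      -- filtration extends.
      obtain ⟨φ, hφ, hφi, -⟩ := hπ'.exists_map hπ j
      refine (hM.quotient_filtered N' π' hπ').extend (hφi hj) (i := i) (fun b hb y hy => ?_)
        (hπ'.locFree ((hasRankVec_iff' _ _ _ _).mp hM.rank (.inl i)).1)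
        (hπ.locFree ((hasRankVec_iff' _ _ _ _).mp hT.rank (.inl i)).1)
      obtain ⟨x, hx, rfl⟩ := hπ.exists_eq hy
      obtain ⟨z, rfl⟩ := hcov (.inl b) (by simpa using hb) x hx
      exact ⟨π' z, hφ z⟩
    -- Surjectivity onto the framing arises at the first step which changes the module. Before it
    -- the weight is still `-ϖ_{i0}`, so the reflection must be at `i0` and creates rank one there;
    -- later steps preserve the property.
    · by_cases hd0 : disp u l = 0
      · have e1 : u (0, l) = (0, l) := Prod.ext (by rw [← Red.disp_eq, hd0]) (Red.snd S hu _)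
        have e2 : disp (S.s i * u) l = Pi.single i (-l i) := by
          rw [Red.disp_eq, LinearEquiv.mul_apply, e1, s_apply, coroot_apply]
          ext b
          by_cases hb : b = i
          · subst hb; simp [root]
          · simp [root, hb]
        have e3 : i = i0 := by
          by_contra hne
          apply hd
          rw [e2, hi0]
          simp [hne]
        subst e3
        refine socleSurj_of_hasRankVec hT.prestable ?_
        have := hT.rank
        rw [e2, hi0] at this
        simpa using this
      · exact (hM.socleSurj i0 hi0 hd0).map (hcov _ (by simp))

end Existence

end CartanDatum

namespace CartanDatum

/-! ### Direct products -/

section Products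

variable {ι : Type w} [Fintype ι] {S : CartanDatum ι} {K : Type u} [Field K]
  {M : Type v} [AddCommGroup M] [Module K M] [Module (S.Preproj K) M]
  [IsScalarTower K (S.Preproj K) M]
  {M' : Type*} [AddCommGroup M'] [Module K M'] [Module (S.Preproj K) M']
  [IsScalarTower K (S.Preproj K) M']

theorem OutInj.prod {i : ι} (h : OutInj S K M i) (h' : OutInj S K M' i) :
    OutInj S K (M × M') i := by
  rw [outInj_iff, Submodule.eq_bot_iff] at h h' ⊢
  intro x hx
  obtain ⟨hx, hx'⟩ := mem_outKer.mp hx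
  exact Prod.ext
    (h x.1 (mem_outKer.mpr ⟨congrArg Prod.fst hx, fun b k m => congrArg Prod.fst (hx' b k m)⟩))
    (h' x.2 (mem_outKer.mpr ⟨congrArg Prod.snd hx, fun b k m => congrArg Prod.snd (hx' b k m)⟩))

theorem LocFree.prod {i : ι} (h : S.LocFree K M i) (h' : S.LocFree K M' i) :
    S.LocFree K (M × M') i := by
  intro x hx hx0
  obtain ⟨y, hy, hyx⟩ := h x.1 (congrArg Prod.fst hx) (congrArg Prod.fst hx0)
  obtain ⟨y', hy', hyx'⟩ := h' x.2 (congrArg Prod.snd hx) (congrArg Prod.snd hx0)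
  exact ⟨(y, y'), Prod.ext hy hy', Prod.ext hyx hyx'⟩

theorem vdim_prod [Module.Finite K M] [Module.Finite K M'] (i : ι) :
    S.vdim K (M × M') i = S.vdim K M i + S.vdim K M' i := by
  unfold vdim
  rw [← Module.finrank_prod]
  let φ : S.vertexSpace K (M × M') i →ₗ[K] S.vertexSpace K M i × S.vertexSpace K M' i :=
    (S.vmap K (LinearMap.fst _ M M') i).prod (S.vmap K (LinearMap.snd _ M M') i)
  refine LinearEquiv.finrank_eq (LinearEquiv.ofBijective φ ⟨fun x y h => ?_, fun y => ?_⟩)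
  · exact Subtype.ext (Prod.ext (congrArg (fun z => (z.1 : M)) h)
      (congrArg (fun z => (z.2 : M')) h))
  · exact ⟨⟨(y.1, y.2), (S.mem_vertexSpace K).mpr (Prod.ext ((S.mem_vertexSpace K).mp y.1.2)
      ((S.mem_vertexSpace K).mp y.2.2))⟩, rfl⟩

theorem HasRankVec.prod {r r' : ι → ℤ} (h : S.HasRankVec K M r) (h' : S.HasRankVec K M' r') :
    S.HasRankVec K (M × M') (r + r') := by
  have := h.finite
  have := h'.finite
  rw [hasRankVec_iff'] at h h' ⊢
  refine fun i => ⟨(h i).1.prod (h' i).1, ?_⟩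
  rw [vdim_prod, Nat.cast_add, (h i).2, (h' i).2, Pi.add_apply, mul_add]

end Products

/-! ### The socle of the quotient -/

section SubOfQuotient

variable {ι : Type w} [Fintype ι] [DecidableEq ι] {S : CartanDatum ι} {K : Type u} [Field K]
  {T : Type*} [AddCommGroup T] [Module K T] [Module (S.FPreproj K) T]
  [IsScalarTower K (S.FPreproj K) T]
  {N : Type*} [AddCommGroup N] [Module K N] [Module (S.Preproj K) N]
  [IsScalarTower K (S.Preproj K) N] {π : T →ₗ[K] N}

theorem IsUnframing.mem_outKer_iff (h : IsUnframing (S := S) π) {i : ι} {x : T}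
    (hx : S.framed.e K (.inl i) • x = x) : π x ∈ S.outKer K N i ↔
      ∀ b k m, S.framed.arr K (.inl b) (.inl i) k • S.framed.eps K (.inl i) ^ m • x = 0 := by
  rw [mem_outKer, ← h.e_smul, hx]
  simp only [true_and]
  refine forall_congr' fun b => forall_congr' fun k => forall_congr' fun m => ?_
  rw [← h.eps_pow_smul, ← h.arr_smul]
  exact ⟨h.eq_zero (S.framed.e_arr_smul K _ _ _ _), fun h0 => by rw [h0, map_zero]⟩

theorem sub_eq_outKer [Module.Finite K N] {i : ι} (h : ∀ j, j ≠ i → S.outKer K N j = ⊥) :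
    S.sub K N = S.outKer K N i := by
  unfold sub
  simp only [subAt_eq_outKer]
  refine le_antisymm (iSup_le fun j => ?_) (le_iSup (fun j => S.outKer K N j) i)
  by_cases hj : j = i
  · rw [hj]
  · rw [h j hj]; exact bot_le

/-- The socle of the quotient of a prestable module with framing of rank one at the vertex `i`. -/
theorem IsUnframing.isGenSimple_sub (h : IsUnframing (S := S) π) (hT : S.Prestable K T) {i : ι}
    {ν : ι → ℤ} (hr : S.framed.HasRankVec K T (Sum.elim ν (Pi.single i 1)))
    (hs : S.SocleSurj K T i) : S.IsGenSimple K (S.sub K N) i := by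
  have := hr.finite
  have : Module.Finite K N := Module.Finite.of_surjective π h.surj
  rw [hasRankVec_iff'] at hr
  -- Prestability at `i`: a socle element of the quotient at `i` is determined by its image under
  -- the framing arrow.
  have hinj : ∀ x : T, S.framed.e K (.inl i) • x = x → π x ∈ S.outKer K N i →
      S.framed.arr K (.inr i) (.inl i) 0 • x = 0 → x = 0 := fun x hx hx' h0 =>
    (outInj_inl_iff i).mp (hT i) x hx ((h.mem_outKer_iff hx).mp hx') h0
  have hbot : ∀ j, j ≠ i → S.outKer K N j = ⊥ := by
    intro j hj
    rw [Submodule.eq_bot_iff]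
    intro y hy
    obtain ⟨x, hx, rfl⟩ := h.exists_eq (mem_outKer.mp hy).1
    rw [(outInj_inl_iff j).mp (hT j) x hx ((h.mem_outKer_iff hx).mp hy), map_zero]
    refine eq_zero_of_vdim_eq_zero (M := T) ?_ (S.framed.e_arr_smul K _ _ _ _)
    have := (hr (.inr j)).2
    simpa [hj] using this
  rw [sub_eq_outKer hbot]
  unfold IsGenSimple
  have hei : ∀ y : S.outKer K N i, S.e K i • y = y := fun y =>
    Subtype.ext (mem_outKer.mp y.2).1
  rw [hasRankVec_iff']
  intro j
  by_cases hj : j = i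
  swap
  · have h0 : ∀ y : S.outKer K N i, S.e K j • y = 0 := fun y => by
      rw [← hei y, e_e_smul_ne S K hj]
    constructor
    · intro y hy _
      exact ⟨0, smul_zero _, by rw [smul_zero, ← hy, h0]⟩
    · have e : S.vertexSpace K (S.outKer K N i) j = ⊥ := by
        ext y
        rw [mem_vertexSpace, h0, Submodule.mem_bot, eq_comm]
      rw [vdim, e]
      simp [hj]
  subst hj
  constructor
  · intro y _ hy0
    obtain ⟨x, hx, hxy⟩ := h.exists_eq (mem_outKer.mp y.2).1
    have hxK : π x ∈ S.outKer K N j := hxy ▸ y.2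
    have hex : S.framed.eps K (.inl j) • x = 0 := by
      refine h.eq_zero (S.framed.e_eps_smul K _ x) ?_
      rw [h.eps_smul, hxy]
      exact congrArg Subtype.val hy0
    -- Freeness is transported from the framing vertex: divide the image of `x` there by `ε ^ (c_j -
    -- 1)`, lift the result to the socle by `hs`, and compare with `x` through `hinj`.
    obtain ⟨w, hw, hwx⟩ := (hr (.inr j)).1 (S.framed.arr K (.inr j) (.inl j) 0 • x)
      (S.framed.e_arr_smul K _ _ _ _) (by
        have := arr_inr_inl_eps_pow (S := S) (K := K) j 0 1 x
        rw [pow_one, pow_one] at this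
        rw [← this, hex, smul_zero])
    obtain ⟨x', hx', hx'0, rfl⟩ := hs w hw
    have hx'K : π x' ∈ S.outKer K N j := (h.mem_outKer_iff hx').mpr hx'0
    refine ⟨⟨π x', hx'K⟩, hei _, Subtype.ext ?_⟩
    change S.eps K j ^ (S.c j - 1) • π x' = y
    rw [← hxy, ← h.eps_pow_smul, ← sub_eq_zero, ← map_sub]
    refine (congrArg π (hinj _ ?_ ?_ ?_)).trans (map_zero π)
    · rw [smul_sub, hx, S.framed.e_eps_pow_smul K _ _ _ hx']
    · rw [map_sub, h.eps_pow_smul]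
      exact sub_mem ((S.outKer K N j).smul_mem _ hx'K) hxK
    · rw [smul_sub, arr_inr_inl_eps_pow, sub_eq_zero]
      exact hwx
  -- The preimage of the socle at `j` is isomorphic to the socle through `π` and to the framing
  -- space through the arrow, so the rank is one.
  · let X : Submodule K T := S.framed.vertexSpace K T (.inl j) ⊓
      ((S.outKer K N j).restrictScalars K).comap π
    have hX : ∀ x : X, S.framed.e K (.inl j) • (x : T) = x := fun x =>
      (S.framed.mem_vertexSpace K).mp x.2.1
    let p : X →ₗ[K] S.vertexSpace K (S.outKer K N j) j :=
      { toFun := fun x => ⟨⟨π x, x.2.2⟩, (S.mem_vertexSpace K).mpr (hei _)⟩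
        map_add' := fun x y => Subtype.ext (Subtype.ext (map_add π x.1 y.1))
        map_smul' := fun t x => Subtype.ext (Subtype.ext (map_smul π t x.1)) }
    have hp : Function.Bijective p := by
      constructor
      · rw [injective_iff_map_eq_zero]
        intro x hx
        exact Subtype.ext (h.eq_zero (hX x) (congrArg (fun z => (z.1 : N)) hx))
      · intro y
        obtain ⟨x, hx, hxy⟩ := h.exists_eq (mem_outKer.mp y.1.2).1
        refine ⟨⟨x, (S.framed.mem_vertexSpace K).mpr hx, ?_⟩, Subtype.ext (Subtype.ext hxy)⟩
        change π x ∈ S.outKer K N j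
        rw [hxy]; exact y.1.2
    let q : X →ₗ[K] S.framed.vertexSpace K T (.inr j) :=
      ((Algebra.lsmul K K T (S.framed.arr K (.inr j) (.inl j) 0)).domRestrict X).codRestrict _
        fun x => (S.framed.mem_vertexSpace K).mpr (S.framed.e_arr_smul K _ _ _ _)
    have hq : Function.Bijective q := by
      constructor
      · rw [injective_iff_map_eq_zero]
        intro x hx
        exact Subtype.ext (hinj x (hX x) x.2.2 (congrArg Subtype.val hx))
      · intro y
        obtain ⟨x, hx, hx0, hxy⟩ := hs y.1 ((S.framed.mem_vertexSpace K).mp y.2)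
        exact ⟨⟨x, (S.framed.mem_vertexSpace K).mpr hx, (h.mem_outKer_iff hx).mpr hx0⟩,
          Subtype.ext hxy⟩
    have e1 := (LinearEquiv.ofBijective p hp).finrank_eq
    have e2 := (LinearEquiv.ofBijective q hq).finrank_eq
    have e3 := (hr (.inr j)).2
    rw [vdim, ← e2, e1] at e3
    exact e3

end SubOfQuotient

end CartanDatum

namespace CartanDatum

/-! ### Functionals and maps to `H_i` -/

section SocleFunctional

variable {ι : Type w} [Fintype ι] {S : CartanDatum ι} {K : Type u} [Field K]
  {M : Type v} [AddCommGroup M] [Module K M] [Module (S.Preproj K) M]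
  [IsScalarTower K (S.Preproj K) M]

variable (S) in
/-- The homomorphism to `H_i` defined by a functional. -/
noncomputable def coMap (i : ι) (χ : M →ₗ[K] K) : M →ₗ[K] Truncated K (S.c i) where
  toFun v := ∑ s ∈ Finset.range (S.c i), χ (S.eps K i ^ (S.c i - 1 - s) • S.e K i • v) •
    (Ideal.Quotient.mk _ Polynomial.X : Truncated K (S.c i)) ^ s
  map_add' v v' := by simp only [smul_add, map_add, add_smul, Finset.sum_add_distrib]
  map_smul' t v := by
    simp only [smul_comm_K, map_smul, smul_eq_mul, mul_smul, Finset.smul_sum, RingHom.id_apply]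

theorem coMap_apply (i : ι) (χ : M →ₗ[K] K) (v : M) : S.coMap i χ v =
    ∑ s ∈ Finset.range (S.c i), χ (S.eps K i ^ (S.c i - 1 - s) • S.e K i • v) •
    (Ideal.Quotient.mk _ Polynomial.X : Truncated K (S.c i)) ^ s := rfl

theorem coMap_e (i : ι) (χ : M →ₗ[K] K) (v : M) : S.coMap i χ (S.e K i • v) = S.coMap i χ v := by
  simp only [coMap_apply, e_e_smul]

/-- The coefficients of `coMap` are the values of `χ` along the `ε_i`-orbit in reverse order, so
multiplication by `X` shifts them as `ε_i` does. This expresses that `H_i` is a Frobenius algebra.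
-/
theorem coMap_eps (i : ι) (χ : M →ₗ[K] K) (v : M) :
    S.coMap i χ (S.eps K i • v) = Ideal.Quotient.mk _ Polynomial.X * S.coMap i χ v := by
  obtain ⟨n, hn⟩ : ∃ n, S.c i = n + 1 := ⟨S.c i - 1, by have := S.c_pos i; omega⟩
  have h1 : S.eps K i ^ (n + 1) = 0 := hn ▸ S.eps_pow K i
  have h2 : (Ideal.Quotient.mk _ Polynomial.X : Truncated K (S.c i)) ^ (n + 1) = 0 := by
    rw [← truncated_X_pow (K := K) (S.c i), hn]
  simp only [coMap_apply, e_eps_smul]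
  have hr : Finset.range (S.c i) = Finset.range (n + 1) := by rw [hn]
  have hc : S.c i - 1 = n := by omega
  rw [hr, hc, Finset.mul_sum, Finset.sum_range_succ', Finset.sum_range_succ]
  simp only [mul_smul_comm, ← pow_succ', h2, smul_zero, add_zero]
  rw [Nat.sub_zero, ← mul_smul, ← pow_succ, h1, zero_smul, map_zero, zero_smul, add_zero]
  refine Finset.sum_congr rfl fun s hs => ?_
  have hs := Finset.mem_range.mp hs
  have : S.eps K i • v = S.eps K i • S.e K i • v := (S.eps_e_smul K i v).symm
  rw [this, ← mul_smul, ← pow_succ, show n - (s + 1) + 1 = n - s by omega]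

theorem coMap_eq_of_eps_eq_zero {i : ι} (χ : M →ₗ[K] K) {v : M} (hv : S.e K i • v = v)
    (h0 : S.eps K i • v = 0) : S.coMap i χ v =
      χ v • (Ideal.Quotient.mk _ Polynomial.X : Truncated K (S.c i)) ^ (S.c i - 1) := by
  have := S.c_pos i
  rw [coMap_apply, Finset.sum_eq_single (S.c i - 1), Nat.sub_self, pow_zero, one_smul, hv]
  · intro s hs hne
    have hs := Finset.mem_range.mp hs
    obtain ⟨m, hm⟩ : ∃ m, S.c i - 1 - s = m + 1 := ⟨S.c i - 1 - s - 1, by omega⟩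
    rw [hv, hm, pow_succ, mul_smul, h0, smul_zero, map_zero, zero_smul]
  · intro h
    exact absurd (Finset.mem_range.mpr (by omega)) h

/-- In a generalized simple module, the kernel of `ε_i` is one-dimensional. -/
theorem IsGenSimple.exists_socle [DecidableEq ι] {i : ι} (h : S.IsGenSimple K M i) :
    ∃ z : M, z ≠ 0 ∧ ∀ x : M, S.e K i • x = x → S.eps K i • x = 0 → ∃ a : K, x = a • z := by
  obtain ⟨h1, h2, h3⟩ := h i
  have hst := S.vertexModule_isScalarTower K (M := M) i
  have hnt : Nontrivial (S.H K i) := ⟨_, 0, truncated_X_pow_ne (S.c_pos i)⟩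
  rw [Pi.single_eq_same] at h3
  obtain ⟨θ⟩ : Nonempty (S.vertexSpace K M i ≃ₗ[S.H K i] S.H K i) :=
    FiniteDimensional.nonempty_linearEquiv_of_finrank_eq
      (by rw [Module.finrank_self]; exact_mod_cast h3)
  refine ⟨(θ.symm (Ideal.Quotient.mk _ Polynomial.X ^ (S.c i - 1)) : M), ?_, fun x hx hx0 => ?_⟩
  · intro h0
    have := (LinearEquiv.map_eq_zero_iff θ.symm).mp (Subtype.ext h0)
    exact truncated_X_pow_ne (S.c_pos i) this
  · let y : S.vertexSpace K M i := ⟨x, (S.mem_vertexSpace K).mpr hx⟩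
    have h4 : Ideal.Quotient.mk _ Polynomial.X * θ y = 0 := by
      rw [← smul_eq_mul, ← map_smul, vertexModule_X_smul, LinearEquiv.map_eq_zero_iff]
      exact Subtype.ext hx0
    obtain ⟨q, hq⟩ := truncated_ker (S.c_pos i) _ h4
    obtain ⟨a, r, rfl⟩ := truncated_decomp _ q
    refine ⟨a, ?_⟩
    have h5 : θ y = a • (Ideal.Quotient.mk _ Polynomial.X : S.H K i) ^ (S.c i - 1) := by
      rw [hq, mul_add, ← mul_assoc, ← pow_succ, Nat.sub_add_cancel (S.c_pos i), truncated_X_pow,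
        zero_mul, add_zero, mul_comm, ← Algebra.smul_def]
    have h6 : y = a • θ.symm (Ideal.Quotient.mk _ Polynomial.X ^ (S.c i - 1)) := by
      rw [← θ.symm_apply_apply y, h5]
      exact (θ.symm.restrictScalars K).map_smul a _
    exact congrArg Subtype.val h6

/-- A finite-dimensional module with socle `E_i` has a functional which detects the socle. -/
theorem exists_coMap_injOn [DecidableEq ι] [Module.Finite K M] {i : ι}
    (h : S.IsGenSimple K (S.sub K M) i) : (∀ j, j ≠ i → S.outKer K M j = ⊥) ∧
      ∃ χ : M →ₗ[K] K, ∀ x ∈ S.outKer K M i, S.coMap i χ x = 0 → x = 0 := by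
  have hle : ∀ j, S.outKer K M j ≤ S.sub K M := fun j => by
    rw [← subAt_eq_outKer]
    exact le_iSup (fun j => S.subAt K M j) j
  have hr := (hasRankVec_iff' _ _ _ _).mp h
  have hbot : ∀ j, j ≠ i → S.outKer K M j = ⊥ := by
    intro j hj
    rw [Submodule.eq_bot_iff]
    intro x hx
    have := eq_zero_of_vdim_eq_zero (M := S.sub K M) (b := j) (x := ⟨x, hle j hx⟩)
      (by have := (hr j).2; simpa [hj] using this) (Subtype.ext (mem_outKer.mp hx).1)
    exact congrArg Subtype.val this
  refine ⟨hbot, ?_⟩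
  obtain ⟨z, hz, hzx⟩ := h.exists_socle
  obtain ⟨χ, hχ⟩ : ∃ χ : M →ₗ[K] K, χ z ≠ 0 := by
    by_contra! hne
    exact hz (Subtype.ext ((Module.forall_dual_apply_eq_zero_iff K (z : M)).mp hne))
  refine ⟨χ, ?_⟩
  have key : ∀ x ∈ S.outKer K M i, S.eps K i • x = 0 → S.coMap i χ x = 0 → x = 0 := by
    intro x hx hx0 hψ
    have he := (mem_outKer.mp hx).1
    obtain ⟨a, ha⟩ := hzx ⟨x, hle i hx⟩ (Subtype.ext he) (Subtype.ext hx0)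
    have ha : x = a • (z : M) := congrArg Subtype.val ha
    rw [coMap_eq_of_eps_eq_zero χ he hx0, smul_eq_zero_iff_left (truncated_X_pow_ne (S.c_pos i)),
      ha, map_smul, smul_eq_mul, mul_eq_zero] at hψ
    rw [ha, hψ.resolve_right hχ, zero_smul]
  -- On the socle elements killed by `ε_i` the map sees only `χ`, which is nonzero on this line.
  -- Nilpotency of `ε_i` reduces injectivity on all of `outKer` to that case.
  have key2 : ∀ n, ∀ x ∈ S.outKer K M i, S.eps K i ^ n • x = 0 → S.coMap i χ x = 0 → x = 0 := by
    intro n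
    induction n with
    | zero => intro x _ h0 _; rwa [pow_zero, one_smul] at h0
    | succ n ih =>
      intro x hx h0 hψ
      rw [pow_succ, mul_smul] at h0
      exact key x hx (ih _ ((S.outKer K M i).smul_mem _ hx) h0
        (by rw [coMap_eps, hψ, mul_zero])) hψ
  exact fun x hx => key2 (S.c i) x hx (by rw [eps_pow, zero_smul])

end SocleFunctional

/-! ### Framing a module by a map to `H_i` -/

section Coframing

variable {ι : Type w} [Fintype ι] [DecidableEq ι] {S : CartanDatum ι} {K : Type u} [Field K]
  {M : Type v} [AddCommGroup M] [Module K M] [Module (S.Preproj K) M]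
  [IsScalarTower K (S.Preproj K) M] (i : ι)

/-- The operators of the framed module defined by a map from `M` to `H_i`. -/
noncomputable def coframeOp (ψ : M →ₗ[K] Truncated K (S.c i)) :
    Gen (ι ⊕ ι) → Module.End K (M × Truncated K (S.c i))
  | .e (.inl j) => LinearMap.prodMap (Algebra.lsmul K K M (S.e K j)) 0
  | .e (.inr j) => if j = i then LinearMap.prodMap 0 LinearMap.id else 0
  | .eps (.inl j) => LinearMap.prodMap (Algebra.lsmul K K M (S.eps K j)) 0
  | .eps (.inr j) => if j = i then
      LinearMap.prodMap 0 (LinearMap.mulLeft K (Ideal.Quotient.mk _ Polynomial.X)) else 0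
  | .arr (.inl a) (.inl b) k => LinearMap.prodMap (Algebra.lsmul K K M (S.arr K a b k)) 0
  | .arr (.inr a) (.inl b) k => if a = i ∧ b = i ∧ k = 0 then
      LinearMap.inr K _ _ ∘ₗ ψ ∘ₗ LinearMap.fst K _ _ else 0
  | .arr _ (.inr _) _ => 0

variable {i} {ψ : M →ₗ[K] Truncated K (S.c i)}

theorem coframeOp_e_inl (j : ι) (x : M × Truncated K (S.c i)) :
    S.coframeOp i ψ (.e (.inl j)) x = (S.e K j • x.1, 0) := rfl

theorem coframeOp_e_inr (x : M × Truncated K (S.c i)) :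
    S.coframeOp i ψ (.e (.inr i)) x = (0, x.2) := by simp [coframeOp]

theorem coframeOp_e_inr_ne {j : ι} (h : j ≠ i) : S.coframeOp i ψ (.e (.inr j)) = 0 := by
  simp [coframeOp, h]

theorem coframeOp_eps_inl (j : ι) (x : M × Truncated K (S.c i)) :
    S.coframeOp i ψ (.eps (.inl j)) x = (S.eps K j • x.1, 0) := rfl

theorem coframeOp_eps_inr (x : M × Truncated K (S.c i)) :
    S.coframeOp i ψ (.eps (.inr i)) x = (0, Ideal.Quotient.mk _ Polynomial.X * x.2) := by
  simp [coframeOp]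

theorem coframeOp_eps_inr_ne {j : ι} (h : j ≠ i) : S.coframeOp i ψ (.eps (.inr j)) = 0 := by
  simp [coframeOp, h]

theorem coframeOp_arr_inl (a b : ι) (k : ℕ) (x : M × Truncated K (S.c i)) :
    S.coframeOp i ψ (.arr (.inl a) (.inl b) k) x = (S.arr K a b k • x.1, 0) := rfl

theorem coframeOp_arr_inr (x : M × Truncated K (S.c i)) :
    S.coframeOp i ψ (.arr (.inr i) (.inl i) 0) x = (0, ψ x.1) := by simp [coframeOp]

theorem coframeOp_arr_inr_ne {a b : ι} {k : ℕ} (h : ¬ (a = i ∧ b = i ∧ k = 0)) :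
    S.coframeOp i ψ (.arr (.inr a) (.inl b) k) = 0 := by
  simp only [coframeOp, if_neg h]

theorem coframeOp_arr_right (a : ι ⊕ ι) (b : ι) (k : ℕ) :
    S.coframeOp i ψ (.arr a (.inr b) k) = 0 := by
  rcases a with a | a <;> rfl

theorem coframeOp_eps_inl_pow (j : ι) (n : ℕ) (x : M × Truncated K (S.c i)) :
    ((S.coframeOp i ψ (.eps (.inl j)) ^ n) x).1 = S.eps K j ^ n • x.1 := by
  induction n with
  | zero => simp
  | succ n ih => rw [pow_succ', Module.End.mul_apply, coframeOp_eps_inl, ih, pow_succ', mul_smul]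

theorem coframeOp_eps_inl_pow_zero (j : ι) (n : ℕ) (m : M) :
    (S.coframeOp i ψ (.eps (.inl j)) ^ n) (m, 0) = (S.eps K j ^ n • m, 0) := by
  induction n with
  | zero => simp
  | succ n ih => rw [pow_succ', Module.End.mul_apply, ih, coframeOp_eps_inl, pow_succ', mul_smul]

theorem coframeOp_eps_inr_pow (n : ℕ) (x : M × Truncated K (S.c i)) :
    ((S.coframeOp i ψ (.eps (.inr i)) ^ n) x).2 = Ideal.Quotient.mk _ Polynomial.X ^ n * x.2 := by
  induction n with
  | zero => simp
  | succ n ih => rw [pow_succ', Module.End.mul_apply, coframeOp_eps_inr, ih, pow_succ', mul_assoc]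

/-- All arrows out of the framing vertices are zero, so the mesh relations acquire no new terms. The
only new commutation relation is the linearity of `ψ` over `H_i`. -/
theorem coframeOp_isRep (hψe : ∀ v, ψ (S.e K i • v) = ψ v)
    (hψ : ∀ v, ψ (S.eps K i • v) = Ideal.Quotient.mk _ Polynomial.X * ψ v) :
    S.framed.IsRep K (S.coframeOp i ψ) where
  idem b x := by
    rcases b with j | j
    · simp only [coframeOp_e_inl, e_e_smul]
    · by_cases h : j = i
      · subst h; simp only [coframeOp_e_inr]
      · simp only [coframeOp_e_inr_ne h, LinearMap.zero_apply]
  orth a b x h := by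
    rcases a with a | a <;> rcases b with b | b
    · simp only [coframeOp_e_inl, e_e_smul_ne S K (show a ≠ b by simpa using h)]
      rfl
    · by_cases hb : b = i
      · subst hb; simp [coframeOp_e_inl, coframeOp_e_inr]
      · simp [coframeOp_e_inr_ne hb]
    · by_cases hb : a = i
      · subst hb; simp [coframeOp_e_inl, coframeOp_e_inr]
      · simp [coframeOp_e_inr_ne hb]
    · by_cases hb : b = i
      · have ha : a ≠ i := fun ha => h (by rw [ha, hb])
        simp [coframeOp_e_inr_ne ha]
      · simp [coframeOp_e_inr_ne hb]
  one x := by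
    rw [Fintype.sum_sum_type, Finset.sum_eq_single (s := Finset.univ) (f := fun j =>
      S.coframeOp i ψ (.e (.inr j)) x) i]
    · simp only [coframeOp_e_inl, coframeOp_e_inr]
      refine Prod.ext ?_ ?_
      · simp [Prod.fst_sum, sum_e_smul]
      · simp [Prod.snd_sum]
    · intro j _ hj
      rw [coframeOp_e_inr_ne hj, LinearMap.zero_apply]
    · simp
  eps_vertex b x := by
    rcases b with j | j
    · simp only [coframeOp_e_inl, coframeOp_eps_inl, eps_e_smul, e_eps_smul]
    · by_cases h : j = i
      · subst h; simp only [coframeOp_e_inr, coframeOp_eps_inr]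
      · simp only [coframeOp_e_inr_ne h, coframeOp_eps_inr_ne h, LinearMap.zero_apply]
  arr_vertex a b k x := by
    rcases b with b | b
    · rcases a with a | a
      · simp only [coframeOp_e_inl, coframeOp_arr_inl, arr_e_smul, e_arr_smul]
      · by_cases h : a = i ∧ b = i ∧ k = 0
        · obtain ⟨rfl, rfl, rfl⟩ := h
          simp only [coframeOp_e_inl, coframeOp_arr_inr, coframeOp_e_inr, hψe]
        · simp [coframeOp_arr_inr_ne h]
    · simp [coframeOp_arr_right]
  arr_zero a b k h x := by
    rcases b with b | b
    · rcases a with a | a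
      · rw [coframeOp_arr_inl, S.arr_eq_zero K a b k h, zero_smul]; rfl
      · rw [coframeOp_arr_inr_ne, LinearMap.zero_apply]
        rintro ⟨rfl, rfl, rfl⟩
        apply h
        rw [framed_g_inr_inl, framed_C_inr_inl]
        simp
    · rw [coframeOp_arr_right, LinearMap.zero_apply]
  nilp b x := by
    obtain ⟨n, hn⟩ : ∃ n, S.framed.c b = n + 1 :=
      ⟨S.framed.c b - 1, by have := S.framed.c_pos b; omega⟩
    rcases b with j | j
    · refine Prod.ext ?_ ?_
      · rw [coframeOp_eps_inl_pow, framed_c_inl, eps_pow, zero_smul]; rfl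
      · rw [hn, pow_succ', Module.End.mul_apply, coframeOp_eps_inl]; rfl
    · by_cases h : j = i
      · subst h
        refine Prod.ext ?_ ?_
        · rw [hn, pow_succ', Module.End.mul_apply, coframeOp_eps_inr]; rfl
        · rw [coframeOp_eps_inr_pow, framed_c_inr, truncated_X_pow, zero_mul]; rfl
      · rw [hn, pow_succ', Module.End.mul_apply, coframeOp_eps_inr_ne h, LinearMap.zero_apply]
  comm a b k hC hk x := by
    rcases b with b | b
    · rcases a with a | a
      · rw [coframeOp_arr_inl, coframeOp_arr_inl, coframeOp_eps_inl_pow,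
          coframeOp_eps_inl_pow_zero]
        exact congrArg (fun m => (m, 0)) (S.eps_arr_smul K a b k x.1)
      · by_cases h : a = i ∧ b = i ∧ k = 0
        · obtain ⟨rfl, rfl, rfl⟩ := h
          rw [framed_f_inr_inl, framed_f_inl_inr, pow_one, pow_one, coframeOp_arr_inr,
            coframeOp_arr_inr, coframeOp_eps_inr, coframeOp_eps_inl, hψ]
        · simp [coframeOp_arr_inr_ne h]
    · simp [coframeOp_arr_right]
  mesh b x := by
    rcases b with j | j
    · have h := congrArg (fun a => a • x.1) (S.mesh K j)
      simp only [Finset.sum_filter, Finset.sum_smul, ite_smul, zero_smul, smul_assoc,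
        mul_smul] at h
      simp only [Finset.sum_filter, Fintype.sum_sum_type, coframeOp_arr_right,
        LinearMap.zero_apply, map_zero, smul_zero, Finset.sum_const_zero, ite_self, add_zero,
        coframeOp_arr_inl, coframeOp_eps_inl_pow, coframeOp_eps_inl_pow_zero]
      refine Prod.ext ?_ ?_
      · rw [Prod.fst_sum, Prod.fst_zero, ← h]
        refine Finset.sum_congr rfl fun b _ => ?_
        change (if S.C b j < 0 then _ else _ : M × Truncated K (S.c i)).1 = _
        split_ifs
        · simp only [Prod.fst_sum]
          rfl
        · rfl
      · rw [Prod.snd_sum, Prod.snd_zero]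
        refine Finset.sum_eq_zero fun b _ => ?_
        split_ifs
        · simp [Prod.snd_sum]
        · rfl
    · simp [coframeOp_arr_right]

end Coframing

end CartanDatum

namespace CartanDatum

/-! ### Prestability and rank vector of the coframed module -/

section Coframe

variable {ι : Type w} [Fintype ι] [DecidableEq ι] {S : CartanDatum ι} {K : Type u} [Field K]
  {M : Type v} [AddCommGroup M] [Module K M] [Module (S.Preproj K) M]
  [IsScalarTower K (S.Preproj K) M] {i : ι} {ψ : M →ₗ[K] Truncated K (S.c i)}

/-- The framed module defined by a map from `M` to `H_i`. -/
abbrev Coframe (hψe : ∀ v, ψ (S.e K i • v) = ψ v)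
    (hψ : ∀ v, ψ (S.eps K i • v) = Ideal.Quotient.mk _ Polynomial.X * ψ v) :=
  RepMod (coframeOp_isRep hψe hψ)

variable (hψe : ∀ v, ψ (S.e K i • v) = ψ v)
  (hψ : ∀ v, ψ (S.eps K i • v) = Ideal.Quotient.mk _ Polynomial.X * ψ v)

theorem coframe_isUnframing : IsUnframing (S := S) (T := Coframe hψe hψ)
    (LinearMap.fst K M (Truncated K (S.c i)) ∘ₗ (RepMod.of _).symm.toLinearMap) where
  surj m := ⟨RepMod.of _ (m, 0), rfl⟩
  ker x := by
    obtain ⟨x, rfl⟩ := (RepMod.of _).surjective x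
    simp only [RepMod.e_smul, coframeOp_e_inl, LinearEquiv.map_eq_zero_iff]
    change x.1 = 0 ↔ _
    constructor
    · intro h j
      rw [h, smul_zero]; rfl
    · intro h
      rw [← S.sum_e_smul K x.1]
      exact Finset.sum_eq_zero fun j _ => congrArg Prod.fst (h j)
  smul := by
    refine map_smul_of_framed_gens ?_ ?_ ?_ ?_ ?_
    · intro x hx
      obtain ⟨x, rfl⟩ := (RepMod.of _).surjective x
      simp only [RepMod.e_smul, coframeOp_e_inl, LinearEquiv.map_eq_zero_iff] at hx
      change x.1 = 0
      rw [← S.sum_e_smul K x.1]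
      exact Finset.sum_eq_zero fun j _ => congrArg Prod.fst (hx j)
    · intro j x
      obtain ⟨x, rfl⟩ := (RepMod.of _).surjective x
      rw [RepMod.e_smul]; rfl
    · intro j x
      obtain ⟨x, rfl⟩ := (RepMod.of _).surjective x
      rw [RepMod.eps_smul]; rfl
    · intro a b k x
      obtain ⟨x, rfl⟩ := (RepMod.of _).surjective x
      rw [RepMod.arr_smul]; rfl
    · intro a b k x
      obtain ⟨x, rfl⟩ := (RepMod.of _).surjective x
      rw [RepMod.arr_smul]; rfl

/-- The framing arrow at `i` is `ψ`, so it is enough that `ψ` be injective on the part of the socle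
at `i` and that the other parts vanish. -/
theorem coframe_prestable (h : ∀ j, j ≠ i → S.outKer K M j = ⊥)
    (h' : ∀ x ∈ S.outKer K M i, ψ x = 0 → x = 0) : S.Prestable K (Coframe hψe hψ) := by
  intro j
  rw [outInj_inl_iff]
  intro x hx h1 h2
  have hm := ((coframe_isUnframing hψe hψ).mem_outKer_iff hx).mpr h1
  obtain ⟨x, rfl⟩ := (RepMod.of _).surjective x
  rw [RepMod.e_smul] at hx
  have hx2 : x.2 = 0 := (congrArg Prod.snd ((RepMod.of _).injective hx)).symm
  change x.1 ∈ S.outKer K M j at hm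
  have hx1 : x.1 = 0 := by
    by_cases hj : j = i
    · subst hj
      rw [RepMod.arr_smul, coframeOp_arr_inr, LinearEquiv.map_eq_zero_iff] at h2
      exact h' _ hm (congrArg Prod.snd h2)
    · rw [h j hj] at hm
      exact (Submodule.mem_bot _).mp hm
  rw [show x = 0 from Prod.ext hx1 hx2, map_zero]

theorem coframe_hasRankVec {ν : ι → ℤ} (hM : S.HasRankVec K M ν) :
    S.framed.HasRankVec K (Coframe hψe hψ) (Sum.elim ν (Pi.single i 1)) := by
  have := hM.finite
  have := truncated_finite (K := K) (S.c i)
  have : Module.Finite K (Coframe hψe hψ) :=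
    inferInstanceAs (Module.Finite K (M × Truncated K (S.c i)))
  have hun := coframe_isUnframing hψe hψ
  have hr := coframeOp_isRep hψe hψ
  rw [hasRankVec_iff'] at hM ⊢
  rintro (j | j)
  · refine ⟨fun x hx hx0 => ?_, by rw [hun.vdim_eq, (hM j).2]; rfl⟩
    obtain ⟨x, rfl⟩ := (RepMod.of hr).surjective x
    rw [RepMod.e_smul, coframeOp_e_inl] at hx
    have hx := (RepMod.of hr).injective hx
    rw [RepMod.eps_smul, coframeOp_eps_inl, LinearEquiv.map_eq_zero_iff] at hx0
    obtain ⟨y, hy, hyx⟩ := (hM j).1 x.1 (congrArg Prod.fst hx) (congrArg Prod.fst hx0)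
    refine ⟨RepMod.of hr (y, 0), ?_, ?_⟩
    · rw [RepMod.e_smul, coframeOp_e_inl, hy]
    · rw [RepMod.eps_pow_smul, coframeOp_eps_inl_pow_zero]
      exact congrArg _ (Prod.ext hyx (congrArg Prod.snd hx :))
  · by_cases hj : j = i
    · subst hj
      constructor
      · intro x hx hx0
        obtain ⟨x, rfl⟩ := (RepMod.of hr).surjective x
        rw [RepMod.e_smul, coframeOp_e_inr] at hx
        have hx := (RepMod.of hr).injective hx
        rw [RepMod.eps_smul, coframeOp_eps_inr, LinearEquiv.map_eq_zero_iff] at hx0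
        obtain ⟨q, hq⟩ := truncated_ker (S.c_pos j) x.2 (congrArg Prod.snd hx0)
        have hy : S.framed.e K (.inr j) • RepMod.of hr (0, q) = RepMod.of hr (0, q) := by
          rw [RepMod.e_smul, coframeOp_e_inr]
        refine ⟨RepMod.of hr (0, q), hy, ?_⟩
        rw [← S.framed.e_eps_pow_smul K _ _ _ hy, RepMod.eps_pow_smul, RepMod.e_smul,
          coframeOp_e_inr, coframeOp_eps_inr_pow]
        exact congrArg _ (Prod.ext (congrArg Prod.fst hx :) hq.symm)
      · let φ : Truncated K (S.c j) →ₗ[K] S.framed.vertexSpace K (Coframe hψe hψ) (.inr j) :=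
          ((RepMod.of hr).toLinearMap ∘ₗ LinearMap.inr K M _).codRestrict _ fun q => by
            rw [mem_vertexSpace]
            change S.framed.e K (.inr j) • RepMod.of hr (0, q) = RepMod.of hr (0, q)
            rw [RepMod.e_smul, coframeOp_e_inr]
        have hφ : Function.Bijective φ := by
          constructor
          · intro q q' h
            exact congrArg Prod.snd ((RepMod.of hr).injective (congrArg Subtype.val h))
          · intro y
            obtain ⟨x, hx⟩ := (RepMod.of hr).surjective y.1
            refine ⟨x.2, Subtype.ext ?_⟩
            have := (S.framed.mem_vertexSpace K).mp y.2
            rw [← hx, RepMod.e_smul, coframeOp_e_inr] at this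
            rw [← hx]
            exact this
        rw [vdim, ← (LinearEquiv.ofBijective φ hφ).finrank_eq, truncated_finrank, framed_c_inr]
        simp
    · have h0 : ∀ x : Coframe hψe hψ, S.framed.e K (.inr j) • x = 0 := fun x => by
        obtain ⟨x, rfl⟩ := (RepMod.of hr).surjective x
        rw [RepMod.e_smul, coframeOp_e_inr_ne hj, LinearMap.zero_apply, map_zero]
      constructor
      · intro x hx _
        exact ⟨0, smul_zero _, by rw [smul_zero, ← hx, h0]⟩
      · have e : S.framed.vertexSpace K (Coframe hψe hψ) (.inr j) = ⊥ := by
          ext y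
          rw [mem_vertexSpace, h0, Submodule.mem_bot, eq_comm]
        rw [vdim, e]
        simp [hj]

end Coframe

/-! ### Choice of the modules for each weight -/

section Family

variable {ι : Type w} [Fintype ι] [DecidableEq ι] {S : CartanDatum ι} {K : Type u} [Field K]

theorem disp_add (x : ExtLattice ι ≃ₗ[ℤ] ExtLattice ι) (l m : ι → ℤ) :
    disp x (l + m) = disp x l + disp x m := by
  unfold disp
  rw [← Prod.fst_add, show ((0, l + m) : ExtLattice ι) = (0, l) + (0, m) by simp, map_add]
  congr 1
  abel

theorem disp_neg (x : ExtLattice ι ≃ₗ[ℤ] ExtLattice ι) (l : ι → ℤ) : disp x (-l) = -disp x l := by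
  have h := disp_add x l (-l)
  have h0 : disp x (0 : ι → ℤ) = 0 := by
    unfold disp
    rw [show ((0, 0) : ExtLattice ι) = 0 from rfl, map_zero, sub_zero]
    rfl
  rw [add_neg_cancel, h0] at h
  exact (neg_eq_of_add_eq_zero_right h.symm).symm

theorem act_add (x : ExtLattice ι ≃ₗ[ℤ] ExtLattice ι) (l m : ι → ℤ) :
    S.act x (l + m) = S.act x l + S.act x m := by
  unfold act toWeight
  rw [show ((0, l + m) : ExtLattice ι) = (0, l) + (0, m) by simp, map_add, Prod.fst_add,
    Prod.snd_add, Matrix.mulVec_add]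
  abel

theorem AntiDominant.add {l m : ι → ℤ} (hl : AntiDominant l) (hm : AntiDominant m) :
    AntiDominant (l + m) := fun i => add_nonpos (hl i) (hm i)

theorem antiDominant_neg_single (i : ι) : AntiDominant (-Pi.single i 1 : ι → ℤ) := by
  intro j
  by_cases hj : j = i
  · subst hj; simp
  · simp [hj]

/-- A model depends on the group element only through the displacement, so one module can serve all
presentations of a weight. -/
theorem IsGoodModel.congr {x y : ExtLattice ι ≃ₗ[ℤ] ExtLattice ι} {l : ι → ℤ} {T : Type*}
    [AddCommGroup T] [Module K T] [Module (S.FPreproj K) T] [IsScalarTower K (S.FPreproj K) T]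
    (h : S.IsGoodModel K x l T) (he : disp x l = disp y l) : S.IsGoodModel K y l T :=
  ⟨⟨h.prestable, he ▸ h.rank, h.filtered⟩, h.exists_embedding, h.quotient_filtered,
    fun i hi hd => h.socleSurj i hi (he ▸ hd)⟩

theorem IsGoodModel.exists_unframing {x : ExtLattice ι ≃ₗ[ℤ] ExtLattice ι} {l : ι → ℤ}
    (hl : AntiDominant l) {T : Type*} [AddCommGroup T] [Module K T] [Module (S.FPreproj K) T]
    [IsScalarTower K (S.FPreproj K) T] (h : S.IsGoodModel K x l T) :
    ∃ (N : FinDimMod K (S.Preproj K)) (π : T →ₗ[K] N), IsUnframing (S := S) π := by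
  have := h.rank.finite
  obtain ⟨j, hj⟩ := h.exists_embedding
  exact CartanDatum.exists_unframing (arr_inl_inr_smul hl h.rank hj)

variable (S K) in
/-- Stable framed modules and their quotients, chosen for each weight. -/
theorem exists_family : ∃ (Nt : (ι → ℤ) → FinDimMod K (S.FPreproj K))
    (N : (ι → ℤ) → FinDimMod K (S.Preproj K)), ∀ x ∈ S.W, ∀ l : ι → ℤ, AntiDominant l →
      S.IsGoodModel K x l (Nt (S.act x l)) ∧
      ∃ π : Nt (S.act x l) →ₗ[K] N (S.act x l), IsUnframing (S := S) π := by
  have h : ∀ γ : ι → ℤ, ∃ (T : FinDimMod K (S.FPreproj K)) (N : FinDimMod K (S.Preproj K)),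
      ∀ x ∈ S.W, ∀ l : ι → ℤ, AntiDominant l → γ = S.act x l →
        S.IsGoodModel K x l T ∧ ∃ π : T →ₗ[K] N, IsUnframing (S := S) π := by
    intro γ
    by_cases hγ : ∃ x ∈ S.W, ∃ l : ι → ℤ, AntiDominant l ∧ γ = S.act x l
    · obtain ⟨x, hx, l, hl, rfl⟩ := hγ
      obtain ⟨T, hT⟩ := (S.red_of_mem hx).exists_goodModel (K := K) hl
      obtain ⟨N, π, hπ⟩ := hT.exists_unframing hl
      refine ⟨T, N, fun y hy m hm he => ⟨?_, π, hπ⟩⟩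
      obtain ⟨rfl, h2⟩ := S.act_inj hx hy hl hm he
      exact hT.congr (by rw [Red.disp_eq, Red.disp_eq, h2])
    -- Weights outside the orbits of anti-dominant ones receive arbitrary modules, about which
    -- nothing is claimed.
    · have hl : AntiDominant (0 : ι → ℤ) := fun _ => le_rfl
      obtain ⟨T, hT⟩ := exists_goodModel_one (S := S) (K := K) hl
      obtain ⟨N, -⟩ := hT.exists_unframing hl
      exact ⟨T, N, fun x hx l hl he => absurd ⟨x, hx, l, hl, he⟩ hγ⟩
  choose Nt N hN using h
  exact ⟨Nt, N, fun x hx l hl => hN _ x hx l hl rfl⟩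

/-- A module with socle `E_i` and the right rank vector is the quotient of a stable module. -/
theorem Red.nonempty_equiv_of_isGenSimple_sub {x : ExtLattice ι ≃ₗ[ℤ] ExtLattice ι}
    (hx : S.Red x) {i : ι} {T : Type*} [AddCommGroup T] [Module K T] [Module (S.FPreproj K) T]
    [IsScalarTower K (S.FPreproj K) T] (hT : S.IsModel K x (-Pi.single i 1) T)
    {N : Type*} [AddCommGroup N] [Module K N] [Module (S.Preproj K) N]
    [IsScalarTower K (S.Preproj K) N] {π : T →ₗ[K] N} (hπ : IsUnframing (S := S) π)
    {M : Type*} [AddCommGroup M] [Module K M] [Module (S.Preproj K) M]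
    [IsScalarTower K (S.Preproj K) M] [Module.Finite K M]
    (hM : S.HasRankVec K M (disp x (-Pi.single i 1))) (hs : S.IsGenSimple K (S.sub K M) i) :
    Nonempty (M ≃ₗ[S.Preproj K] N) := by
  obtain ⟨h1, χ, hχ⟩ := exists_coMap_injOn hs
  have hr := coframe_hasRankVec (coMap_e i χ) (coMap_eps i χ) hM
  -- The coframed module is not known to be `𝔼`-filtered, but prestability and the rank vector
  -- suffice for uniqueness.
  obtain ⟨e⟩ := hx.nonempty_equiv _ T (coframe_prestable (coMap_e i χ) (coMap_eps i χ) h1 hχ)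
    hT.prestable (by rwa [neg_neg]) hT.rank
  exact (coframe_isUnframing (coMap_e i χ) (coMap_eps i χ)).nonempty_equiv hπ e

end Family

end CartanDatum

/-! ### The theorem -/

theorem theorem3 {ι : Type w} [Fintype ι] [DecidableEq ι] (S : CartanDatum ι)
    (K : Type u) [Field K] :
    ∃ (Nt : (ι → ℤ) → CartanDatum.FinDimMod K (S.FPreproj K))
      (N : (ι → ℤ) → CartanDatum.FinDimMod K (S.Preproj K)),
      -- `Nt (w l)` is the unique stable module with rank vector `(w l - l, l)`
      (∀ x ∈ S.W, ∀ l : ι → ℤ, CartanDatum.AntiDominant l →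
        S.IsStable K (Nt (S.act x l)) ∧
        S.framed.HasRankVec K (Nt (S.act x l)) (Sum.elim (CartanDatum.disp x l) (-l)) ∧
        ∀ (T : Type v) [AddCommGroup T] [Module K T] [Module (S.FPreproj K) T]
          [IsScalarTower K (S.FPreproj K) T], S.IsStable K T →
          S.framed.HasRankVec K T (Sum.elim (CartanDatum.disp x l) (-l)) →
          Nonempty (T ≃ₗ[S.FPreproj K] Nt (S.act x l))) ∧
      -- `N (w l)` is the quotient of `Nt (w l)` by its submodule `Nt l`
      (∀ x ∈ S.W, ∀ l : ι → ℤ, CartanDatum.AntiDominant l →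
        (∃ j : Nt l →ₗ[S.FPreproj K] Nt (S.act x l), Function.Injective j) ∧
        ∀ j : Nt l →ₗ[S.FPreproj K] Nt (S.act x l), Function.Injective j →
          ∃ φ : (Nt (S.act x l) ⧸ LinearMap.range j) ≃ₗ[K] N (S.act x l),
            ∀ (a : S.FPreproj K) y, φ (a • y) = S.unframe K a • φ y) ∧
      -- (1)
      (∀ γ : ι → ℤ, CartanDatum.AntiDominant γ → Subsingleton (N γ)) ∧
      -- (2)
      (∀ x ∈ S.W, ∀ i : ι, -CartanDatum.disp x (Pi.single i 1) ≠ 0 →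
        S.IsEFiltered K (N (S.act x (-Pi.single i 1))) ∧
        S.HasRankVec K (N (S.act x (-Pi.single i 1))) (-CartanDatum.disp x (Pi.single i 1)) ∧
        S.IsGenSimple K (S.sub K (N (S.act x (-Pi.single i 1)))) i ∧
        ∀ (M : Type v) [AddCommGroup M] [Module K M] [Module (S.Preproj K) M]
          [IsScalarTower K (S.Preproj K) M] [Module.Finite K M],
          S.HasRankVec K M (-CartanDatum.disp x (Pi.single i 1)) →
          S.IsGenSimple K (S.sub K M) i →
          Nonempty (M ≃ₗ[S.Preproj K] N (S.act x (-Pi.single i 1)))) ∧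
      -- (3)
      (∀ γ δ : ι → ℤ, S.SameChamber γ δ →
        Nonempty (N (γ + δ) ≃ₗ[S.Preproj K] (N γ × N δ))) := by
  obtain ⟨Nt, N, hN⟩ := CartanDatum.exists_family S K
  have hone : ∀ l : ι → ℤ, CartanDatum.AntiDominant l → S.IsGoodModel K 1 l (Nt l) ∧
      ∃ π : Nt l →ₗ[K] N l, CartanDatum.IsUnframing (S := S) π := fun l hl => by
    have := hN 1 S.W.one_mem l hl
    rwa [S.act_one] at this
  have hzero : ∀ l : ι → ℤ, CartanDatum.AntiDominant l → ∀ i,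
      S.framed.vdim K (Nt l) (.inl i) = 0 := fun l hl i => by
    have := ((CartanDatum.hasRankVec_iff' _ _ _ _).mp (hone l hl).1.rank (.inl i)).2
    simpa [CartanDatum.disp_one] using this
  have he0 : ∀ l : ι → ℤ, CartanDatum.AntiDominant l → ∀ i, ∀ y : Nt l,
      S.framed.e K (.inl i) • y = 0 := fun l hl i y =>
    CartanDatum.eq_zero_of_vdim_eq_zero (hzero l hl i) (S.framed.e_e_smul K _ y)
  refine ⟨Nt, N, ?_, ?_, ?_, ?_, ?_⟩
  · intro x hx l hl
    obtain ⟨hT, -⟩ := hN x hx l hl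
    refine ⟨CartanDatum.isStable_iff.mpr ⟨hT.filtered, hT.prestable⟩, hT.rank, ?_⟩
    intro T _ _ _ _ hT' hr
    have := hr.finite
    exact (S.red_of_mem hx).nonempty_equiv T _ (CartanDatum.isStable_iff.mp hT').2 hT.prestable
      hr hT.rank
  · intro x hx l hl
    obtain ⟨hT, π, hπ⟩ := hN x hx l hl
    have hB := (hone l hl).1.rank
    rw [CartanDatum.disp_one] at hB
    constructor
    · obtain ⟨j, hj⟩ := hT.exists_embedding
      -- The module of an anti-dominant weight is supported on the framing vertices, between which
      -- there are no arrows, so it is the base of the construction up to isomorphism.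
      obtain ⟨e⟩ := CartanDatum.nonempty_equiv_of_arr_eq_zero hB
        (CartanDatum.fbase_hasRankVec (S := S) (K := K) hl)
        (CartanDatum.arr_eq_zero_of_inl (hzero l hl)) fun a b k x => CartanDatum.base_arr _ a b k x
      exact ⟨j ∘ₗ e.toLinearMap, hj.comp e.injective⟩
    · intro j hj
      -- The image of any injective map is forced: it vanishes at the original vertices and fills
      -- the framing part because the ranks agree.
      refine hπ.exists_coker_equiv (fun i y => ?_)
        (CartanDatum.covers_inr_of_hasRankVec hB hT.rank hj)
      rw [← map_smul, he0 l hl, map_zero]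
  · intro l hl
    obtain ⟨π, hπ⟩ := (hone l hl).2
    exact CartanDatum.subsingleton_of_vdim_eq_zero (S := S) (K := K) fun i => by
      rw [← hπ.vdim_eq, hzero l hl]
  · intro x hx i hd
    have hl := CartanDatum.antiDominant_neg_single i
    obtain ⟨hT, π, hπ⟩ := hN x hx _ hl
    rw [← CartanDatum.disp_neg] at hd ⊢
    have hr := hT.rank
    refine ⟨hT.quotient_filtered _ π hπ, hπ.hasRankVec hr, ?_, ?_⟩
    · rw [neg_neg] at hr
      exact hπ.isGenSimple_sub hT.prestable hr (hT.socleSurj i rfl hd)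
    · intro M _ _ _ _ _ hM hs
      exact (S.red_of_mem hx).nonempty_equiv_of_isGenSimple_sub hT.toIsModel hπ hM hs
  · rintro γ δ ⟨x, hx, l, m, hl, hm, rfl, rfl⟩
    obtain ⟨h1, π1, hπ1⟩ := hN x hx l hl
    obtain ⟨h2, π2, hπ2⟩ := hN x hx m hm
    have h := hN x hx _ (hl.add hm)
    rw [CartanDatum.act_add] at h
    obtain ⟨h3, π3, hπ3⟩ := h
    have hr := h1.rank.prod h2.rank
    have e : Sum.elim (CartanDatum.disp x l) (-l) + Sum.elim (CartanDatum.disp x m) (-m) =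
        Sum.elim (CartanDatum.disp x (l + m)) (-(l + m)) := by
      rw [CartanDatum.disp_add, neg_add]
      ext (i | i) <;> rfl
    rw [e] at hr
    -- The product is prestable and displacements are additive, so uniqueness identifies it with the
    -- module of the sum. The isomorphism then descends to the quotients.
    obtain ⟨φ⟩ := (S.red_of_mem hx).nonempty_equiv _ _ h3.prestable
      (fun i => (h1.prestable i).prod (h2.prestable i)) h3.rank hr
    exact hπ3.nonempty_equiv (hπ1.prod hπ2) φ
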